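/- Let $A=(A_1,A_2,\ldots)$ be a sequence of non-negative random variables such that $N:=\max\{j:A_j\neq0\}$ (with $\max\emptyset=0$) is finite almost surely, and let $\mu_0$ be a probability measure on $\mathbb R$. For a probability measure $\mu$ on $\mathbb R$ let $Q(\mu)$ be the law of $\sum_{j=1}^N A_jX_j$, where $X_1,X_2,\ldots$ are i.i.d. with law $\mu$ and independent of $A$. Consider the equation $$\partial_t\mu_t+\mu_t=Q(\mu_t),\qquad t\ge0, \qquad (*)$$ with initial value $\mu_0$, for families $(\mu_t)_{t\ge0}$ of probability measures on $\mathbb R$, in the weak sense: for every bounded continuous $f:\mathbb R\to\mathbb R$, the function $t\mapsto\int f\,d\mu_t$ is differentiable on $[0,\infty)$ with derivative $\int f\,dQ(\mu_t)-\int f\,d\mu_t$. Put $\Phi(\theta)=\mathbb E\big[\sum_{j=1}^NA_j^\theta\big]-1$, and for $\gamma\in(0,2]$ let $\mathcal M^1_\gamma(\mathbb R)$ be the set of probability measures on $\mathbb R$ with finite absolute moment of order $\gamma$, centered if $\gamma>1$. Branching random walk: let $\mathcal I=\bigcup_{n\ge0}\mathbb N^n$. On a probability space let $(A(u),E(u))$,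 $u\in\mathcal I$, be i.i.d. copies of $(A,E)$, where $E$ is a unit-mean exponential variable independent of $A$, and, independently of them, let $X_u$, $u\in\mathcal I$, be i.i.d. with law $\mu_0$. For $u=u_1\ldots u_m$ and $u|_k=u_1\ldots u_k$ put $S(u)=-\sum_{k=1}^m\log A_{u_k}(u|_{k-1})\in(-\infty,\infty]$, $\sigma(u)=\sum_{k=0}^{m-1}E(u|_k)$ and $\mathcal I_t=\{u\in\mathcal I: S(u)<\infty,\ \sigma(u)\le t<\sigma(u)+E(u)\}$. (i) Suppose that $\int_{1-\delta}^1\frac{ds}{|\mathbb E[s^N]-s|}=\infty$ for all $0<\delta<1$. Then $(*)$ has a unique solution $(\mu_t)_{t\ge0}$ with initial value $\mu_0$. For every such branching random walk and every $t\ge0$, the set $\mathcal I_t$ is almost surely finite and $\mu_t$ is the law of $U_t=\sum_{u\in\mathcal I_t}e^{-S(u)}X_u$. (ii) Suppose that $\gamma\in(0,2]$, $\mu_0\in\mathcal M^1_\gamma(\mathbb R)$ and $\Phi(\gamma)<\infty$. Then $(*)$ has a solution $(\mu_t)_{t\ge0}$ with initial value $\mu_0$ and with $\sup_{0\le s\le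 t}\int|x|^\gamma\,\mu_s(dx)<\infty$ for all $t\ge0$, and it is the only solution with this property. For every such branching random walk and every $t\ge0$, the series $U_t=\sum_{u\in\mathcal I_t}e^{-S(u)}X_u$ converges unconditionally in $L^\gamma$ (its partial sums over the finite subsets of $\mathcal I$, directed by inclusion, converge), and $\mu_t$ is the law of $U_t$. -/

import Mathlib

open MeasureTheory ProbabilityTheory Filter Topology
open scoped NNReal ENNReal BoundedContinuousFunction

noncomputable section

namespace Kinetic

/-! The data: a random sequence of non-negative weights, with coordinates labelled by `ℕ` from `0`
on, so that the coordinate `j` is the weight usually written `A_{j+1}`. -/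

/-- `N = max {j ≥ 1 : A_j ≠ 0}` with `max ∅ = 0`, for a sequence of weights with finitely many
non-zero entries. With labels starting at `0` this is the least `n` such that all the entries with
label at least `n` vanish. -/
def numWeights (a : ℕ → ℝ≥0) : ℕ := sInf {n | ∀ j, n ≤ j → a j = 0}

/-- `∑_{j=1}^N a_j x_j`. -/
def weightedSum (a : ℕ → ℝ≥0) (x : ℕ → ℝ) : ℝ :=
  ∑ j ∈ Finset.range (numWeights a), (a j : ℝ) * x j

theorem numWeights_eq_succ_iff (a : ℕ → ℝ≥0) (n : ℕ) :
    numWeights a = n + 1 ↔ (∀ j, n + 1 ≤ j → a j = 0) ∧ a n ≠ 0 := by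
  constructor
  · intro h
    have hne : {n | ∀ j, n ≤ j → a j = 0}.Nonempty := by
      by_contra hcon
      rw [Set.not_nonempty_iff_eq_empty] at hcon
      simp [numWeights, hcon] at h
    have hmem := Nat.sInf_mem hne
    have h1 : ∀ j, n + 1 ≤ j → a j = 0 := by
      rw [← h]
      exact hmem
    refine ⟨h1, fun h0 => ?_⟩
    have h2 : numWeights a ≤ n := by
      refine Nat.sInf_le fun j hj => ?_
      rcases hj.eq_or_lt with rfl | hj
      · exact h0
      · exact h1 j hj
    omega
  · rintro ⟨h1, h0⟩
    refine le_antisymm (Nat.sInf_le h1) ?_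
    refine le_csInf ⟨n + 1, h1⟩ fun m hm => ?_
    by_contra hlt
    exact h0 (hm n (by omega))

theorem measurable_numWeights : Measurable numWeights := by
  have hs : ∀ n, MeasurableSet (numWeights ⁻¹' {n + 1}) := by
    intro n
    have : numWeights ⁻¹' {n + 1} =
        (⋂ j, ⋂ (_ : n + 1 ≤ j), {a : ℕ → ℝ≥0 | a j = 0}) ∩ {a | a n = 0}ᶜ := by
      ext a
      simp [numWeights_eq_succ_iff]
    rw [this]
    have hz : ∀ j, MeasurableSet {a : ℕ → ℝ≥0 | a j = 0} := fun j =>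
      measurable_pi_apply j (measurableSet_singleton 0)
    exact (MeasurableSet.iInter fun j => MeasurableSet.iInter fun _ => hz j).inter (hz n).compl
  refine measurable_to_countable' fun n => ?_
  cases n with
  | succ n => exact hs n
  | zero =>
    have : numWeights ⁻¹' {0} = (⋃ n, numWeights ⁻¹' {n + 1})ᶜ := by
      ext a
      cases h : numWeights a <;> simp [h]
    rw [this]
    exact (MeasurableSet.iUnion hs).compl

theorem measurable_weightedSum :
    Measurable fun p : (ℕ → ℝ≥0) × (ℕ → ℝ) => weightedSum p.1 p.2 := by
  have h : Measurable fun q : ℕ × ((ℕ → ℝ≥0) × (ℕ → ℝ)) =>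
      ∑ j ∈ Finset.range q.1, (q.2.1 j : ℝ) * q.2.2 j :=
    measurable_from_prod_countable_right fun n =>
      Finset.measurable_fun_sum (Finset.range n) fun j _ => by fun_prop
  exact h.comp ((measurable_numWeights.comp measurable_fst).prodMk measurable_id)

section Weights

variable {Ω₀ : Type*} [MeasurableSpace Ω₀]

/-- The smoothing transformation `Q(μ) = Law(∑_{j=1}^N A_j X_j)`, where `X_1, X_2, …` are i.i.d.
with law `μ` and independent of `A`. -/
def smoothing (P₀ : Measure Ω₀) (A : Ω₀ → ℕ → ℝ≥0) (μ : ProbabilityMeasure ℝ) : Measure ℝ :=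
  (P₀.prod (Measure.infinitePi fun _ : ℕ => (μ : Measure ℝ))).map
    fun p => weightedSum (A p.1) p.2

theorem isProbabilityMeasure_smoothing (P₀ : Measure Ω₀) [IsProbabilityMeasure P₀]
    (A : Ω₀ → ℕ → ℝ≥0) (hA : Measurable A) (μ : ProbabilityMeasure ℝ) :
    IsProbabilityMeasure (smoothing P₀ A μ) :=
  Measure.isProbabilityMeasure_map
    (measurable_weightedSum.comp
      ((hA.comp measurable_fst).prodMk measurable_snd)).aemeasurable

/-- `Φ(θ) = E[∑_{j=1}^N A_j^θ] - 1`, with values in `[-1, ∞]`. -/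
def Phi (P₀ : Measure Ω₀) (A : Ω₀ → ℕ → ℝ≥0) (θ : ℝ) : EReal :=
  ((∫⁻ ω, ∑ j ∈ Finset.range (numWeights (A ω)), (A ω j : ℝ≥0∞) ^ θ ∂P₀ : ℝ≥0∞) : EReal) - 1

/-- The non-explosion assumption: `∫_{1-δ}^1 ds / |E[s^N] - s| = ∞` for all `0 < δ < 1`
(where `1 / 0 = ∞`). -/
def NonExplosion (P₀ : Measure Ω₀) (A : Ω₀ → ℕ → ℝ≥0) : Prop :=
  ∀ δ : ℝ, 0 < δ → δ < 1 →
    ∫⁻ s in Set.Ioo (1 - δ) 1,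
      (ENNReal.ofReal |(∫ ω, s ^ numWeights (A ω) ∂P₀) - s|)⁻¹ = ⊤

/-- `(μ_t)_{t ≥ 0}` is a solution, with initial condition `μ₀`, of the kinetic-type equation
`∂_t μ_t + μ_t = Q(μ_t)` in the weak sense, that is, tested against all bounded continuous
functions. At `t = 0` the derivative is one-sided. -/
structure IsSolution (P₀ : Measure Ω₀) (A : Ω₀ → ℕ → ℝ≥0) (μ₀ : ProbabilityMeasure ℝ)
    (μ : ℝ≥0 → ProbabilityMeasure ℝ) : Prop where
  initial : μ 0 = μ₀
  equation : ∀ (f : ℝ →ᵇ ℝ) (t : ℝ≥0),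
    HasDerivWithinAt (fun s : ℝ => ∫ x, f x ∂(μ s.toNNReal : Measure ℝ))
      ((∫ x, f x ∂(smoothing P₀ A (μ t))) - ∫ x, f x ∂(μ t : Measure ℝ)) (Set.Ici 0) (t : ℝ)

end Weights

/-- The class of probability measures with finite absolute moment of order `γ`, centered if
`γ > 1`. -/
def MomentClass (γ : ℝ) : Set (ProbabilityMeasure ℝ) :=
  {μ | ∫⁻ x, ENNReal.ofReal (|x| ^ γ) ∂(μ : Measure ℝ) < ⊤ ∧
    (1 < γ → ∫ x, x ∂(μ : Measure ℝ) = 0)}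

/-- `sup_{0 ≤ s ≤ t} ∫ |x|^γ μ_s(dx) < ∞` for all `t ≥ 0`. -/
def LocallyBoundedMoment (γ : ℝ) (μ : ℝ≥0 → ProbabilityMeasure ℝ) : Prop :=
  ∀ t : ℝ≥0, ⨆ s ∈ Set.Icc 0 t, ∫⁻ x, ENNReal.ofReal (|x| ^ γ) ∂(μ s : Measure ℝ) < ⊤

/-! The continuous-time branching random walk. Particles are labelled by finite sequences of
natural numbers; the prefix `u|_k` of `u` is `u.take k`. -/

section BranchingRandomWalk

variable {Ω : Type*}

/-- The position `S(u) = -∑_{k=1}^{|u|} log A_{u_k}(u|_{k-1})`, with `log 0 = -∞`, so that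
`S(u) = ∞` if one of the weights vanishes. -/
def position (A : List ℕ → Ω → ℕ → ℝ≥0) (u : List ℕ) (ω : Ω) : EReal :=
  -∑ k : Fin u.length, ENNReal.log (A (u.take k) ω (u.get k) : ℝ≥0∞)

/-- The birth time `σ(u)`: the ancestor is born at time `0`, and `σ(uj) = σ(u) + E(u)`. -/
def birthTime (E : List ℕ → Ω → ℝ) (u : List ℕ) (ω : Ω) : ℝ :=
  ∑ k : Fin u.length, E (u.take k) ω

/-- The set `I_t` of the labels of the particles alive at time `t`. -/
def alive (A : List ℕ → Ω → ℕ → ℝ≥0) (E : List ℕ → Ω → ℝ) (t : ℝ) (ω : Ω) : Set (List ℕ) :=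
  {u | position A u ω < ⊤ ∧ birthTime E u ω ≤ t ∧ t < birthTime E u ω + E u ω}

/-- The summand `e^{-S(u)} X_u`. -/
def summand (A : List ℕ → Ω → ℕ → ℝ≥0) (X : List ℕ → Ω → ℝ) (u : List ℕ) (ω : Ω) : ℝ :=
  (EReal.exp (-position A u ω)).toReal * X u ω

/-- `U_t = ∑_{u ∈ I_t} e^{-S(u)} X_u`, to be used where `I_t` is finite. -/
def finiteSum (A : List ℕ → Ω → ℕ → ℝ≥0) (E X : List ℕ → Ω → ℝ) (t : ℝ) (ω : Ω) : ℝ :=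
  ∑ᶠ u ∈ alive A E t ω, summand A X u ω

/-- The partial sum `∑_{u ∈ F ∩ I_t} e^{-S(u)} X_u` over a finite set `F` of labels. -/
def partialSum (A : List ℕ → Ω → ℕ → ℝ≥0) (E X : List ℕ → Ω → ℝ) (t : ℝ)
    (F : Finset (List ℕ)) (ω : Ω) : ℝ :=
  ∑ u ∈ F, (alive A E t ω).indicator (fun v => summand A X v ω) u

variable [MeasurableSpace Ω] {Ω₀ : Type*} [MeasurableSpace Ω₀]

/-- The random elements that drive the branching random walk: the pairs `(A(u), E(u))` are i.i.d.
copies of `(A, E)`, where `A` is given and `E` is a unit-mean exponential random variable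
independent of `A`; the `X_u` are i.i.d. with law `μ₀`; the two families are independent. -/
structure IsDrivingFamily (P₀ : Measure Ω₀) (A₀ : Ω₀ → ℕ → ℝ≥0) (μ₀ : ProbabilityMeasure ℝ)
    (P : Measure Ω) (A : List ℕ → Ω → ℕ → ℝ≥0) (E X : List ℕ → Ω → ℝ) : Prop where
  measurable_A : ∀ u, Measurable (A u)
  measurable_E : ∀ u, Measurable (E u)
  measurable_X : ∀ u, Measurable (X u)
  map_pair : ∀ u, P.map (fun ω => (A u ω, E u ω)) = (P₀.map A₀).prod (expMeasure 1)
  map_X : ∀ u, P.map (X u) = μ₀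
  indep_pair : iIndepFun (fun u ω => (A u ω, E u ω)) P
  indep_X : iIndepFun X P
  indep : IndepFun (fun ω u => (A u ω, E u ω)) (fun ω u => X u ω) P

end BranchingRandomWalk

end Kinetic

end

noncomputable section

namespace Kinetic

/-! ### An Osgood criterion -/

/-- The Picard iterates of the equation `h' = w(h)`, `h(0) = 0`, started from above. -/
def picard (w : ℝ → ℝ) : ℕ → ℝ → ℝ
  | 0 => fun t => 1 + t
  | n + 1 => fun t => ∫ s in (0 : ℝ)..t, w (picard w n s)

theorem continuous_picard {w : ℝ → ℝ} (hw : Continuous w) (n : ℕ) : Continuous (picard w n) := by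
  induction n with
  | zero => exact continuous_const.add continuous_id
  | succ n ih =>
    exact intervalIntegral.continuous_primitive
      (fun a b => (hw.comp ih).intervalIntegrable a b) 0

theorem picard_nonneg {w : ℝ → ℝ} (h0 : ∀ x, 0 ≤ w x) (n : ℕ) {t : ℝ} (ht : 0 ≤ t) :
    0 ≤ picard w n t := by
  cases n with
  | zero => simp only [picard]; positivity
  | succ n => exact intervalIntegral.integral_nonneg ht fun _ _ => h0 _

theorem picard_succ_le {w : ℝ → ℝ} (hw : Continuous w) (hm : Monotone w) (h1 : ∀ x, w x ≤ 1)
    (n : ℕ) {t : ℝ} (ht : 0 ≤ t) : picard w (n + 1) t ≤ picard w n t := by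
  induction n generalizing t with
  | zero =>
    have : picard w 1 t ≤ ∫ s in (0 : ℝ)..t, (1 : ℝ) :=
      intervalIntegral.integral_mono_on ht
        ((hw.comp (continuous_picard hw 0)).intervalIntegrable _ _)
        (continuous_const.intervalIntegrable _ _) fun _ _ => h1 _
    simp at this
    simp only [picard] at this ⊢
    linarith
  | succ n ih =>
    exact intervalIntegral.integral_mono_on ht
      ((hw.comp (continuous_picard hw (n + 1))).intervalIntegrable _ _)
      ((hw.comp (continuous_picard hw n)).intervalIntegrable _ _) fun s hs => hm (ih hs.1)

/-- The Osgood criterion: the only non-negative solution of `h' = w(h)`, `h(0) = 0`, is zero. -/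
theorem eq_zero_of_osgood {w : ℝ → ℝ} (hw : Continuous w) (hpos : ∀ x, 0 < x → 0 < w x)
    (hint : ∀ ε : ℝ, 0 < ε → ∫⁻ x in Set.Ioo 0 ε, (ENNReal.ofReal (w x))⁻¹ = ⊤)
    {h : ℝ → ℝ} (hc : Continuous h) (h0 : ∀ t, 0 ≤ t → 0 ≤ h t)
    (heq : ∀ t, 0 ≤ t → h t = ∫ s in (0 : ℝ)..t, w (h s)) {T : ℝ} (hT : 0 ≤ T) : h T = 0 := by
  by_contra hne
  have hTpos : 0 < h T := lt_of_le_of_ne (h0 T hT) (Ne.symm hne)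
  have hz : h 0 = 0 := by simpa using heq 0 le_rfl
  have hwh : Continuous fun s => w (h s) := hw.comp hc
  have hderiv : ∀ t, 0 < t → HasDerivAt h (w (h t)) t := by
    intro t ht
    have h1 : HasDerivAt (fun t => ∫ s in (0 : ℝ)..t, w (h s)) (w (h t)) t :=
      intervalIntegral.integral_hasDerivAt_right (hwh.intervalIntegrable _ _)
        hwh.aestronglyMeasurable.stronglyMeasurableAtFilter hwh.continuousAt
    refine h1.congr_of_eventuallyEq ?_
    filter_upwards [lt_mem_nhds ht] with s hs using heq s hs.le
  set S : Set ℝ := Set.Ioo 0 T ∩ {t | 0 < h t} with hS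
  have hSm : MeasurableSet S :=
    measurableSet_Ioo.inter (isOpen_lt continuous_const hc).measurableSet
  have hw0 : ∀ s, 0 ≤ s → 0 ≤ w (h s) := by
    intro s hs
    rcases (h0 s hs).eq_or_lt with h2 | h2
    · have : Tendsto w (𝓝[>] 0) (𝓝 (w 0)) := hw.continuousAt.tendsto.mono_left nhdsWithin_le_nhds
      rw [← h2]
      exact ge_of_tendsto this (eventually_nhdsWithin_of_forall fun x hx => (hpos x hx).le)
    · exact (hpos _ h2).le
  have hincr : ∀ s t, 0 ≤ s → s ≤ t → h t - h s = ∫ r in s..t, w (h r) := by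
    intro s t hs hst
    rw [heq t (hs.trans hst), heq s hs,
      intervalIntegral.integral_interval_sub_left (hwh.intervalIntegrable _ _)
        (hwh.intervalIntegrable _ _)]
  have hmono : ∀ s t, 0 ≤ s → s ≤ t → h s ≤ h t := by
    intro s t hs hst
    have h1 := hincr s t hs hst
    have h2 : 0 ≤ ∫ r in s..t, w (h r) :=
      intervalIntegral.integral_nonneg hst fun r hr => hw0 r (hs.trans hr.1)
    linarith
  have hstrict : ∀ s ∈ S, ∀ t ∈ S, s < t → h s < h t := by
    intro s hs t _ hst
    have h1 := hincr s t hs.1.1.le hst.le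
    have h2 : 0 < ∫ r in s..t, w (h r) :=
      intervalIntegral.intervalIntegral_pos_of_pos_on (hwh.intervalIntegrable _ _)
        (fun r hr => hpos _ (lt_of_lt_of_le hs.2 (hmono s r hs.1.1.le hr.1.le))) hst
    linarith
  have hinj : Set.InjOn h S := by
    intro s hs t ht hst
    rcases lt_trichotomy s t with hlt | hlt | hlt
    · exact absurd hst (hstrict s hs t ht hlt).ne
    · exact hlt
    · exact absurd hst (hstrict t ht s hs hlt).ne'
  have hcov := lintegral_image_eq_lintegral_abs_deriv_mul hSm
    (fun t ht => (hderiv t ht.1.1).hasDerivWithinAt) hinj (fun x => (ENNReal.ofReal (w x))⁻¹)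
  have hsub : Set.Ioo 0 (h T) ⊆ h '' S := by
    intro x hx
    have h1 : x ∈ h '' Set.Icc 0 T := by
      refine intermediate_value_Icc hT hc.continuousOn ⟨?_, hx.2.le⟩
      rw [hz]
      exact hx.1.le
    obtain ⟨t, ht, rfl⟩ := h1
    refine ⟨t, ⟨⟨?_, ?_⟩, hx.1⟩, rfl⟩
    · rcases ht.1.eq_or_lt with h2 | h2
      · rw [← h2, hz] at hx
        exact absurd hx.1 (lt_irrefl _)
      · exact h2
    · rcases ht.2.eq_or_lt with h2 | h2
      · rw [h2] at hx
        exact absurd hx.2 (lt_irrefl _)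
      · exact h2
  have h1 : ∫⁻ x in h '' S, (ENNReal.ofReal (w x))⁻¹ = ⊤ :=
    top_le_iff.1 ((hint _ hTpos).symm.le.trans (lintegral_mono_set hsub))
  have h2 : ∫⁻ t in S, ENNReal.ofReal |w (h t)| * (ENNReal.ofReal (w (h t)))⁻¹ ≤
      ∫⁻ t in S, 1 := by
    refine setLIntegral_mono measurable_const fun t ht => ?_
    rw [abs_of_pos (hpos _ ht.2), ENNReal.mul_inv_cancel]
    · simpa using hpos _ ht.2
    · exact ENNReal.ofReal_ne_top
  rw [← hcov, h1, setLIntegral_one] at h2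
  have h3 : volume S < ⊤ := (measure_mono Set.inter_subset_left).trans_lt (by simp)
  exact absurd h3 (not_lt.2 h2)

theorem tendsto_picard {w : ℝ → ℝ} (hw : Continuous w) (hm : Monotone w) (h1 : ∀ x, w x ≤ 1)
    (hw0 : ∀ x, 0 ≤ w x) (hpos : ∀ x, 0 < x → 0 < w x)
    (hint : ∀ ε : ℝ, 0 < ε → ∫⁻ x in Set.Ioo 0 ε, (ENNReal.ofReal (w x))⁻¹ = ⊤)
    {t : ℝ} (ht : 0 ≤ t) : Tendsto (fun n => picard w n t) atTop (𝓝 0) := by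
  set g : ℝ → ℝ := fun t => ⨅ n, picard w n t with hg
  have hlim : ∀ t, 0 ≤ t → Tendsto (fun n => picard w n t) atTop (𝓝 (g t)) := fun t ht =>
    tendsto_atTop_ciInf (antitone_nat_of_succ_le fun n => picard_succ_le hw hm h1 n ht)
      ⟨0, by rintro _ ⟨n, rfl⟩; exact picard_nonneg hw0 n ht⟩
  have hgm : Measurable g := Measurable.iInf fun n => (continuous_picard hw n).measurable
  have hgi : ∀ a b, IntervalIntegrable (fun s => w (g s)) volume a b := by
    intro a b
    refine (intervalIntegrable_const (c := (1 : ℝ))).mono_fun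
      (hw.measurable.comp hgm).aestronglyMeasurable (ae_of_all _ fun s => ?_)
    simpa [abs_of_nonneg (hw0 _)] using h1 (g s)
  set h : ℝ → ℝ := fun t => ∫ s in (0 : ℝ)..t, w (g s) with hh
  have hgh : ∀ t, 0 ≤ t → g t = h t := by
    intro t ht
    have h2 : Tendsto (fun n => picard w (n + 1) t) atTop (𝓝 (h t)) := by
      refine intervalIntegral.tendsto_integral_filter_of_dominated_convergence (fun _ => 1)
        (.of_forall fun n => ?_) (.of_forall fun n => ae_of_all _ fun s _ => ?_)
        intervalIntegrable_const (ae_of_all _ fun s hs => ?_)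
      · exact (hw.comp (continuous_picard hw n)).aestronglyMeasurable
      · rw [Real.norm_of_nonneg (hw0 _)]
        exact h1 _
      · rw [Set.uIoc_of_le ht] at hs
        exact (hw.tendsto _).comp (hlim s hs.1.le)
    exact tendsto_nhds_unique ((hlim t ht).comp (tendsto_add_atTop_nat 1)) h2
  have hz : h t = 0 := by
    refine eq_zero_of_osgood hw hpos hint (intervalIntegral.continuous_primitive hgi 0)
      (fun s hs => intervalIntegral.integral_nonneg hs fun _ _ => hw0 _) (fun s hs => ?_) ht
    refine intervalIntegral.integral_congr fun r hr => ?_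
    rw [Set.uIcc_of_le hs] at hr
    exact congrArg w (hgh r hr.1)
  rw [← hz, ← hgh t ht]
  exact hlim t ht

/-! ### The modulus of continuity of the smoothing transformation -/

section Modulus

variable {Ω₀ : Type*} [MeasurableSpace Ω₀]

/-- `E[min(1, (M + 1) x⁺)]`. -/
def modulus (P₀ : Measure Ω₀) (M : Ω₀ → ℕ) (x : ℝ) : ℝ :=
  ∫ ω, min 1 ((M ω + 1) * max x 0) ∂P₀

theorem modulus_integrand_mem (n : ℕ) (x : ℝ) :
    0 ≤ min (1 : ℝ) ((n + 1) * max x 0) ∧ min (1 : ℝ) ((n + 1) * max x 0) ≤ 1 :=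
  ⟨le_min zero_le_one (by positivity), min_le_left _ _⟩

variable {P₀ : Measure Ω₀} [IsProbabilityMeasure P₀] {M : Ω₀ → ℕ} (hM : Measurable M)

include hM in
theorem integrable_modulus (x : ℝ) :
    Integrable (fun ω => min (1 : ℝ) ((M ω + 1) * max x 0)) P₀ := by
  refine Integrable.of_bound (C := 1) ?_ (ae_of_all _ fun ω => ?_)
  · exact (measurable_const.min
      (((measurable_from_nat (f := fun n : ℕ => (n : ℝ))).comp hM |>.add_const 1).mul_const
        _)).aestronglyMeasurable
  · rw [Real.norm_of_nonneg (modulus_integrand_mem _ _).1]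
    exact (modulus_integrand_mem _ _).2

omit [IsProbabilityMeasure P₀] in
theorem modulus_nonneg (x : ℝ) : 0 ≤ modulus P₀ M x :=
  integral_nonneg fun _ => (modulus_integrand_mem _ _).1

include hM

theorem modulus_le_one (x : ℝ) : modulus P₀ M x ≤ 1 := by
  have := integral_mono (integrable_modulus (P₀ := P₀) hM x) (integrable_const (1 : ℝ))
    fun ω => (modulus_integrand_mem (M ω) x).2
  rwa [integral_const, probReal_univ, one_smul] at this

theorem monotone_modulus : Monotone (modulus P₀ M) := by
  intro x y hxy
  refine integral_mono (integrable_modulus hM x) (integrable_modulus hM y) fun ω => ?_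
  have : max x 0 ≤ max y 0 := max_le_max hxy le_rfl
  simp only
  gcongr

theorem continuous_modulus : Continuous (modulus P₀ M) := by
  refine continuous_of_dominated (bound := fun _ => 1)
    (fun x => (integrable_modulus hM x).aestronglyMeasurable)
    (fun x => ae_of_all _ fun ω => ?_) (integrable_const _) (ae_of_all _ fun ω => ?_)
  · rw [Real.norm_of_nonneg (modulus_integrand_mem _ _).1]
    exact (modulus_integrand_mem _ _).2
  · fun_prop

theorem min_le_modulus (x : ℝ) : min 1 (max x 0) ≤ modulus P₀ M x := by
  have := integral_mono (integrable_const (min 1 (max x 0))) (integrable_modulus (P₀ := P₀) hM x)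
    fun ω => ?_
  · rwa [integral_const, probReal_univ, one_smul] at this
  · have h1 : max x 0 ≤ (M ω + 1) * max x 0 := by
      have : (0 : ℝ) ≤ M ω * max x 0 := by positivity
      linarith
    exact min_le_min le_rfl h1

theorem modulus_pos {x : ℝ} (hx : 0 < x) : 0 < modulus P₀ M x :=
  lt_of_lt_of_le (lt_min one_pos (lt_max_of_lt_left hx)) (min_le_modulus hM x)

omit hM in
theorem min_one_mul_le (n : ℕ) {x : ℝ} (h0 : 0 ≤ x) (h1 : x ≤ 1) :
    min (1 : ℝ) ((n + 1) * max x 0) ≤ 2 * (1 - (1 - x) ^ n) + x := by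
  rw [max_eq_left h0]
  have hb : 1 + n * x ≤ (1 + x) ^ n := one_add_mul_le_pow (by linarith) n
  have hp : (1 - x) ^ n * (1 + x) ^ n ≤ 1 := by
    rw [← mul_pow]
    exact pow_le_one₀ (mul_nonneg (by linarith) (by linarith)) (by nlinarith)
  have hq : 0 ≤ (1 - x) ^ n := pow_nonneg (by linarith) n
  have hq1 : (1 - x) ^ n ≤ 1 := pow_le_one₀ (by linarith) (by linarith)
  have hnx : 0 ≤ n * x := by positivity
  have h3 : (1 - x) ^ n * (1 + n * x) ≤ 1 := (mul_le_mul_of_nonneg_left hb hq).trans hp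
  rcases le_total (n * x) 1 with h | h
  · refine (min_le_right _ _).trans ?_
    nlinarith
  · refine (min_le_left _ _).trans ?_
    nlinarith

theorem modulus_le_generating {x : ℝ} (h0 : 0 ≤ x) (h1 : x ≤ 1) :
    modulus P₀ M x ≤ 2 * (1 - ∫ ω, (1 - x) ^ M ω ∂P₀) + x := by
  have hi : Integrable (fun ω => (1 - x) ^ M ω) P₀ := by
    refine Integrable.of_bound (C := 1)
      ((measurable_from_nat (f := fun n => (1 - x) ^ n)).comp hM).aestronglyMeasurable
      (ae_of_all _ fun ω => ?_)
    rw [Real.norm_of_nonneg (pow_nonneg (by linarith) _)]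
    exact pow_le_one₀ (by linarith) (by linarith)
  have := integral_mono (integrable_modulus (P₀ := P₀) hM x)
    ((((integrable_const (1 : ℝ)).sub hi).const_mul 2).add (integrable_const x))
    fun ω => min_one_mul_le (M ω) h0 h1
  refine this.trans_eq ?_
  have hi' : Integrable (fun ω => 1 - (1 - x) ^ M ω) P₀ := (integrable_const (1 : ℝ)).sub hi
  simp only [Pi.add_apply, Pi.sub_apply]
  rw [integral_add (hi'.const_mul 2) (integrable_const x), integral_const_mul,
    integral_sub (integrable_const _) hi]
  simp

theorem modulus_le_mul (hfin : ∫⁻ ω, (M ω : ℝ≥0∞) ∂P₀ ≠ ⊤) {x : ℝ} (hx : 0 ≤ x) :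
    modulus P₀ M x ≤ (∫⁻ ω, (M ω : ℝ≥0∞) ∂P₀ + 1).toReal * x := by
  have hMm : Measurable fun ω => (M ω : ℝ≥0∞) := measurable_from_nat.comp hM
  rw [modulus, integral_eq_lintegral_of_nonneg_ae
    (ae_of_all _ fun ω => (modulus_integrand_mem _ _).1) (integrable_modulus hM x).1]
  have : ∫⁻ ω, ENNReal.ofReal (min 1 ((M ω + 1) * max x 0)) ∂P₀ ≤
      (∫⁻ ω, (M ω : ℝ≥0∞) ∂P₀ + 1) * ENNReal.ofReal x := by
    calc _ ≤ ∫⁻ ω, ((M ω : ℝ≥0∞) + 1) * ENNReal.ofReal x ∂P₀ := by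
          refine lintegral_mono fun ω => ?_
          rw [max_eq_left hx]
          refine (ENNReal.ofReal_le_ofReal (min_le_right _ _)).trans_eq ?_
          rw [ENNReal.ofReal_mul (by positivity), ENNReal.ofReal_add (by positivity) zero_le_one]
          simp
      _ = _ := by
          rw [lintegral_mul_const _ (hMm.add_const 1), lintegral_add_left hMm]
          simp
  refine (ENNReal.toReal_mono ?_ this).trans_eq ?_
  · exact ENNReal.mul_ne_top (by simp [hfin]) ENNReal.ofReal_ne_top
  · rw [ENNReal.toReal_mul, ENNReal.toReal_ofReal hx]

theorem exists_mul_le_modulus (hinf : ∫⁻ ω, (M ω : ℝ≥0∞) ∂P₀ = ⊤) (c : ℝ) :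
    ∃ δ > 0, ∀ x, 0 ≤ x → x ≤ δ → c * x ≤ modulus P₀ M x := by
  have hMm : Measurable fun ω => (M ω : ℝ≥0∞) := measurable_from_nat.comp hM
  have hsup : ⨆ K : ℕ, ∫⁻ ω, min (M ω : ℝ≥0∞) K ∂P₀ = ⊤ := by
    rw [← lintegral_iSup (fun K => hMm.min measurable_const), ← hinf]
    · refine lintegral_congr fun ω => le_antisymm (iSup_le fun K => min_le_left _ _) ?_
      exact le_iSup_of_le (M ω) (by simp)
    · intro K L hKL ω
      exact min_le_min le_rfl (by exact_mod_cast hKL)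
  obtain ⟨K, hK⟩ := lt_iSup_iff.1 (hsup ▸ ENNReal.ofReal_lt_top : ENNReal.ofReal c < _)
  refine ⟨1 / (K + 1), by positivity, fun x hx hxK => ?_⟩
  rcases le_or_gt c 0 with hc | hc
  · exact (mul_nonpos_of_nonpos_of_nonneg hc hx).trans (modulus_nonneg x)
  have hle : ENNReal.ofReal c * ENNReal.ofReal x ≤ ENNReal.ofReal (modulus P₀ M x) := by
    rw [modulus, ofReal_integral_eq_lintegral_ofReal (integrable_modulus hM x)
      (ae_of_all _ fun ω => (modulus_integrand_mem _ _).1)]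
    refine (mul_le_mul_left hK.le _).trans ?_
    rw [← lintegral_mul_const _ (hMm.min measurable_const)]
    refine lintegral_mono fun ω => ?_
    have : (min (M ω : ℝ≥0∞) K) = ENNReal.ofReal ((min (M ω) K : ℕ) : ℝ) := by
      rw [ENNReal.ofReal_natCast]
      exact (Nat.mono_cast.map_min (a := M ω) (b := K)).symm
    rw [this, ← ENNReal.ofReal_mul (by positivity), max_eq_left hx]
    refine ENNReal.ofReal_le_ofReal (le_min ?_ ?_)
    · have h1 : ((min (M ω) K : ℕ) : ℝ) ≤ K := by exact_mod_cast min_le_right _ _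
      rw [le_div_iff₀ (by positivity)] at hxK
      nlinarith
    · have h1 : ((min (M ω) K : ℕ) : ℝ) ≤ M ω := by exact_mod_cast min_le_left _ _
      nlinarith
  rw [← ENNReal.ofReal_mul hc.le] at hle
  exact (ENNReal.ofReal_le_ofReal_iff (modulus_nonneg x)).1 hle

omit hM in
theorem lintegral_inv_linear {c ε : ℝ} (hε : 0 < ε) :
    ∫⁻ x in Set.Ioo 0 ε, (ENNReal.ofReal (c * x))⁻¹ = ⊤ := by
  rcases le_or_gt c 0 with hc | hc
  · have : ∫⁻ x in Set.Ioo 0 ε, (ENNReal.ofReal (c * x))⁻¹ = ∫⁻ x in Set.Ioo 0 ε, ⊤ := by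
      refine setLIntegral_congr_fun measurableSet_Ioo fun x hx => ?_
      simp [ENNReal.ofReal_of_nonpos (mul_nonpos_of_nonpos_of_nonneg hc hx.1.le)]
    rw [this, lintegral_const, ENNReal.top_mul]
    simpa using hε
  by_contra hne
  have h1 : IntegrableOn (fun x : ℝ => (c * x)⁻¹) (Set.Ioo 0 ε) := by
    refine ⟨(measurable_const.mul measurable_id).inv.aestronglyMeasurable, ?_⟩
    rw [hasFiniteIntegral_iff_ofReal]
    · refine lt_of_le_of_lt (le_of_eq ?_) (lt_top_iff_ne_top.2 hne)
      refine setLIntegral_congr_fun measurableSet_Ioo fun x hx => ?_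
      exact ENNReal.ofReal_inv_of_pos (mul_pos hc hx.1)
    · filter_upwards [ae_restrict_mem measurableSet_Ioo] with x hx
      exact inv_nonneg.2 (mul_pos hc hx.1).le
  have h2 : IntervalIntegrable (fun x : ℝ => x⁻¹) volume 0 ε := by
    rw [intervalIntegrable_iff_integrableOn_Ioo_of_le hε.le]
    refine IntegrableOn.congr_fun (f := fun x => c * (c * x)⁻¹) (h1.const_mul c) (fun x hx => ?_)
      measurableSet_Ioo
    have := hx.1.ne'
    field_simp
  rw [intervalIntegrable_inv_iff] at h2
  rcases h2 with h2 | h2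
  · exact hε.ne h2
  · exact h2 (Set.left_mem_uIcc)

theorem lintegral_inv_modulus
    (hne : ∀ δ : ℝ, 0 < δ → δ < 1 → ∫⁻ s in Set.Ioo (1 - δ) 1,
      (ENNReal.ofReal |(∫ ω, s ^ M ω ∂P₀) - s|)⁻¹ = ⊤) {ε : ℝ} (hε : 0 < ε) :
    ∫⁻ x in Set.Ioo 0 ε, (ENNReal.ofReal (modulus P₀ M x))⁻¹ = ⊤ := by
  by_cases hfin : ∫⁻ ω, (M ω : ℝ≥0∞) ∂P₀ = ⊤
  · obtain ⟨δ', hδ', hmod⟩ := exists_mul_le_modulus hM hfin 8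
    set δ : ℝ := min ε (min δ' (1 / 2)) with hδ
    have hδ0 : 0 < δ := by positivity
    have hδε : δ ≤ ε := min_le_left _ _
    have hδδ : δ ≤ δ' := (min_le_right _ _).trans (min_le_left _ _)
    have hδ1 : δ < 1 := lt_of_le_of_lt ((min_le_right _ _).trans (min_le_right _ _)) (by norm_num)
    have h1 := hne δ hδ0 hδ1
    have h2 : ∫⁻ x in Set.Ioo 0 δ, (ENNReal.ofReal |(∫ ω, (1 - x) ^ M ω ∂P₀) - (1 - x)|)⁻¹ = ⊤ := by
      rw [← h1]
      have := (Measure.measurePreserving_sub_left (volume : Measure ℝ) 1).setLIntegral_comp_preimage_emb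
        (Homeomorph.subLeft (1 : ℝ)).measurableEmbedding
        (fun s => (ENNReal.ofReal |(∫ ω, s ^ M ω ∂P₀) - s|)⁻¹) (Set.Ioo (1 - δ) 1)
      rw [← this]
      simp
    have h3 : ∫⁻ x in Set.Ioo 0 δ, (ENNReal.ofReal |(∫ ω, (1 - x) ^ M ω ∂P₀) - (1 - x)|)⁻¹ ≤
        ∫⁻ x in Set.Ioo 0 δ, 4 * (ENNReal.ofReal (modulus P₀ M x))⁻¹ := by
      refine lintegral_mono_ae ?_
      filter_upwards [ae_restrict_mem measurableSet_Ioo] with x hx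
      have ha := hmod x hx.1.le (hx.2.le.trans hδδ)
      have hb := modulus_le_generating (P₀ := P₀) hM hx.1.le (hx.2.le.trans hδ1.le)
      have hc : modulus P₀ M x / 4 ≤ |(∫ ω, (1 - x) ^ M ω ∂P₀) - (1 - x)| := by
        rw [abs_sub_comm]
        refine le_trans ?_ (le_abs_self _)
        linarith [hx.1]
      have hd : (4 : ℝ≥0∞) * (ENNReal.ofReal (modulus P₀ M x))⁻¹ =
          (ENNReal.ofReal (modulus P₀ M x / 4))⁻¹ := by
        rw [ENNReal.ofReal_div_of_pos (by norm_num), ENNReal.inv_div (by simp) (by simp),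
          ENNReal.div_eq_inv_mul, mul_comm]
        simp
      rw [hd]
      exact ENNReal.inv_le_inv.2 (ENNReal.ofReal_le_ofReal hc)
    rw [h2, top_le_iff, lintegral_const_mul' _ _ (by simp), ENNReal.mul_eq_top] at h3
    have h4 : ∫⁻ x in Set.Ioo 0 δ, (ENNReal.ofReal (modulus P₀ M x))⁻¹ = ⊤ := by
      simpa using h3
    exact top_le_iff.1 (h4.symm.le.trans (lintegral_mono_set (Set.Ioo_subset_Ioo_right hδε)))
  · refine top_le_iff.1 ?_
    rw [← lintegral_inv_linear (c := (∫⁻ ω, (M ω : ℝ≥0∞) ∂P₀ + 1).toReal) hε]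
    refine lintegral_mono_ae ?_
    filter_upwards [ae_restrict_mem measurableSet_Ioo] with x hx
    exact ENNReal.inv_le_inv.2 (ENNReal.ofReal_le_ofReal (modulus_le_mul hM hfin hx.1.le))

end Modulus

section

variable {Ω₀ : Type*} [MeasurableSpace Ω₀] {P₀ : Measure Ω₀} [IsProbabilityMeasure P₀]
  {A : Ω₀ → ℕ → ℝ≥0}

theorem tendsto_picard_modulus (hA : Measurable A) (hne : NonExplosion P₀ A) {t : ℝ}
    (ht : 0 ≤ t) :
    Tendsto (fun n => picard (modulus P₀ fun ω => numWeights (A ω)) n t) atTop (𝓝 0) := by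
  have hM : Measurable fun ω => numWeights (A ω) := measurable_numWeights.comp hA
  exact tendsto_picard (continuous_modulus hM) (monotone_modulus hM) (modulus_le_one hM)
    modulus_nonneg (fun x hx => modulus_pos hM hx)
    (fun ε hε => lintegral_inv_modulus hM hne hε) ht

end

/-! ### Weak convergence and characteristic functions -/

theorem tendsto_charFun_of_tendsto {ι : Type*} {l : Filter ι} {μ : ι → ProbabilityMeasure ℝ}
    {μ' : ProbabilityMeasure ℝ} (h : Tendsto μ l (𝓝 μ')) (ξ : ℝ) :
    Tendsto (fun i => charFun (μ i : Measure ℝ) ξ) l (𝓝 (charFun (μ' : Measure ℝ) ξ)) := by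
  rw [ProbabilityMeasure.tendsto_iff_forall_integral_rclike_tendsto ℂ] at h
  simp_rw [charFun_eq_integral_innerProbChar]
  exact h (BoundedContinuousFunction.innerProbChar ξ)

theorem tendsto_of_tendsto_charFun {ι : Type*} {l : Filter ι} [l.IsCountablyGenerated]
    {μ : ι → ProbabilityMeasure ℝ} {μ' : ProbabilityMeasure ℝ}
    (h : ∀ ξ, Tendsto (fun i => charFun (μ i : Measure ℝ) ξ) l
      (𝓝 (charFun (μ' : Measure ℝ) ξ))) : Tendsto μ l (𝓝 μ') :=
  tendsto_of_seq_tendsto fun _ hx =>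
    ProbabilityMeasure.tendsto_of_tendsto_charFun fun ξ => (h ξ).comp hx

theorem norm_prod_sub_prod_le {ι : Type*} (s : Finset ι) (z w : ι → ℂ) (hz : ∀ i, ‖z i‖ ≤ 1)
    (hw : ∀ i, ‖w i‖ ≤ 1) : ‖∏ i ∈ s, z i - ∏ i ∈ s, w i‖ ≤ ∑ i ∈ s, ‖z i - w i‖ := by
  classical
  induction s using Finset.induction_on with
  | empty => simp
  | insert a s ha ih =>
    rw [Finset.prod_insert ha, Finset.prod_insert ha, Finset.sum_insert ha]
    have h1 : z a * ∏ i ∈ s, z i - w a * ∏ i ∈ s, w i =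
        (z a - w a) * ∏ i ∈ s, z i + w a * (∏ i ∈ s, z i - ∏ i ∈ s, w i) := by ring
    have h2 : ‖∏ i ∈ s, z i‖ ≤ 1 := by
      rw [norm_prod]
      exact Finset.prod_le_one (fun _ _ => norm_nonneg _) fun i _ => hz i
    rw [h1]
    refine (norm_add_le _ _).trans ?_
    rw [norm_mul, norm_mul]
    refine add_le_add ?_ ?_
    · exact mul_le_of_le_one_right (norm_nonneg _) h2
    · exact (mul_le_of_le_one_left (norm_nonneg _) (hw a)).trans ih

/-! ### Smoothing with summands of different laws -/

section Smoothing

variable {Ω₀ : Type*} [MeasurableSpace Ω₀]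

/-- The law of `∑_{j=1}^N A_j X_j` for independent `X_j` with laws `ν_j`, independent of `A`. -/
def mixedSmoothing (P₀ : Measure Ω₀) (A : Ω₀ → ℕ → ℝ≥0) (ν : ℕ → ProbabilityMeasure ℝ) :
    Measure ℝ :=
  (P₀.prod (Measure.infinitePi fun j => (ν j : Measure ℝ))).map fun p => weightedSum (A p.1) p.2

theorem smoothing_eq_mixedSmoothing (P₀ : Measure Ω₀) (A : Ω₀ → ℕ → ℝ≥0)
    (μ : ProbabilityMeasure ℝ) : smoothing P₀ A μ = mixedSmoothing P₀ A fun _ => μ := rfl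

variable {P₀ : Measure Ω₀} [IsProbabilityMeasure P₀] {A : Ω₀ → ℕ → ℝ≥0} (hA : Measurable A)

include hA

theorem measurable_weightedSum_comp :
    Measurable fun p : Ω₀ × (ℕ → ℝ) => weightedSum (A p.1) p.2 :=
  measurable_weightedSum.comp ((hA.comp measurable_fst).prodMk measurable_snd)

theorem isProbabilityMeasure_mixedSmoothing (ν : ℕ → ProbabilityMeasure ℝ) :
    IsProbabilityMeasure (mixedSmoothing P₀ A ν) :=
  Measure.isProbabilityMeasure_map (measurable_weightedSum_comp hA).aemeasurable

omit hA in
theorem charFun_map_weightedSum (a : ℕ → ℝ≥0) (ν : ℕ → ProbabilityMeasure ℝ) (ξ : ℝ) :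
    charFun ((Measure.infinitePi fun j => (ν j : Measure ℝ)).map (weightedSum a)) ξ =
      ∏ j ∈ Finset.range (numWeights a), charFun (ν j : Measure ℝ) (a j * ξ) := by
  have hmeas : ∀ j, Measurable fun x : ℕ → ℝ => (a j : ℝ) * x j := fun j =>
    measurable_const.mul (measurable_pi_apply j)
  have hind : iIndepFun (fun (j : ℕ) (x : ℕ → ℝ) => (a j : ℝ) * x j)
      (Measure.infinitePi fun j => (ν j : Measure ℝ)) :=
    iIndepFun_infinitePi (X := fun j x => (a j : ℝ) * x) fun j => by fun_prop
  have := iIndepFun.charFun_map_fun_finsetSum_eq_prod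
    (X := fun (j : ℕ) (x : ℕ → ℝ) => (a j : ℝ) * x j) (s := Finset.range (numWeights a))
    (P := Measure.infinitePi fun j => (ν j : Measure ℝ))
    (fun j _ => (hmeas j).aemeasurable)
    (hind.restrict (Finset.range (numWeights a)))
  have h2 := congrFun this ξ
  rw [Finset.prod_apply] at h2
  refine Eq.trans h2 (Finset.prod_congr rfl fun j _ => ?_)
  have h3 := charFun_map_mul (μ := (ν j : Measure ℝ)) (a j) ξ
  rw [← h3, ← Measure.infinitePi_map_eval (fun j => (ν j : Measure ℝ)) j,
    Measure.map_map (by fun_prop) (by fun_prop)]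
  rfl

theorem charFun_mixedSmoothing (ν : ℕ → ProbabilityMeasure ℝ) (ξ : ℝ) :
    charFun (mixedSmoothing P₀ A ν) ξ =
      ∫ ω, ∏ j ∈ Finset.range (numWeights (A ω)),
        charFun (ν j : Measure ℝ) (A ω j * ξ) ∂P₀ := by
  have hm := measurable_weightedSum_comp hA
  rw [charFun_apply_real, mixedSmoothing, integral_map hm.aemeasurable
    (by fun_prop), integral_prod]
  · refine integral_congr_ae (ae_of_all _ fun ω => ?_)
    simp only
    rw [← charFun_map_weightedSum, charFun_apply_real,
      integral_map (φ := weightedSum (A ω))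
        (hm.comp (measurable_prodMk_left (x := ω))).aemeasurable (by fun_prop)]
  · refine Integrable.of_bound (C := 1) (Measurable.aestronglyMeasurable ?_)
      (ae_of_all _ fun p => ?_)
    · exact (Complex.measurable_exp.comp
        (((Complex.measurable_ofReal.comp hm).const_mul _).mul_const _))
    rw [← Complex.ofReal_mul, Complex.norm_exp_ofReal_mul_I]

omit [IsProbabilityMeasure P₀] in
theorem aestronglyMeasurable_prod_charFun (ν : ℕ → ProbabilityMeasure ℝ) (ξ : ℝ) :
    AEStronglyMeasurable (fun ω => ∏ j ∈ Finset.range (numWeights (A ω)),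
        charFun (ν j : Measure ℝ) (A ω j * ξ)) P₀ := by
  have h : Measurable fun q : ℕ × (ℕ → ℝ≥0) => ∏ j ∈ Finset.range q.1,
      charFun (ν j : Measure ℝ) (q.2 j * ξ) := by
    refine measurable_from_prod_countable_right fun n =>
      Finset.measurable_fun_prod (Finset.range n) fun j _ => ?_
    exact measurable_charFun.comp (by fun_prop)
  exact (h.comp ((measurable_numWeights.comp hA).prodMk hA)).aestronglyMeasurable

omit hA in
theorem norm_prod_charFun_le (a : ℕ → ℝ≥0) (ν : ℕ → ProbabilityMeasure ℝ) (ξ : ℝ) (n : ℕ) :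
    ‖∏ j ∈ Finset.range n, charFun (ν j : Measure ℝ) (a j * ξ)‖ ≤ 1 := by
  rw [norm_prod]
  exact Finset.prod_le_one (fun _ _ => norm_nonneg _) fun i _ => norm_charFun_le_one _

theorem integrable_prod_charFun (ν : ℕ → ProbabilityMeasure ℝ) (ξ : ℝ) :
    Integrable (fun ω => ∏ j ∈ Finset.range (numWeights (A ω)),
        charFun (ν j : Measure ℝ) (A ω j * ξ)) P₀ :=
  Integrable.of_bound (C := 1) (aestronglyMeasurable_prod_charFun hA ν ξ)
    (ae_of_all _ fun _ => norm_prod_charFun_le _ ν ξ _)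

theorem tendsto_mixedSmoothing {ι : Type*} {l : Filter ι} [l.IsCountablyGenerated]
    {ν : ι → ℕ → ProbabilityMeasure ℝ} {ν' : ℕ → ProbabilityMeasure ℝ}
    (h : ∀ j, Tendsto (fun i => ν i j) l (𝓝 (ν' j))) (f : ℝ →ᵇ ℝ) :
    Tendsto (fun i => ∫ x, f x ∂(mixedSmoothing P₀ A (ν i))) l
      (𝓝 (∫ x, f x ∂(mixedSmoothing P₀ A ν'))) := by
  have hp := isProbabilityMeasure_mixedSmoothing (P₀ := P₀) hA
  have key : Tendsto (β := ProbabilityMeasure ℝ) (fun i => (⟨mixedSmoothing P₀ A (ν i), hp _⟩ : ProbabilityMeasure ℝ)) l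
      (𝓝 (⟨mixedSmoothing P₀ A ν', hp _⟩ : ProbabilityMeasure ℝ)) := by
    refine tendsto_of_tendsto_charFun fun ξ => ?_
    simp only [ProbabilityMeasure.coe_mk, charFun_mixedSmoothing hA]
    refine tendsto_integral_filter_of_dominated_convergence (fun _ => 1)
      (.of_forall fun i => aestronglyMeasurable_prod_charFun hA _ ξ)
      (.of_forall fun i => ae_of_all _ fun ω => norm_prod_charFun_le _ _ ξ _)
      (integrable_const _) (ae_of_all _ fun ω => ?_)
    exact tendsto_finsetProd _ fun j _ => tendsto_charFun_of_tendsto (h j) _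
  exact (ProbabilityMeasure.tendsto_iff_forall_integral_tendsto.1 key) f

/-! ### The mild form of the equation -/

omit hA in
theorem continuous_toNNReal_comp {α : Type*} [TopologicalSpace α] {g : ℝ≥0 → α}
    (h : ContinuousOn (fun s : ℝ => g s.toNNReal) (Set.Ici 0)) :
    Continuous fun s : ℝ => g s.toNNReal := by
  have h1 : (fun s : ℝ => g s.toNNReal) = fun s : ℝ => g (max s 0).toNNReal := by
    ext s
    congr 1
    simp [Real.toNNReal]
  rw [h1]
  exact h.comp_continuous (by fun_prop) fun s => Set.mem_Ici.2 (le_max_right _ _)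

omit hA in
theorem continuous_curve {μ : ℝ≥0 → ProbabilityMeasure ℝ}
    (h : ∀ f : ℝ →ᵇ ℝ, ContinuousOn (fun s : ℝ => ∫ x, f x ∂(μ s.toNNReal : Measure ℝ))
      (Set.Ici 0)) : Continuous fun s : ℝ => μ s.toNNReal := by
  refine continuous_iff_continuousAt.2 fun s => ?_
  refine ProbabilityMeasure.tendsto_iff_forall_integral_tendsto.2 fun f => ?_
  exact (continuous_toNNReal_comp (g := fun t => ∫ x, f x ∂(μ t : Measure ℝ)) (h f)).tendsto s

theorem continuous_integral_smoothing {μ : ℝ≥0 → ProbabilityMeasure ℝ}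
    (h : Continuous fun s : ℝ => μ s.toNNReal) (f : ℝ →ᵇ ℝ) :
    Continuous fun s : ℝ => ∫ x, f x ∂(smoothing P₀ A (μ s.toNNReal)) :=
  continuous_iff_continuousAt.2 fun s =>
    tendsto_mixedSmoothing hA (fun _ => h.tendsto s) f

theorem continuous_charFun_smoothing {μ : ℝ≥0 → ProbabilityMeasure ℝ}
    (h : Continuous fun s : ℝ => μ s.toNNReal) (ξ : ℝ) :
    Continuous fun s : ℝ => charFun (smoothing P₀ A (μ s.toNNReal)) ξ := by
  simp_rw [smoothing_eq_mixedSmoothing, charFun_mixedSmoothing hA]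
  refine continuous_of_dominated (bound := fun _ => 1)
    (fun s => aestronglyMeasurable_prod_charFun hA _ ξ)
    (fun s => ae_of_all _ fun ω => norm_prod_charFun_le _ _ ξ _)
    (integrable_const _) (ae_of_all _ fun ω => ?_)
  refine continuous_finsetProd _ fun j _ => continuous_iff_continuousAt.2 fun s => ?_
  exact tendsto_charFun_of_tendsto (h.tendsto s) _

/-- A family of probability measures that satisfies the mild form of the equation is a solution. -/
theorem isSolution_of_mild {μ₀ : ProbabilityMeasure ℝ} {μ : ℝ≥0 → ProbabilityMeasure ℝ}
    (hm : ∀ f : ℝ →ᵇ ℝ, AEStronglyMeasurable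
      (fun s : ℝ => ∫ x, f x ∂(smoothing P₀ A (μ s.toNNReal))))
    (h : ∀ (f : ℝ →ᵇ ℝ) (t : ℝ), 0 ≤ t → ∫ x, f x ∂(μ t.toNNReal : Measure ℝ) =
      Real.exp (-t) * (∫ x, f x ∂(μ₀ : Measure ℝ) + ∫ s in (0 : ℝ)..t,
        Real.exp s * ∫ x, f x ∂(smoothing P₀ A (μ s.toNNReal)))) :
    IsSolution P₀ A μ₀ μ := by
  have hp := isProbabilityMeasure_smoothing P₀ A hA
  have hint : ∀ (f : ℝ →ᵇ ℝ) (a b : ℝ), IntervalIntegrable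
      (fun s => Real.exp s * ∫ x, f x ∂(smoothing P₀ A (μ s.toNNReal))) volume a b := by
    intro f a b
    refine IntervalIntegrable.continuousOn_mul ?_ Real.continuous_exp.continuousOn
    refine (intervalIntegrable_const (c := ‖f‖)).mono_fun (hm f).restrict
      (ae_of_all _ fun s => ?_)
    have := hp (μ s.toNNReal)
    rw [Real.norm_of_nonneg (norm_nonneg f)]
    exact f.norm_integral_le_norm _
  have hcurve : Continuous fun s : ℝ => μ s.toNNReal := by
    refine continuous_curve fun f => ?_
    refine ContinuousOn.congr (f := fun t => Real.exp (-t) * (∫ x, f x ∂(μ₀ : Measure ℝ) +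
      ∫ s in (0 : ℝ)..t, Real.exp s * ∫ x, f x ∂(smoothing P₀ A (μ s.toNNReal)))) ?_
      fun t ht => h f t ht
    have := intervalIntegral.continuous_primitive (hint f) 0
    fun_prop
  refine ⟨?_, fun f t => ?_⟩
  · have h0 : ((μ 0 : ProbabilityMeasure ℝ) : Measure ℝ) = μ₀ :=
      ext_of_forall_integral_eq_of_IsFiniteMeasure fun f => by simpa using h f 0 le_rfl
    exact Subtype.ext h0
  · have hq := continuous_integral_smoothing (P₀ := P₀) hA hcurve f
    have h1 : HasDerivAt (fun t => ∫ s in (0 : ℝ)..t,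
        Real.exp s * ∫ x, f x ∂(smoothing P₀ A (μ s.toNNReal)))
        (Real.exp t * ∫ x, f x ∂(smoothing P₀ A (μ (t : ℝ).toNNReal))) (t : ℝ) :=
      intervalIntegral.integral_hasDerivAt_right (hint f _ _)
        (Real.continuous_exp.mul hq).aestronglyMeasurable.stronglyMeasurableAtFilter
        (Real.continuous_exp.mul hq).continuousAt
    have h2 : HasDerivAt (fun t : ℝ => Real.exp (-t)) (-Real.exp (-t)) (t : ℝ) := by
      simpa using (hasDerivAt_neg (t : ℝ)).exp
    have h3 := (h2.mul (h1.const_add (∫ x, f x ∂(μ₀ : Measure ℝ)))).hasDerivWithinAt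
      (s := Set.Ici 0)
    refine (h3.congr (fun s hs => h f s hs) (h f t t.2)).congr_deriv ?_
    have h4 := h f t t.2
    have h5 : Real.exp (-(t : ℝ)) * Real.exp t = 1 := by rw [← Real.exp_add]; simp
    rw [← mul_assoc, h5]
    rw [Real.toNNReal_coe] at h4 ⊢
    rw [h4]
    ring

omit hA in
theorem eq_exp_smul_of_hasDerivWithinAt {E : Type*} [NormedAddCommGroup E] [NormedSpace ℝ E]
    [CompleteSpace E] {F q : ℝ → E} (hq : Continuous q)
    (h : ∀ t, 0 ≤ t → HasDerivWithinAt F (q t - F t) (Set.Ici 0) t) {t : ℝ} (ht : 0 ≤ t) :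
    F t = Real.exp (-t) • (F 0 + ∫ s in (0 : ℝ)..t, Real.exp s • q s) := by
  have h1 : ∀ s, 0 ≤ s → HasDerivWithinAt (fun s => Real.exp s • F s) (Real.exp s • q s)
      (Set.Ici 0) s := by
    intro s hs
    refine ((Real.hasDerivAt_exp s).hasDerivWithinAt.smul (h s hs)).congr_deriv ?_
    rw [smul_sub]
    abel
  have h2 := intervalIntegral.integral_eq_sub_of_hasDerivAt_of_le ht
    (fun s hs => ((h1 s hs.1).continuousWithinAt.mono Set.Icc_subset_Ici_self))
    (fun s hs => (h1 s hs.1.le).hasDerivAt (Ici_mem_nhds hs.1))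
    ((Real.continuous_exp.smul hq).intervalIntegrable _ _)
  rw [h2, Real.exp_zero, one_smul, add_sub_cancel, smul_smul, ← Real.exp_add]
  simp

omit hA [IsProbabilityMeasure P₀] in
theorem IsSolution.continuous_curve {μ₀ : ProbabilityMeasure ℝ} {μ : ℝ≥0 → ProbabilityMeasure ℝ}
    (h : IsSolution P₀ A μ₀ μ) : Continuous fun s : ℝ => μ s.toNNReal :=
  Kinetic.continuous_curve fun f s hs => by
    have := (h.equation f s.toNNReal).continuousWithinAt
    rwa [Real.coe_toNNReal s hs] at this

theorem IsSolution.mild {μ₀ : ProbabilityMeasure ℝ} {μ : ℝ≥0 → ProbabilityMeasure ℝ}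
    (h : IsSolution P₀ A μ₀ μ) (f : ℝ →ᵇ ℝ) {t : ℝ} (ht : 0 ≤ t) :
    ∫ x, f x ∂(μ t.toNNReal : Measure ℝ) =
      Real.exp (-t) * (∫ x, f x ∂(μ₀ : Measure ℝ) + ∫ s in (0 : ℝ)..t,
        Real.exp s * ∫ x, f x ∂(smoothing P₀ A (μ s.toNNReal))) := by
  have := eq_exp_smul_of_hasDerivWithinAt
    (F := fun s => ∫ x, f x ∂(μ s.toNNReal : Measure ℝ))
    (continuous_integral_smoothing (P₀ := P₀) hA h.continuous_curve f)
    (fun s hs => ?_) ht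
  · simpa [h.initial] using this
  · have := h.equation f s.toNNReal
    rwa [Real.coe_toNNReal s hs] at this

omit hA in
theorem charFun_eq_integral_cos_sin (μ : Measure ℝ) [IsProbabilityMeasure μ] (ξ : ℝ) :
    charFun μ ξ = ((∫ x, Real.cos (ξ * x) ∂μ : ℝ) : ℂ) +
      ((∫ x, Real.sin (ξ * x) ∂μ : ℝ) : ℂ) * Complex.I := by
  have hc : Integrable (fun x => Real.cos (ξ * x)) μ :=
    Integrable.of_bound (C := 1) (by fun_prop) (ae_of_all _ fun x => Real.abs_cos_le_one _)
  have hs : Integrable (fun x => Real.sin (ξ * x)) μ :=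
    Integrable.of_bound (C := 1) (by fun_prop) (ae_of_all _ fun x => Real.abs_sin_le_one _)
  rw [charFun_apply_real, ← integral_complex_ofReal, ← integral_complex_ofReal,
    ← integral_mul_const, ← integral_add hc.ofReal (hs.ofReal.mul_const _)]
  refine integral_congr_ae (ae_of_all _ fun x => ?_)
  simp only
  rw [Complex.exp_mul_I]
  simp

/-- The function `x ↦ cos (ξ x)`. -/
def cosTest (ξ : ℝ) : ℝ →ᵇ ℝ :=
  BoundedContinuousFunction.ofNormedAddCommGroup (fun x => Real.cos (ξ * x)) (by fun_prop) 1
    fun x => Real.abs_cos_le_one _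

/-- The function `x ↦ sin (ξ x)`. -/
def sinTest (ξ : ℝ) : ℝ →ᵇ ℝ :=
  BoundedContinuousFunction.ofNormedAddCommGroup (fun x => Real.sin (ξ * x)) (by fun_prop) 1
    fun x => Real.abs_sin_le_one _

theorem IsSolution.charFun_eq {μ₀ : ProbabilityMeasure ℝ} {μ : ℝ≥0 → ProbabilityMeasure ℝ}
    (h : IsSolution P₀ A μ₀ μ) (ξ : ℝ) {t : ℝ} (ht : 0 ≤ t) :
    charFun (μ t.toNNReal : Measure ℝ) ξ =
      Real.exp (-t) • (charFun (μ₀ : Measure ℝ) ξ + ∫ s in (0 : ℝ)..t,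
        Real.exp s • charFun (smoothing P₀ A (μ s.toNNReal)) ξ) := by
  have := eq_exp_smul_of_hasDerivWithinAt
    (F := fun s => charFun (μ s.toNNReal : Measure ℝ) ξ)
    (continuous_charFun_smoothing (P₀ := P₀) hA h.continuous_curve ξ)
    (fun s hs => ?_) ht
  · simpa [h.initial] using this
  · have hp := isProbabilityMeasure_smoothing P₀ A hA (μ s.toNNReal)
    have hc := h.equation (cosTest ξ) s.toNNReal
    have hs' := h.equation (sinTest ξ) s.toNNReal
    rw [Real.coe_toNNReal s hs] at hc hs'
    simp_rw [charFun_eq_integral_cos_sin]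
    refine (hc.ofReal_comp.add (hs'.ofReal_comp.mul_const Complex.I)).congr_deriv ?_
    simp only [cosTest, sinTest, BoundedContinuousFunction.coe_ofNormedAddCommGroup]
    push_cast
    ring

theorem IsSolution.norm_charFun_sub_le {μ₀ : ProbabilityMeasure ℝ}
    {μ ν : ℝ≥0 → ProbabilityMeasure ℝ} (hμ : IsSolution P₀ A μ₀ μ) (hν : IsSolution P₀ A μ₀ ν)
    (ξ : ℝ) {t : ℝ} (ht : 0 ≤ t) {b : ℝ → ℝ} (hbi : IntervalIntegrable b volume 0 t)
    (hb : ∀ s, 0 ≤ s → s ≤ t → ‖charFun (smoothing P₀ A (μ s.toNNReal)) ξ -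
      charFun (smoothing P₀ A (ν s.toNNReal)) ξ‖ ≤ b s) :
    ‖charFun (μ t.toNNReal : Measure ℝ) ξ - charFun (ν t.toNNReal : Measure ℝ) ξ‖ ≤
      ∫ s in (0 : ℝ)..t, b s := by
  have h1 := continuous_charFun_smoothing (P₀ := P₀) hA hμ.continuous_curve ξ
  have h2 := continuous_charFun_smoothing (P₀ := P₀) hA hν.continuous_curve ξ
  rw [hμ.charFun_eq hA ξ ht, hν.charFun_eq hA ξ ht, ← smul_sub, add_sub_add_left_eq_sub,
    ← intervalIntegral.integral_sub
      (Continuous.intervalIntegrable (by fun_prop) _ _)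
      (Continuous.intervalIntegrable (by fun_prop) _ _), ← intervalIntegral.integral_smul]
  refine intervalIntegral.norm_integral_le_of_norm_le ht (ae_of_all _ fun s hs => ?_) hbi
  rw [← smul_sub, smul_smul, ← Real.exp_add, norm_smul, Real.norm_of_nonneg (Real.exp_pos _).le]
  refine (mul_le_of_le_one_left (norm_nonneg _) ?_).trans (hb s hs.1.le hs.2)
  rw [Real.exp_le_one_iff]
  linarith [hs.2]

omit hA in
theorem eq_of_charFun_eq {μ ν : ℝ≥0 → ProbabilityMeasure ℝ}
    (h : ∀ t : ℝ, 0 ≤ t → ∀ ξ, charFun (μ t.toNNReal : Measure ℝ) ξ =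
      charFun (ν t.toNNReal : Measure ℝ) ξ) : μ = ν := by
  ext1 t
  have h1 : ((μ t : ProbabilityMeasure ℝ) : Measure ℝ) = ν t := by
    refine Measure.ext_of_charFun ?_
    ext ξ
    have := h t t.2 ξ
    rwa [Real.toNNReal_coe] at this
  exact Subtype.ext h1

/-- Uniqueness of the solution under the non-explosion assumption. -/
theorem IsSolution.unique {μ₀ : ProbabilityMeasure ℝ} {μ ν : ℝ≥0 → ProbabilityMeasure ℝ}
    (hne : NonExplosion P₀ A) (hμ : IsSolution P₀ A μ₀ μ) (hν : IsSolution P₀ A μ₀ ν) :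
    μ = ν := by
  have hM : Measurable fun ω => numWeights (A ω) := measurable_numWeights.comp hA
  set w := modulus P₀ fun ω => numWeights (A ω) with hw
  have key : ∀ n : ℕ, ∀ t : ℝ, 0 ≤ t → ∀ ξ, ‖charFun (μ t.toNNReal : Measure ℝ) ξ -
      charFun (ν t.toNNReal : Measure ℝ) ξ‖ ≤ 2 * picard w n t := by
    intro n
    induction n with
    | zero =>
      intro t ht ξ
      refine (norm_sub_le _ _).trans ?_
      have h1 := norm_charFun_le_one (μ := (μ t.toNNReal : Measure ℝ)) ξ
      have h2 := norm_charFun_le_one (μ := (ν t.toNNReal : Measure ℝ)) ξ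
      simp only [picard]
      linarith
    | succ n ih =>
      intro t ht ξ
      have hc : Continuous fun s => 2 * w (picard w n s) :=
        continuous_const.mul ((continuous_modulus hM).comp
          (continuous_picard (continuous_modulus hM) n))
      refine (hμ.norm_charFun_sub_le hA hν ξ ht (hc.intervalIntegrable _ _)
        fun s hs _ => ?_).trans_eq (intervalIntegral.integral_const_mul _ _)
      rw [smoothing_eq_mixedSmoothing, smoothing_eq_mixedSmoothing, charFun_mixedSmoothing hA,
        charFun_mixedSmoothing hA, ← integral_sub (integrable_prod_charFun hA _ ξ)
          (integrable_prod_charFun hA _ ξ), hw, modulus, ← integral_const_mul]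
      refine norm_integral_le_of_norm_le ((integrable_modulus hM _).const_mul 2)
        (ae_of_all _ fun ω => ?_)
      have h0 : 0 ≤ picard w n s := picard_nonneg modulus_nonneg n hs
      rw [mul_min_of_nonneg _ _ zero_le_two]
      refine le_min ?_ ?_
      · refine (norm_sub_le _ _).trans ?_
        have h1 := norm_prod_charFun_le (A ω) (fun _ => μ s.toNNReal) ξ (numWeights (A ω))
        have h2 := norm_prod_charFun_le (A ω) (fun _ => ν s.toNNReal) ξ (numWeights (A ω))
        linarith
      · refine (norm_prod_sub_prod_le _ _ _ (fun j => norm_charFun_le_one _)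
          fun j => norm_charFun_le_one _).trans ?_
        refine (Finset.sum_le_sum fun j _ => ih s hs (A ω j * ξ)).trans ?_
        rw [Finset.sum_const, Finset.card_range, nsmul_eq_mul, max_eq_left h0]
        nlinarith
  refine eq_of_charFun_eq fun t ht ξ => ?_
  have h1 : Tendsto (fun n => 2 * picard w n t) atTop (𝓝 0) := by
    simpa using (tendsto_picard_modulus hA hne ht).const_mul 2
  have h2 := ge_of_tendsto h1 (.of_forall fun n => key n t ht ξ)
  exact sub_eq_zero.1 (norm_le_zero_iff.1 h2)

end Smoothing

/-! ### Absolute moments -/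

/-- The absolute moment of order `γ`. -/
def absMoment (γ : ℝ) (μ : Measure ℝ) : ℝ≥0∞ := ∫⁻ x, ENNReal.ofReal (|x| ^ γ) ∂μ

theorem abs_le_one_add_rpow {γ : ℝ} (hγ : 1 ≤ γ) (x : ℝ) : |x| ≤ 1 + |x| ^ γ := by
  rcases le_total |x| 1 with h | h
  · have : 0 ≤ |x| ^ γ := by positivity
    linarith
  · have : |x| ^ (1 : ℝ) ≤ |x| ^ γ := Real.rpow_le_rpow_of_exponent_le h hγ
    rw [Real.rpow_one] at this
    linarith

theorem measurable_ofReal_abs_rpow (γ : ℝ) :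
    Measurable fun x : ℝ => ENNReal.ofReal (|x| ^ γ) := by fun_prop

theorem measurable_abs_rpow (γ : ℝ) : Measurable fun x : ℝ => |x| ^ γ :=
  (measurable_id.abs).pow_const γ

theorem integrable_abs_rpow {γ : ℝ} {μ : Measure ℝ} (h : absMoment γ μ ≠ ⊤) :
    Integrable (fun x => |x| ^ γ) μ := by
  refine ⟨(measurable_abs_rpow γ).aestronglyMeasurable, ?_⟩
  rw [hasFiniteIntegral_iff_ofReal (ae_of_all _ fun x => by positivity)]
  exact lt_top_iff_ne_top.2 h

theorem integral_abs_rpow (γ : ℝ) (μ : Measure ℝ) :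
    ∫ x, |x| ^ γ ∂μ = (absMoment γ μ).toReal :=
  integral_eq_lintegral_of_nonneg_ae (ae_of_all _ fun x => by positivity)
    (measurable_abs_rpow γ).aestronglyMeasurable

theorem integrable_id_of_absMoment {γ : ℝ} (hγ : 1 ≤ γ) {μ : Measure ℝ} [IsFiniteMeasure μ]
    (h : absMoment γ μ ≠ ⊤) : Integrable (fun x => x) μ := by
  refine ((integrable_const (1 : ℝ)).add (integrable_abs_rpow h)).mono' (by fun_prop)
    (ae_of_all _ fun x => ?_)
  exact abs_le_one_add_rpow hγ x

theorem norm_exp_mul_I_sub_one_le_rpow {γ : ℝ} (h0 : 0 < γ) (h1 : γ ≤ 1) (y : ℝ) :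
    ‖Complex.exp (y * Complex.I) - 1‖ ≤ 3 * |y| ^ γ := by
  rcases le_total |y| 1 with h | h
  · have h2 := Real.norm_exp_I_mul_ofReal_sub_one_le (x := y)
    rw [mul_comm] at h2
    have h3 : |y| ^ (1 : ℝ) ≤ |y| ^ γ :=
      Real.rpow_le_rpow_of_exponent_ge_of_imp (abs_nonneg y) h h1 fun _ h' => absurd h' one_ne_zero
    rw [Real.rpow_one] at h3
    rw [Real.norm_eq_abs] at h2
    have : 0 ≤ |y| ^ γ := by positivity
    linarith
  · have h2 : 1 ≤ |y| ^ γ := Real.one_le_rpow h h0.le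
    refine (norm_sub_le _ _).trans ?_
    rw [Complex.norm_exp_ofReal_mul_I, norm_one]
    linarith

theorem norm_exp_mul_I_sub_one_sub_le_rpow {γ : ℝ} (h1 : 1 < γ) (h2 : γ ≤ 2) (y : ℝ) :
    ‖Complex.exp (y * Complex.I) - 1 - y * Complex.I‖ ≤ 3 * |y| ^ γ := by
  have hn : ‖(y : ℂ) * Complex.I‖ = |y| := by simp
  rcases le_total |y| 1 with h | h
  · have h3 := Complex.norm_exp_sub_one_sub_id_le (x := y * Complex.I) (by rwa [hn])
    rw [hn] at h3
    have h4 : |y| ^ (2 : ℝ) ≤ |y| ^ γ :=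
      Real.rpow_le_rpow_of_exponent_ge_of_imp (abs_nonneg y) h h2 fun _ h' => absurd h' (by linarith)
    rw [Real.rpow_two] at h4
    have : 0 ≤ |y| ^ γ := by positivity
    linarith
  · have h3 : |y| ^ (1 : ℝ) ≤ |y| ^ γ := Real.rpow_le_rpow_of_exponent_le h h1.le
    rw [Real.rpow_one] at h3
    refine (norm_sub_le _ _).trans ?_
    have h4 : ‖Complex.exp (y * Complex.I) - 1‖ ≤ 2 := by
      refine (norm_sub_le _ _).trans ?_
      rw [Complex.norm_exp_ofReal_mul_I, norm_one]
      norm_num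
    rw [hn]
    linarith

theorem norm_charFun_sub_one_le {γ : ℝ} (h0 : 0 < γ) (h2 : γ ≤ 2) {μ : Measure ℝ}
    [IsProbabilityMeasure μ] (hm : absMoment γ μ ≠ ⊤) (hc : 1 < γ → ∫ x, x ∂μ = 0) (ξ : ℝ) :
    ‖charFun μ ξ - 1‖ ≤ 3 * |ξ| ^ γ * (absMoment γ μ).toReal := by
  have hi := integrable_abs_rpow hm
  have he : Integrable (fun x : ℝ => Complex.exp (ξ * x * Complex.I)) μ := by
    refine Integrable.of_bound (C := 1) (by fun_prop) (ae_of_all _ fun x => ?_)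
    rw [← Complex.ofReal_mul, Complex.norm_exp_ofReal_mul_I]
  have hr : ∀ x : ℝ, 3 * |ξ * x| ^ γ = 3 * |ξ| ^ γ * |x| ^ γ := by
    intro x
    rw [abs_mul, Real.mul_rpow (abs_nonneg _) (abs_nonneg _), mul_assoc]
  rw [← integral_abs_rpow, ← integral_const_mul]
  have hb := hi.const_mul (3 * |ξ| ^ γ)
  rcases le_or_gt γ 1 with h1 | h1
  · have : charFun μ ξ - 1 = ∫ x, (Complex.exp (ξ * x * Complex.I) - 1) ∂μ := by
      rw [integral_sub he (integrable_const _), charFun_apply_real]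
      simp
    rw [this]
    refine norm_integral_le_of_norm_le hb (ae_of_all _ fun x => ?_)
    rw [← hr, ← Complex.ofReal_mul]
    exact norm_exp_mul_I_sub_one_le_rpow h0 h1 _
  · have hid := integrable_id_of_absMoment h1.le hm
    have hid' : Integrable (fun x : ℝ => (ξ * x * Complex.I : ℂ)) μ :=
      (hid.ofReal.const_mul _).mul_const _
    have : charFun μ ξ - 1 =
        ∫ x, (Complex.exp (ξ * x * Complex.I) - 1 - ξ * x * Complex.I) ∂μ := by
      rw [integral_sub (f := fun x : ℝ => Complex.exp (ξ * x * Complex.I) - 1)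
        (he.sub (integrable_const _)) hid', integral_sub he (integrable_const _),
        charFun_apply_real, integral_mul_const, integral_const_mul, integral_complex_ofReal, hc h1]
      simp
    rw [this]
    refine norm_integral_le_of_norm_le hb (ae_of_all _ fun x => ?_)
    rw [← hr, ← Complex.ofReal_mul]
    exact norm_exp_mul_I_sub_one_sub_le_rpow h1 h2 _

theorem integral_linear_iterate (κ B t : ℝ) (n : ℕ) :
    ∫ s in (0 : ℝ)..t, κ * (B * ((κ * s) ^ n / n.factorial)) =
      B * ((κ * t) ^ (n + 1) / (n + 1).factorial) := by
  have : ∀ s : ℝ, κ * (B * ((κ * s) ^ n / n.factorial)) =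
      κ ^ (n + 1) * B / n.factorial * s ^ n := by
    intro s
    rw [mul_pow]
    ring
  simp_rw [this]
  rw [intervalIntegral.integral_const_mul, integral_pow, Nat.factorial_succ]
  have : (n.factorial : ℝ) ≠ 0 := by positivity
  have : (n : ℝ) + 1 ≠ 0 := by positivity
  push_cast
  field_simp
  ring

theorem tendsto_linear_iterate (κ B t : ℝ) :
    Tendsto (fun n : ℕ => B * ((κ * t) ^ n / n.factorial)) atTop (𝓝 0) := by
  simpa using (FloorSemiring.tendsto_pow_div_factorial_atTop (κ * t)).const_mul B

/-- The function `x ↦ min(|x|^γ, K)`. -/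
def powTest {γ : ℝ} (hγ : 0 ≤ γ) (K : ℕ) : ℝ →ᵇ ℝ :=
  BoundedContinuousFunction.ofNormedAddCommGroup (fun x => min (|x| ^ γ) K)
    ((continuous_abs.rpow_const fun _ => Or.inr hγ).min continuous_const) K fun x => by
      rw [Real.norm_of_nonneg (le_min (by positivity) (by positivity))]
      exact min_le_right _ _

/-- The function `x ↦ max(-K, min(K, x))`. -/
def clipTest (K : ℕ) : ℝ →ᵇ ℝ :=
  BoundedContinuousFunction.ofNormedAddCommGroup (fun x => max (-(K : ℝ)) (min K x))
    (by fun_prop) K fun x => by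
      rw [Real.norm_eq_abs, abs_le]
      have : (0 : ℝ) ≤ K := by positivity
      exact ⟨le_max_left _ _, max_le (by linarith) (min_le_left _ _)⟩

theorem abs_clipTest_le (K : ℕ) (x : ℝ) : |clipTest K x| ≤ |x| := by
  have hK : (0 : ℝ) ≤ K := by positivity
  simp only [clipTest, BoundedContinuousFunction.coe_ofNormedAddCommGroup]
  rcases abs_cases x with h | h <;> rcases abs_cases (max (-(K : ℝ)) (min K x)) with h' | h' <;>
    rcases max_cases (-(K : ℝ)) (min K x) with h3 | h3 <;>
    rcases min_cases (K : ℝ) x with h4 | h4 <;> linarith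

theorem tendsto_clipTest (x : ℝ) : Tendsto (fun K => clipTest K x) atTop (𝓝 x) := by
  refine tendsto_const_nhds.congr' ?_
  obtain ⟨K₀, hK₀⟩ := exists_nat_ge |x|
  filter_upwards [eventually_ge_atTop K₀] with K hK
  have hK' : |x| ≤ K := hK₀.trans (by exact_mod_cast hK)
  rw [abs_le] at hK'
  simp [clipTest, min_eq_right hK'.2, max_eq_right hK'.1]

theorem tendsto_integral_clipTest {μ : Measure ℝ} (h : Integrable (fun x => x) μ) :
    Tendsto (fun K => ∫ x, clipTest K x ∂μ) atTop (𝓝 (∫ x, x ∂μ)) :=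
  tendsto_integral_of_dominated_convergence (fun x => |x|)
    (fun K => (clipTest K).continuous.aestronglyMeasurable) h.abs
    (fun K => ae_of_all _ fun x => abs_clipTest_le K x) (ae_of_all _ fun x => tendsto_clipTest x)

theorem absMoment_eq_iSup {γ : ℝ} (hγ : 0 ≤ γ) (μ : Measure ℝ) [IsFiniteMeasure μ] :
    absMoment γ μ = ⨆ K : ℕ, ENNReal.ofReal (∫ x, powTest hγ K x ∂μ) := by
  have h1 : ∀ K : ℕ, ENNReal.ofReal (∫ x, powTest hγ K x ∂μ) =
      ∫⁻ x, ENNReal.ofReal (powTest hγ K x) ∂μ := fun K =>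
    ofReal_integral_eq_lintegral_ofReal ((powTest hγ K).integrable μ)
      (ae_of_all _ fun x => le_min (by positivity) (by positivity))
  simp_rw [h1]
  rw [← lintegral_iSup (fun K => (powTest hγ K).continuous.measurable.ennreal_ofReal)]
  · refine lintegral_congr fun x => le_antisymm ?_ (iSup_le fun K => ?_)
    · obtain ⟨K, hK⟩ := exists_nat_ge (|x| ^ γ)
      refine le_iSup_of_le K (ENNReal.ofReal_le_ofReal ?_)
      exact le_min le_rfl hK
    · exact ENNReal.ofReal_le_ofReal (min_le_left _ _)
  · intro K L hKL x
    refine ENNReal.ofReal_le_ofReal (min_le_min le_rfl ?_)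
    exact_mod_cast hKL

theorem integral_powTest_le {γ : ℝ} (hγ : 0 ≤ γ) {μ : Measure ℝ} [IsFiniteMeasure μ]
    (h : absMoment γ μ ≠ ⊤) (K : ℕ) : ∫ x, powTest hγ K x ∂μ ≤ (absMoment γ μ).toReal := by
  rw [← integral_abs_rpow]
  exact integral_mono ((powTest hγ K).integrable μ) (integrable_abs_rpow h)
    fun x => min_le_left _ _

/-! ### Uniqueness in the class of solutions with locally bounded moments -/

theorem LocallyBoundedMoment.exists_bound {γ : ℝ} {μ : ℝ≥0 → ProbabilityMeasure ℝ}
    (h : LocallyBoundedMoment γ μ) (T : ℝ) :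
    ∃ C : ℝ, 0 ≤ C ∧ ∀ s : ℝ, s ≤ T → absMoment γ (μ s.toNNReal : Measure ℝ) ≠ ⊤ ∧
      (absMoment γ (μ s.toNNReal : Measure ℝ)).toReal ≤ C := by
  have hT := h T.toNNReal
  refine ⟨_, ENNReal.toReal_nonneg (a := ⨆ s ∈ Set.Icc 0 T.toNNReal,
    absMoment γ (μ s : Measure ℝ)), fun s hs => ?_⟩
  have hle : absMoment γ (μ s.toNNReal : Measure ℝ) ≤
      ⨆ s ∈ Set.Icc 0 T.toNNReal, absMoment γ (μ s : Measure ℝ) :=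
    le_iSup₂_of_le s.toNNReal ⟨zero_le, Real.toNNReal_le_toNNReal hs⟩ le_rfl
  exact ⟨(hle.trans_lt hT).ne, ENNReal.toReal_mono hT.ne hle⟩

section Uniqueness

variable {Ω₀ : Type*} [MeasurableSpace Ω₀]
  {P₀ : Measure Ω₀} [IsProbabilityMeasure P₀] {A : Ω₀ → ℕ → ℝ≥0} (hA : Measurable A)

include hA

/-- The mean of `Q(μ)` is the mean of `μ` times `E[∑ A_j]`, if `Q(μ)` has a mean. Here the last
expectation is a Bochner integral, which vanishes if it does not exist. -/
theorem integral_smoothing_eq (μ : ProbabilityMeasure ℝ)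
    (hi : Integrable (fun x : ℝ => x) (μ : Measure ℝ))
    (hQ : Integrable (fun x : ℝ => x) (smoothing P₀ A μ)) :
    ∫ x, x ∂(smoothing P₀ A μ) =
      (∫ ω, ∑ j ∈ Finset.range (numWeights (A ω)), (A ω j : ℝ) ∂P₀) *
        ∫ x, x ∂(μ : Measure ℝ) := by
  have hm := measurable_weightedSum_comp hA
  rw [smoothing, integrable_map_measure (by fun_prop) hm.aemeasurable] at hQ
  rw [smoothing, integral_map hm.aemeasurable (by fun_prop), integral_prod (fun p => weightedSum (A p.1) p.2) hQ,
    ← integral_mul_const]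
  refine integral_congr_ae (ae_of_all _ fun ω => ?_)
  simp only [weightedSum]
  have hmp := fun j : ℕ => measurePreserving_eval_infinitePi (fun _ : ℕ => (μ : Measure ℝ)) j
  rw [integral_finsetSum, Finset.sum_mul]
  · refine Finset.sum_congr rfl fun j _ => ?_
    rw [integral_const_mul]
    congr 1
    have := integral_map (φ := Function.eval j) (hmp j).measurable.aemeasurable
      (f := fun x : ℝ => x) (μ := Measure.infinitePi fun _ : ℕ => (μ : Measure ℝ)) (by fun_prop)
    rw [(hmp j).map_eq] at this
    exact this.symm
  · intro j _
    exact ((hmp j).integrable_comp_of_integrable hi).const_mul _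

theorem measurable_absMoment_smoothing {γ : ℝ} (hγ : 0 ≤ γ) {μ : ℝ≥0 → ProbabilityMeasure ℝ}
    (h : Continuous fun s : ℝ => μ s.toNNReal) :
    Measurable fun s : ℝ => absMoment γ (smoothing P₀ A (μ s.toNNReal)) := by
  have hp := isProbabilityMeasure_smoothing P₀ A hA
  have : (fun s : ℝ => absMoment γ (smoothing P₀ A (μ s.toNNReal))) = fun s : ℝ =>
      ⨆ K : ℕ, ENNReal.ofReal (∫ x, powTest hγ K x ∂(smoothing P₀ A (μ s.toNNReal))) := by
    ext s
    have := hp (μ s.toNNReal)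
    exact absMoment_eq_iSup hγ _
  rw [this]
  exact Measurable.iSup fun K =>
    (continuous_integral_smoothing (P₀ := P₀) hA h _).measurable.ennreal_ofReal

theorem IsSolution.lintegral_absMoment_smoothing_lt_top {γ : ℝ} (hγ : 0 ≤ γ)
    {μ₀ : ProbabilityMeasure ℝ} {μ : ℝ≥0 → ProbabilityMeasure ℝ} (hμ : IsSolution P₀ A μ₀ μ)
    (hm : LocallyBoundedMoment γ μ) {T : ℝ} (hT : 0 ≤ T) :
    ∫⁻ s in Set.Ioc 0 T, absMoment γ (smoothing P₀ A (μ s.toNNReal)) < ⊤ := by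
  have hp := isProbabilityMeasure_smoothing P₀ A hA
  obtain ⟨C, -, hC⟩ := hm.exists_bound T
  have hcont := fun K => continuous_integral_smoothing (P₀ := P₀) hA hμ.continuous_curve
    (powTest hγ K)
  have hnn : ∀ (K : ℕ) (ν : Measure ℝ), 0 ≤ ∫ x, powTest hγ K x ∂ν := fun K ν =>
    integral_nonneg fun x => le_min (by positivity) (by positivity)
  have hK : ∀ K : ℕ, ∫⁻ s in Set.Ioc 0 T, ENNReal.ofReal
      (∫ x, powTest hγ K x ∂(smoothing P₀ A (μ s.toNNReal))) ≤
        ENNReal.ofReal (Real.exp T * C) := by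
    intro K
    rw [← ofReal_integral_eq_lintegral_ofReal
      ((hcont K).integrableOn_Ioc) (ae_of_all _ fun s => hnn _ _),
      ← intervalIntegral.integral_of_le hT]
    refine ENNReal.ofReal_le_ofReal ?_
    have h1 := hμ.mild hA (powTest hγ K) hT
    have h2 := (integral_powTest_le hγ (hC T le_rfl).1 K).trans (hC T le_rfl).2
    have h3 : ∫ s in (0 : ℝ)..T, ∫ x, powTest hγ K x ∂(smoothing P₀ A (μ s.toNNReal)) ≤
        ∫ s in (0 : ℝ)..T, Real.exp s *
          ∫ x, powTest hγ K x ∂(smoothing P₀ A (μ s.toNNReal)) := by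
      refine intervalIntegral.integral_mono_on hT ((hcont K).intervalIntegrable _ _)
        ((Real.continuous_exp.mul (hcont K)).intervalIntegrable _ _) fun s hs => ?_
      exact le_mul_of_one_le_left (hnn _ _) (Real.one_le_exp hs.1)
    have h4 := hnn K (μ₀ : Measure ℝ)
    rw [h1] at h2
    have h5 : Real.exp T * (Real.exp (-T) * (∫ x, powTest hγ K x ∂(μ₀ : Measure ℝ) +
        ∫ s in (0 : ℝ)..T, Real.exp s *
          ∫ x, powTest hγ K x ∂(smoothing P₀ A (μ s.toNNReal)))) ≤ Real.exp T * C :=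
      mul_le_mul_of_nonneg_left h2 (Real.exp_pos T).le
    rw [← mul_assoc, ← Real.exp_add, add_neg_cancel, Real.exp_zero, one_mul] at h5
    linarith
  have : ∫⁻ s in Set.Ioc 0 T, absMoment γ (smoothing P₀ A (μ s.toNNReal)) =
      ⨆ K : ℕ, ∫⁻ s in Set.Ioc 0 T, ENNReal.ofReal
        (∫ x, powTest hγ K x ∂(smoothing P₀ A (μ s.toNNReal))) := by
    rw [← lintegral_iSup (fun K => (hcont K).measurable.ennreal_ofReal)]
    · exact lintegral_congr fun s => by
        have := hp (μ s.toNNReal)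
        exact absMoment_eq_iSup hγ _
    · intro K L hKL s
      have := hp (μ s.toNNReal)
      refine ENNReal.ofReal_le_ofReal (integral_mono ((powTest hγ K).integrable _)
        ((powTest hγ L).integrable _) fun x => min_le_min le_rfl ?_)
      exact Nat.cast_le.2 hKL
  rw [this]
  exact (iSup_le hK).trans_lt ENNReal.ofReal_lt_top

/-- Solutions with locally bounded moments of an order larger than one stay centered. -/
theorem IsSolution.integral_eq_zero {γ : ℝ} (hγ : 1 < γ)
    {μ₀ : ProbabilityMeasure ℝ} {μ : ℝ≥0 → ProbabilityMeasure ℝ} (hμ : IsSolution P₀ A μ₀ μ)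
    (hm : LocallyBoundedMoment γ μ) (h0 : ∫ x, x ∂(μ₀ : Measure ℝ) = 0) {t : ℝ} (ht : 0 ≤ t) :
    ∫ x, x ∂(μ t.toNNReal : Measure ℝ) = 0 := by
  have hp := isProbabilityMeasure_smoothing P₀ A hA
  have hγ0 : 0 ≤ γ := by linarith
  set κ := ∫ ω, ∑ j ∈ Finset.range (numWeights (A ω)), (A ω j : ℝ) ∂P₀ with hκ
  set a : ℝ → ℝ := fun s => ∫ x, x ∂(μ s.toNNReal : Measure ℝ) with ha
  have hfin : ∀ s : ℝ, absMoment γ (μ s.toNNReal : Measure ℝ) ≠ ⊤ := fun s => by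
    obtain ⟨C, -, hC⟩ := hm.exists_bound s
    exact (hC s le_rfl).1
  have hai : ∀ s : ℝ, Integrable (fun x => x) (μ s.toNNReal : Measure ℝ) := fun s =>
    integrable_id_of_absMoment hγ.le (hfin s)
  have hmild : ∀ t, 0 ≤ t →
      a t = Real.exp (-t) * ∫ s in (0 : ℝ)..t, Real.exp s * (κ * a s) := by
    intro t ht
    have hG := measurable_absMoment_smoothing (P₀ := P₀) hA hγ0 hμ.continuous_curve
    have hGfin := hμ.lintegral_absMoment_smoothing_lt_top hA hγ0 hm ht
    have hae := ae_lt_top hG hGfin.ne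
    have hlim0 : Tendsto (fun K => ∫ x, clipTest K x ∂(μ₀ : Measure ℝ)) atTop (𝓝 0) := by
      rw [← h0, ← hμ.initial]
      have := tendsto_integral_clipTest (hai 0)
      rwa [Real.toNNReal_zero] at this
    have hint : IntervalIntegrable (fun s => Real.exp t *
        (1 + (absMoment γ (smoothing P₀ A (μ s.toNNReal))).toReal)) volume 0 t := by
      rw [intervalIntegrable_iff_integrableOn_Ioc_of_le ht]
      exact ((integrable_const (1 : ℝ)).add
        (integrable_toReal_of_lintegral_ne_top hG.aemeasurable hGfin.ne)).const_mul _
    have hlim : Tendsto (fun K => ∫ s in (0 : ℝ)..t, Real.exp s *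
        ∫ x, clipTest K x ∂(smoothing P₀ A (μ s.toNNReal))) atTop
        (𝓝 (∫ s in (0 : ℝ)..t, Real.exp s * (κ * a s))) := by
      refine intervalIntegral.tendsto_integral_filter_of_dominated_convergence
        (fun s => Real.exp t * (1 + (absMoment γ (smoothing P₀ A (μ s.toNNReal))).toReal))
        (.of_forall fun K => ?_) (.of_forall fun K => ?_) hint ?_
      · exact (Real.continuous_exp.mul (continuous_integral_smoothing (P₀ := P₀) hA
          hμ.continuous_curve _)).aestronglyMeasurable
      · rw [Set.uIoc_of_le ht]
        filter_upwards [(ae_restrict_iff' measurableSet_Ioc).1 hae] with s hs hst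
        have hs' := hs hst
        have := hp (μ s.toNNReal)
        rw [norm_mul, Real.norm_of_nonneg (Real.exp_pos s).le]
        refine mul_le_mul (Real.exp_le_exp.2 hst.2) ?_ (norm_nonneg _) (Real.exp_pos t).le
        have h3 : (1 : ℝ) + (absMoment γ (smoothing P₀ A (μ s.toNNReal))).toReal =
            ∫ x, (1 + |x| ^ γ) ∂(smoothing P₀ A (μ s.toNNReal)) := by
          rw [integral_add (integrable_const _) (integrable_abs_rpow hs'.ne), integral_abs_rpow]
          simp
        rw [h3]
        refine norm_integral_le_of_norm_le
          ((integrable_const _).add (integrable_abs_rpow hs'.ne)) (ae_of_all _ fun x => ?_)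
        exact (abs_clipTest_le K x).trans (abs_le_one_add_rpow hγ.le x)
      · rw [Set.uIoc_of_le ht]
        filter_upwards [(ae_restrict_iff' measurableSet_Ioc).1 hae] with s hs hst
        have := hp (μ s.toNNReal)
        have hi := integrable_id_of_absMoment hγ.le (hs hst).ne
        have h3 := integral_smoothing_eq (P₀ := P₀) hA (μ s.toNNReal) (hai s) hi
        simp only [ha, hκ]
        rw [← h3]
        exact (tendsto_integral_clipTest hi).const_mul _
    have h1 := tendsto_integral_clipTest (hai t)
    simp_rw [hμ.mild hA _ ht] at h1
    have h2 := (hlim0.add hlim).const_mul (Real.exp (-t))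
    rw [zero_add] at h2
    exact tendsto_nhds_unique h1 h2
  obtain ⟨C, hC0, hC⟩ := hm.exists_bound t
  have key : ∀ n : ℕ, ∀ s, 0 ≤ s → s ≤ t →
      |a s| ≤ (1 + C) * ((|κ| * s) ^ n / n.factorial) := by
    intro n
    induction n with
    | zero =>
      intro s _ hst
      have h1 : ‖a s‖ ≤ ∫ x, (1 + |x| ^ γ) ∂(μ s.toNNReal : Measure ℝ) :=
        norm_integral_le_of_norm_le ((integrable_const _).add (integrable_abs_rpow (hfin s)))
          (ae_of_all _ fun x => abs_le_one_add_rpow hγ.le x)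
      rw [integral_add (integrable_const _) (integrable_abs_rpow (hfin s)),
        integral_abs_rpow] at h1
      have := (hC s hst).2
      simp at h1 ⊢
      linarith
    | succ n ih =>
      intro s hs hst
      rw [hmild s hs, ← Real.norm_eq_abs, ← integral_linear_iterate, ← intervalIntegral.integral_const_mul]
      have hcont : Continuous fun r => |κ| * ((1 + C) * ((|κ| * r) ^ n / n.factorial)) := by
        fun_prop
      refine intervalIntegral.norm_integral_le_of_norm_le hs
        (ae_of_all _ fun r hr => ?_) (hcont.intervalIntegrable 0 s)
      rw [← mul_assoc, ← Real.exp_add, norm_mul, norm_mul, Real.norm_of_nonneg (Real.exp_pos _).le]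
      have h1 : Real.exp (-s + r) ≤ 1 := by
        rw [Real.exp_le_one_iff]
        linarith [hr.2]
      refine (mul_le_of_le_one_left (by positivity) h1).trans ?_
      exact mul_le_mul_of_nonneg_left (ih r hr.1.le (hr.2.trans hst)) (abs_nonneg _)
  have h1 := ge_of_tendsto (tendsto_linear_iterate |κ| (1 + C) t)
    (.of_forall fun n => key n t ht le_rfl)
  exact abs_nonpos_iff.1 h1

omit [IsProbabilityMeasure P₀] in
theorem measurable_sum_rpow (γ : ℝ) : Measurable fun ω =>
    ∑ j ∈ Finset.range (numWeights (A ω)), ((A ω j : ℝ≥0∞)) ^ γ := by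
  have h : Measurable fun q : ℕ × (ℕ → ℝ≥0) => ∑ j ∈ Finset.range q.1, ((q.2 j : ℝ≥0∞)) ^ γ :=
    measurable_from_prod_countable_right fun n =>
      Finset.measurable_fun_sum (Finset.range n) fun j _ => by fun_prop
  exact h.comp ((measurable_numWeights.comp hA).prodMk hA)

omit hA [IsProbabilityMeasure P₀] in
theorem lintegral_lt_top_of_Phi {γ : ℝ} (h : Phi P₀ A γ < ⊤) :
    ∫⁻ ω, ∑ j ∈ Finset.range (numWeights (A ω)), ((A ω j : ℝ≥0∞)) ^ γ ∂P₀ < ⊤ := by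
  by_contra hx
  rw [not_lt, top_le_iff] at hx
  rw [Phi, hx] at h
  exact absurd (EReal.top_sub_coe 1) h.ne

/-- Uniqueness among the solutions with locally bounded moments. -/
theorem IsSolution.unique_of_moment {γ : ℝ} (h0 : 0 < γ) (h2 : γ ≤ 2)
    {μ₀ : ProbabilityMeasure ℝ} {μ ν : ℝ≥0 → ProbabilityMeasure ℝ} (hμ₀ : μ₀ ∈ MomentClass γ)
    (hΦ : Phi P₀ A γ < ⊤) (hμ : IsSolution P₀ A μ₀ μ) (hν : IsSolution P₀ A μ₀ ν)
    (hμm : LocallyBoundedMoment γ μ) (hνm : LocallyBoundedMoment γ ν) : μ = ν := by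
  have hSm := measurable_sum_rpow hA γ
  have hSfin := lintegral_lt_top_of_Phi hΦ
  have hreal : ∀ ω, (∑ j ∈ Finset.range (numWeights (A ω)), ((A ω j : ℝ≥0∞)) ^ γ).toReal =
      ∑ j ∈ Finset.range (numWeights (A ω)), (A ω j : ℝ) ^ γ := by
    intro ω
    rw [ENNReal.toReal_sum fun j _ => by simp [h0.le]]
    exact Finset.sum_congr rfl fun j _ => by rw [← ENNReal.toReal_rpow, ENNReal.coe_toReal]
  have hSi : Integrable (fun ω => ∑ j ∈ Finset.range (numWeights (A ω)), (A ω j : ℝ) ^ γ) P₀ := by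
    simp_rw [← hreal]
    exact integrable_toReal_of_lintegral_ne_top hSm.aemeasurable hSfin.ne
  set m := ∫ ω, ∑ j ∈ Finset.range (numWeights (A ω)), (A ω j : ℝ) ^ γ ∂P₀ with hm
  refine eq_of_charFun_eq fun t ht ξ => ?_
  obtain ⟨C, hC0, hC⟩ := hμm.exists_bound t
  obtain ⟨D, hD0, hD⟩ := hνm.exists_bound t
  have key : ∀ n : ℕ, ∀ s, 0 ≤ s → s ≤ t → ∀ ξ, ‖charFun (μ s.toNNReal : Measure ℝ) ξ -
      charFun (ν s.toNNReal : Measure ℝ) ξ‖ ≤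
        (3 * |ξ| ^ γ * (C + D)) * ((m * s) ^ n / n.factorial) := by
    intro n
    induction n with
    | zero =>
      intro s hs hst ξ
      have h3 := norm_charFun_sub_one_le h0 h2 (hC s hst).1
        (fun h => hμ.integral_eq_zero hA h hμm (hμ₀.2 h) hs) ξ
      have h4 := norm_charFun_sub_one_le h0 h2 (hD s hst).1
        (fun h => hν.integral_eq_zero hA h hνm (hμ₀.2 h) hs) ξ
      have h5 := norm_sub_le (charFun (μ s.toNNReal : Measure ℝ) ξ - 1)
        (charFun (ν s.toNNReal : Measure ℝ) ξ - 1)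
      rw [sub_sub_sub_cancel_right] at h5
      have h6 : 0 ≤ 3 * |ξ| ^ γ := by positivity
      have h7 := mul_le_mul_of_nonneg_left (hC s hst).2 h6
      have h8 := mul_le_mul_of_nonneg_left (hD s hst).2 h6
      simp only [pow_zero, Nat.factorial_zero, Nat.cast_one, div_one, mul_one]
      linarith
    | succ n ih =>
      intro s hs hst ξ
      rw [← integral_linear_iterate]
      refine hμ.norm_charFun_sub_le hA hν ξ hs
        (Continuous.intervalIntegrable (by fun_prop) _ _) fun r hr hrs => ?_
      rw [smoothing_eq_mixedSmoothing, smoothing_eq_mixedSmoothing, charFun_mixedSmoothing hA,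
        charFun_mixedSmoothing hA, ← integral_sub (integrable_prod_charFun hA _ ξ)
          (integrable_prod_charFun hA _ ξ), hm, ← integral_mul_const]
      refine norm_integral_le_of_norm_le (hSi.mul_const _) (ae_of_all _ fun ω => ?_)
      refine (norm_prod_sub_prod_le _ _ _ (fun j => norm_charFun_le_one _)
        fun j => norm_charFun_le_one _).trans ?_
      rw [Finset.sum_mul]
      refine Finset.sum_le_sum fun j _ => (ih r hr (hrs.trans hst) (A ω j * ξ)).trans_eq ?_
      rw [abs_mul, Real.mul_rpow (abs_nonneg _) (abs_nonneg _), NNReal.abs_eq]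
      ring
  have h3 := ge_of_tendsto (tendsto_linear_iterate m (3 * |ξ| ^ γ * (C + D)) t)
    (.of_forall fun n => key n t ht le_rfl ξ)
  exact sub_eq_zero.1 (norm_le_zero_iff.1 h3)

end Uniqueness

/-! ### Product measures -/

theorem infinitePi_map_zip {ι α β : Type*} [MeasurableSpace α] [MeasurableSpace β]
    (μ : ι → Measure α) (ν : ι → Measure β) [∀ i, IsProbabilityMeasure (μ i)]
    [∀ i, IsProbabilityMeasure (ν i)] :
    ((Measure.infinitePi μ).prod (Measure.infinitePi ν)).map (fun p i => (p.1 i, p.2 i)) =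
      Measure.infinitePi fun i => (μ i).prod (ν i) := by
  refine IsProjectiveLimit.unique (P := fun I : Finset ι => Measure.pi fun i : I =>
    (μ i).prod (ν i)) (fun I => ?_) (Measure.isProjectiveLimit_infinitePi _)
  rw [Measure.map_map (by fun_prop) (by fun_prop)]
  have h := (measurePreserving_arrowProdEquivProdArrow α β I (fun i => μ i)
    fun i => ν i).symm.map_eq
  change _ = Measure.pi fun i : I => (μ i).prod (ν i)
  rw [← h, ← Measure.infinitePi_map_restrict, ← Measure.infinitePi_map_restrict,
    Measure.map_prod_map _ _ (by fun_prop) (by fun_prop),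
    Measure.map_map (MeasurableEquiv.measurable _) (by fun_prop)]
  rfl

/-! ### Finite sets of words -/

/-- The words `v` such that `jv` is in `F`. -/
def tailSet (F : Finset (List ℕ)) (j : ℕ) : Finset (List ℕ) :=
  F.preimage (List.cons j) (List.cons_injective.injOn)

@[simp]
theorem mem_tailSet {F : Finset (List ℕ)} {j : ℕ} {v : List ℕ} :
    v ∈ tailSet F j ↔ j :: v ∈ F := by
  simp [tailSet]

@[to_additive]
theorem prod_eq_mul_prod_tailSet {M : Type*} [CommMonoid M] (F : Finset (List ℕ))
    (g : List ℕ → M) (n : ℕ) (h : ∀ j v, n ≤ j → j :: v ∈ F → g (j :: v) = 1) :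
    ∏ u ∈ F, g u = (if [] ∈ F then g [] else 1) *
      ∏ j ∈ Finset.range n, ∏ v ∈ tailSet F j, g (j :: v) := by
  classical
  have h1 : ∏ u ∈ F.filter (· = []), g u = if [] ∈ F then g [] else 1 := by
    rw [Finset.prod_filter]
    convert Finset.prod_ite_eq' F [] g
  rw [← Finset.prod_filter_mul_prod_filter_not F (· = []), h1, Finset.prod_sigma']
  congr 1
  symm
  refine Finset.prod_of_injOn (fun p => p.1 :: p.2) ?_ ?_ ?_ fun _ _ => rfl
  · rintro ⟨i, v⟩ _ ⟨j, w⟩ _ hij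
    simp only [List.cons.injEq] at hij
    obtain ⟨rfl, rfl⟩ := hij
    rfl
  · rintro ⟨i, v⟩ hi
    simp only [Finset.coe_sigma, Set.mem_sigma_iff, Finset.mem_coe, mem_tailSet] at hi
    simpa using hi.2
  · intro u hu hnot
    rw [Finset.mem_filter] at hu
    match u, hu with
    | j :: v, hu =>
      refine h j v ?_ hu.1
      by_contra hlt
      refine hnot ⟨⟨j, v⟩, ?_, rfl⟩
      simpa using ⟨not_le.1 hlt, hu.1⟩

theorem exists_bound_heads (F : Finset (List ℕ)) : ∃ n, ∀ j v, n ≤ j → j :: v ∉ F := by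
  refine ⟨F.sup (fun u => u.headD 0) + 1, fun j v hj hmem => ?_⟩
  have := Finset.le_sup (f := fun u : List ℕ => u.headD 0) hmem
  simp only [List.headD_cons] at this
  omega

theorem tendsto_tailSet (j : ℕ) : Tendsto (fun F => tailSet F j) atTop atTop := by
  classical
  refine tendsto_atTop.2 fun G => ?_
  filter_upwards [eventually_ge_atTop (G.image (List.cons j))] with F hF v hv
  exact mem_tailSet.2 (hF (Finset.mem_image_of_mem _ hv))

/-! ### The canonical space -/

/-- The weights, the lifetime and the value attached to a particle. -/
abbrev Driver : Type := ((ℕ → ℝ≥0) × ℝ) × ℝ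

/-- The canonical space of the branching random walk. -/
abbrev Tree : Type := List ℕ → Driver

/-- The weights of the particle `u`. -/
def treeA (u : List ℕ) (ω : Tree) : ℕ → ℝ≥0 := (ω u).1.1

/-- The lifetime of the particle `u`. -/
def treeE (u : List ℕ) (ω : Tree) : ℝ := (ω u).1.2

/-- The value of the particle `u`. -/
def treeX (u : List ℕ) (ω : Tree) : ℝ := (ω u).2

/-- The tree of the descendants of the `j`-th child of the ancestor. -/
def subtree (j : ℕ) (ω : Tree) : Tree := fun v => ω (j :: v)

/-- The tree with given data of the ancestor and given trees of the descendants of its children. -/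
def graft (p : Driver × (ℕ → Tree)) : Tree
  | [] => p.1
  | j :: v => p.2 j v

theorem measurable_graft : Measurable graft := by
  refine measurable_pi_lambda _ fun u => ?_
  match u with
  | [] => exact measurable_fst
  | j :: v =>
    exact (measurable_pi_apply v).comp ((measurable_pi_apply j).comp measurable_snd)

instance : IsProbabilityMeasure (expMeasure 1) := isProbabilityMeasure_expMeasure one_pos

variable (α : Measure (ℕ → ℝ≥0)) (μ₀ : ProbabilityMeasure ℝ)

/-- The joint law of the weights, the lifetime and the value of a particle. -/
def driverLaw : Measure Driver := (α.prod (expMeasure 1)).prod (μ₀ : Measure ℝ)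

/-- The law of the branching random walk on the canonical space. -/
def treeLaw : Measure Tree := Measure.infinitePi fun _ => driverLaw α μ₀

variable [IsProbabilityMeasure α]

instance : IsProbabilityMeasure (driverLaw α μ₀) :=
  inferInstanceAs (IsProbabilityMeasure ((α.prod (expMeasure 1)).prod (μ₀ : Measure ℝ)))

instance : IsProbabilityMeasure (treeLaw α μ₀) :=
  inferInstanceAs (IsProbabilityMeasure (Measure.infinitePi fun _ => driverLaw α μ₀))

theorem map_graft :
    ((driverLaw α μ₀).prod (Measure.infinitePi fun _ : ℕ => treeLaw α μ₀)).map graft =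
      treeLaw α μ₀ := by
  refine Measure.eq_infinitePi _ fun s t ht => ?_
  obtain ⟨n, hn⟩ := exists_bound_heads s
  rw [prod_eq_mul_prod_tailSet s _ n fun j v hj hmem => absurd hmem (hn j v hj),
    Measure.map_apply measurable_graft
      (MeasurableSet.pi s.countable_toSet fun i _ => ht i)]
  have hpre : graft ⁻¹' (Set.pi s t) = (if [] ∈ s then t [] else Set.univ) ×ˢ
      (Set.pi (Finset.range n : Set ℕ) fun j => Set.pi (tailSet s j) fun v => t (j :: v)) := by
    ext p
    simp only [Set.mem_preimage, Set.mem_pi, Set.mem_prod, Finset.mem_coe, mem_tailSet,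
      Finset.mem_range]
    constructor
    · intro h
      refine ⟨?_, fun j _ v hv => h _ hv⟩
      split_ifs with h0
      · exact h [] h0
      · trivial
    · rintro ⟨h0, h1⟩ u hu
      match u, hu with
      | [], hu =>
        rw [if_pos hu] at h0
        exact h0
      | j :: v, hu =>
        refine h1 j ?_ v hu
        by_contra hlt
        exact hn j v (not_lt.1 hlt) hu
  rw [hpre, Measure.prod_prod, Measure.infinitePi_pi]
  · congr 1
    · split_ifs <;> simp
    · refine Finset.prod_congr rfl fun j _ => ?_
      exact Measure.infinitePi_pi _ fun v _ => ht _
  · exact fun j _ => MeasurableSet.pi (Finset.countable_toSet _) fun v _ => ht _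

theorem map_root_subtree (j : ℕ) :
    (treeLaw α μ₀).map (fun ω => (ω [], subtree j ω)) = (driverLaw α μ₀).prod (treeLaw α μ₀) := by
  have hm : Measurable fun ω : Tree => (ω [], subtree j ω) :=
    (measurable_pi_apply _).prodMk (measurable_pi_lambda _ fun v => measurable_pi_apply _)
  have h2 : (driverLaw α μ₀).prod (treeLaw α μ₀) =
      ((driverLaw α μ₀).prod (Measure.infinitePi fun _ : ℕ => treeLaw α μ₀)).map
        (Prod.map id fun y => y j) := by
    rw [← Measure.map_prod_map _ _ measurable_id (measurable_pi_apply j), Measure.map_id,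
      Measure.infinitePi_map_eval]
  conv_lhs => rw [← map_graft α μ₀]
  rw [h2, Measure.map_map hm measurable_graft]
  rfl

/-! ### Driving families -/

omit [IsProbabilityMeasure α] in
theorem IsDrivingFamily.map_eq {Ω₀ Ω : Type*} [MeasurableSpace Ω₀] [MeasurableSpace Ω]
    {P₀ : Measure Ω₀} [IsProbabilityMeasure P₀] {A : Ω₀ → ℕ → ℝ≥0} (hA : Measurable A)
    {P : Measure Ω} [IsProbabilityMeasure P]
    {A' : List ℕ → Ω → ℕ → ℝ≥0} {E X : List ℕ → Ω → ℝ}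
    (h : IsDrivingFamily P₀ A μ₀ P A' E X) :
    P.map (fun ω u => ((A' u ω, E u ω), X u ω)) = treeLaw (P₀.map A) μ₀ := by
  have hp : ∀ u, Measurable fun ω => (A' u ω, E u ω) := fun u =>
    (h.measurable_A u).prodMk (h.measurable_E u)
  have hprob : IsProbabilityMeasure (P₀.map A) :=
    Measure.isProbabilityMeasure_map hA.aemeasurable
  have h1 := (iIndepFun_iff_map_fun_eq_infinitePi_map hp).1 h.indep_pair
  have h2 := (iIndepFun_iff_map_fun_eq_infinitePi_map h.measurable_X).1 h.indep_X
  have h3 := (indepFun_iff_map_prod_eq_prod_map_map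
    (measurable_pi_lambda _ hp).aemeasurable
    (measurable_pi_lambda _ h.measurable_X).aemeasurable).1 h.indep
  simp_rw [h.map_pair] at h1
  simp_rw [h.map_X] at h2
  rw [h1, h2] at h3
  rw [treeLaw, ← show _ = Measure.infinitePi fun _ => driverLaw (P₀.map A) μ₀ from
    infinitePi_map_zip (fun _ : List ℕ => (P₀.map A).prod (expMeasure 1))
      fun _ => (μ₀ : Measure ℝ), ← h3,
    Measure.map_map (by fun_prop)
      ((measurable_pi_lambda _ hp).prodMk (measurable_pi_lambda _ h.measurable_X))]
  rfl

/-! ### The branching random walk on the canonical space -/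

/-- `e^{-S(u)}`, the product of the weights along the path to `u`. -/
def pathWeight : List ℕ → Tree → ℝ≥0
  | [], _ => 1
  | j :: v, ω => treeA [] ω j * pathWeight v (subtree j ω)

theorem measurable_subtree (j : ℕ) : Measurable (subtree j) :=
  measurable_pi_lambda _ fun _ => measurable_pi_apply _

theorem measurable_treeA (u : List ℕ) : Measurable (treeA u) :=
  (measurable_fst.comp measurable_fst).comp (measurable_pi_apply u)

theorem measurable_treeE (u : List ℕ) : Measurable (treeE u) :=
  (measurable_snd.comp measurable_fst).comp (measurable_pi_apply u)

theorem measurable_treeX (u : List ℕ) : Measurable (treeX u) :=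
  measurable_snd.comp (measurable_pi_apply u)

theorem measurable_pathWeight (u : List ℕ) : Measurable (pathWeight u) := by
  induction u with
  | nil => exact measurable_const
  | cons j v ih =>
    exact ((measurable_pi_apply j).comp (measurable_treeA [])).mul (ih.comp (measurable_subtree j))

theorem measurable_birthTime (u : List ℕ) : Measurable (birthTime treeE u) :=
  Finset.measurable_fun_sum _ fun _ _ => measurable_treeE _

@[simp]
theorem birthTime_nil (ω : Tree) : birthTime treeE [] ω = 0 := by simp [birthTime]

theorem birthTime_cons (j : ℕ) (v : List ℕ) (ω : Tree) :
    birthTime treeE (j :: v) ω = treeE [] ω + birthTime treeE v (subtree j ω) := by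
  simp only [birthTime, List.length_cons, Fin.sum_univ_succ]
  rfl

theorem exp_neg_position (u : List ℕ) (ω : Tree) :
    EReal.exp (-position treeA u ω) = pathWeight u ω := by
  induction u generalizing ω with
  | nil => simp [position, pathWeight]
  | cons j v ih =>
    have h := ih (subtree j ω)
    rw [position, neg_neg] at h ⊢
    simp only [List.length_cons, Fin.sum_univ_succ]
    rw [EReal.exp_add, pathWeight, ENNReal.coe_mul, ← h]
    congr 1
    exact ENNReal.exp_log _

theorem position_lt_top_iff (u : List ℕ) (ω : Tree) :
    position treeA u ω < ⊤ ↔ pathWeight u ω ≠ 0 := by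
  have h := exp_neg_position u ω
  rw [← ENNReal.coe_ne_zero, ← h, Ne, EReal.exp_eq_zero_iff, EReal.neg_eq_bot_iff,
    lt_top_iff_ne_top]

theorem summand_tree (u : List ℕ) (ω : Tree) :
    summand treeA treeX u ω = pathWeight u ω * treeX u ω := by
  rw [summand, exp_neg_position, ENNReal.coe_toReal]

/-- The weight of the particle `u` if it is alive at time `t`, and zero otherwise. -/
def aliveWeight (t : ℝ) (u : List ℕ) (ω : Tree) : ℝ :=
  if birthTime treeE u ω ≤ t ∧ t < birthTime treeE u ω + treeE u ω then pathWeight u ω else 0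

theorem aliveWeight_nil (t : ℝ) (ω : Tree) :
    aliveWeight t [] ω = if 0 ≤ t ∧ t < treeE [] ω then 1 else 0 := by
  simp [aliveWeight, pathWeight]

theorem aliveWeight_cons (t : ℝ) (j : ℕ) (v : List ℕ) (ω : Tree) :
    aliveWeight t (j :: v) ω =
      treeA [] ω j * aliveWeight (t - treeE [] ω) v (subtree j ω) := by
  simp only [aliveWeight, birthTime_cons, pathWeight, NNReal.coe_mul, mul_ite, mul_zero]
  refine if_congr (and_congr ?_ ?_) rfl rfl
  · constructor <;> intro h <;> linarith
  · change t < _ + treeE v (subtree j ω) ↔ _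
    constructor <;> intro h <;> linarith

theorem indicator_alive (t : ℝ) (u : List ℕ) (ω : Tree) :
    (alive treeA treeE t ω).indicator (fun v => summand treeA treeX v ω) u =
      aliveWeight t u ω * treeX u ω := by
  classical
  rw [Set.indicator_apply, summand_tree, aliveWeight]
  simp only [alive, Set.mem_ofPred_eq, position_lt_top_iff]
  by_cases h0 : pathWeight u ω = 0
  · simp [h0]
  · simp [h0]

theorem partialSum_tree (t : ℝ) (F : Finset (List ℕ)) (ω : Tree) :
    partialSum treeA treeE treeX t F ω = ∑ u ∈ F, aliveWeight t u ω * treeX u ω :=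
  Finset.sum_congr rfl fun u _ => indicator_alive t u ω

theorem measurable_aliveWeight (u : List ℕ) :
    Measurable fun p : ℝ × Tree => aliveWeight p.1 u p.2 := by
  have hb : Measurable fun p : ℝ × Tree => birthTime treeE u p.2 :=
    (measurable_birthTime u).comp measurable_snd
  have he : Measurable fun p : ℝ × Tree => treeE u p.2 :=
    (measurable_treeE u).comp measurable_snd
  refine Measurable.ite ?_ ?_ measurable_const
  · exact (measurableSet_le hb measurable_fst).inter (measurableSet_lt measurable_fst (hb.add he))
  · exact measurable_coe_nnreal_real.comp ((measurable_pathWeight u).comp measurable_snd)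

theorem measurable_partialSum_uncurry (F : Finset (List ℕ)) :
    Measurable fun p : ℝ × Tree => partialSum treeA treeE treeX p.1 F p.2 := by
  simp_rw [partialSum_tree]
  exact Finset.measurable_fun_sum _ fun u _ =>
    (measurable_aliveWeight u).mul ((measurable_treeX u).comp measurable_snd)

theorem measurable_partialSum (t : ℝ) (F : Finset (List ℕ)) :
    Measurable (partialSum treeA treeE treeX t F) :=
  Measurable.of_uncurry_left (f := fun t ω => partialSum treeA treeE treeX t F ω)
    (measurable_partialSum_uncurry F)

/-- The branching property at the first generation. -/
theorem partialSum_root (t : ℝ) (F : Finset (List ℕ)) (ω : Tree)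
    (hω : ∃ n, ∀ j, n ≤ j → treeA [] ω j = 0) :
    partialSum treeA treeE treeX t F ω =
      (if [] ∈ F ∧ 0 ≤ t ∧ t < treeE [] ω then treeX [] ω else 0) +
        weightedSum (treeA [] ω) fun j =>
          partialSum treeA treeE treeX (t - treeE [] ω) (tailSet F j) (subtree j ω) := by
  have hz : ∀ j, numWeights (treeA [] ω) ≤ j → treeA [] ω j = 0 := Nat.sInf_mem hω
  rw [partialSum_tree, sum_eq_add_sum_tailSet F _ (numWeights (treeA [] ω))]
  · congr 1
    · rw [aliveWeight_nil]
      by_cases h1 : [] ∈ F <;> by_cases h2 : 0 ≤ t ∧ t < treeE [] ω <;> simp [h1, h2]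
    · refine Finset.sum_congr rfl fun j _ => ?_
      simp only [partialSum_tree, Finset.mul_sum]
      refine Finset.sum_congr rfl fun v _ => ?_
      rw [aliveWeight_cons, mul_assoc]
      rfl
  · intro j v hj _
    rw [aliveWeight_cons, hz j hj]
    simp

theorem ae_expMeasure_nonneg : ∀ᵐ e ∂(expMeasure 1), (0 : ℝ) ≤ e := by
  rw [ae_iff]
  have : {e : ℝ | ¬0 ≤ e} = Set.Iio 0 := by ext; simp
  rw [this, expMeasure, gammaMeasure, withDensity_apply _ measurableSet_Iio]
  exact lintegral_gammaPDF_of_nonpos le_rfl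

theorem map_treeE (u : List ℕ) : (treeLaw α μ₀).map (treeE u) = expMeasure 1 := by
  have h := Measure.infinitePi_map_eval (fun _ : List ℕ => driverLaw α μ₀) u
  have : treeE u = (Prod.snd ∘ Prod.fst) ∘ fun ω : Tree => ω u := rfl
  rw [this, ← Measure.map_map (by fun_prop) (by fun_prop), treeLaw, h, driverLaw,
    ← Measure.map_map measurable_snd measurable_fst, Measure.map_fst_prod, measure_univ, one_smul,
    Measure.map_snd_prod, measure_univ, one_smul]

theorem map_treeA (u : List ℕ) : (treeLaw α μ₀).map (treeA u) = α := by
  have h := Measure.infinitePi_map_eval (fun _ : List ℕ => driverLaw α μ₀) u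
  have : treeA u = (Prod.fst ∘ Prod.fst) ∘ fun ω : Tree => ω u := rfl
  rw [this, ← Measure.map_map (by fun_prop) (by fun_prop), treeLaw, h, driverLaw,
    ← Measure.map_map measurable_fst measurable_fst, Measure.map_fst_prod, measure_univ, one_smul,
    Measure.map_fst_prod, measure_univ, one_smul]

theorem ae_treeE_nonneg : ∀ᵐ ω ∂(treeLaw α μ₀), ∀ u, 0 ≤ treeE u ω := by
  refine ae_all_iff.2 fun u => ?_
  have h := ae_expMeasure_nonneg
  rw [← map_treeE α μ₀ u] at h
  exact ae_of_ae_map (measurable_treeE u).aemeasurable h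

theorem birthTime_nonneg {ω : Tree} (h : ∀ u, 0 ≤ treeE u ω) (u : List ℕ) :
    0 ≤ birthTime treeE u ω :=
  Finset.sum_nonneg fun _ _ => h _

theorem partialSum_of_neg {t : ℝ} (ht : t < 0) (F : Finset (List ℕ)) {ω : Tree}
    (h : ∀ u, 0 ≤ treeE u ω) : partialSum treeA treeE treeX t F ω = 0 := by
  rw [partialSum_tree]
  refine Finset.sum_eq_zero fun u _ => ?_
  have := birthTime_nonneg h u
  rw [aliveWeight, if_neg (by rintro ⟨h1, -⟩; linarith), zero_mul]

/-! ### The recursion for the laws of the partial sums -/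

section Recursion

variable (α : Measure (ℕ → ℝ≥0)) (μ₀ : ProbabilityMeasure ℝ) [IsProbabilityMeasure α]

/-- The law of the partial sum over `F`. -/
def partialLaw (F : Finset (List ℕ)) (t : ℝ) : ProbabilityMeasure ℝ :=
  ⟨(treeLaw α μ₀).map (partialSum treeA treeE treeX t F),
    Measure.isProbabilityMeasure_map (measurable_partialSum t F).aemeasurable⟩

theorem measurable_weightedSum_partialSum (F : ℕ → Finset (List ℕ)) :
    Measurable fun p : ℝ × (ℕ → ℝ≥0) × (ℕ → Tree) =>
      weightedSum p.2.1 fun j => partialSum treeA treeE treeX p.1 (F j) (p.2.2 j) := by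
  have h := fun j => measurable_partialSum_uncurry (F j)
  generalize partialSum treeA treeE treeX = G at *
  have h1 : Measurable fun p : ℝ × (ℕ → ℝ≥0) × (ℕ → Tree) =>
      (p.2.1, fun j : ℕ => G p.1 (F j) (p.2.2 j)) := by
    refine (measurable_fst.comp measurable_snd).prodMk (measurable_pi_lambda _ fun j => ?_)
    have h2 : Measurable fun p : ℝ × (ℕ → ℝ≥0) × (ℕ → Tree) => (p.1, p.2.2 j) := by fun_prop
    exact (h j).comp h2
  exact measurable_weightedSum.comp h1

theorem mixedSmoothing_partialLaw (F : ℕ → Finset (List ℕ)) (s : ℝ) :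
    mixedSmoothing α id (fun j => partialLaw α μ₀ (F j) s) =
      (α.prod (Measure.infinitePi fun _ : ℕ => treeLaw α μ₀)).map fun p =>
        weightedSum p.1 fun j => partialSum treeA treeE treeX s (F j) (p.2 j) := by
  have h1 := Measure.infinitePi_map_pi (fun _ : ℕ => treeLaw α μ₀)
    (f := fun j => partialSum treeA treeE treeX s (F j)) fun j => measurable_partialSum s (F j)
  have hg : Measurable fun (y : ℕ → Tree) (j : ℕ) => partialSum treeA treeE treeX s (F j) (y j) :=
    measurable_pi_lambda _ fun j => (measurable_partialSum s (F j)).comp (measurable_pi_apply j)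
  have h2 : α.prod (Measure.infinitePi fun j => (treeLaw α μ₀).map
      (partialSum treeA treeE treeX s (F j))) =
      (α.prod (Measure.infinitePi fun _ : ℕ => treeLaw α μ₀)).map
        (Prod.map id fun y j => partialSum treeA treeE treeX s (F j) (y j)) := by
    rw [← Measure.map_prod_map _ _ measurable_id hg, Measure.map_id, h1]
  refine (congrArg (Measure.map fun p => weightedSum p.1 p.2) h2).trans ?_
  rw [Measure.map_map measurable_weightedSum (measurable_id.prodMap hg)]
  rfl

theorem measurable_weightedSum_partialSum_const (F : ℕ → Finset (List ℕ)) (s : ℝ) :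
    Measurable fun p : (ℕ → ℝ≥0) × (ℕ → Tree) =>
      weightedSum p.1 fun j => partialSum treeA treeE treeX s (F j) (p.2 j) :=
  Measurable.of_uncurry_left (f := fun (s : ℝ) (p : (ℕ → ℝ≥0) × (ℕ → Tree)) =>
    weightedSum p.1 fun j => partialSum treeA treeE treeX s (F j) (p.2 j))
    (measurable_weightedSum_partialSum F)

theorem integral_mixedSmoothing_partialLaw (F : ℕ → Finset (List ℕ)) (s : ℝ) (f : ℝ →ᵇ ℝ) :
    ∫ x, f x ∂(mixedSmoothing α id fun j => partialLaw α μ₀ (F j) s) =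
      ∫ p, f (weightedSum p.1 fun j => partialSum treeA treeE treeX s (F j) (p.2 j))
        ∂(α.prod (Measure.infinitePi fun _ : ℕ => treeLaw α μ₀)) := by
  rw [mixedSmoothing_partialLaw, integral_map
    (measurable_weightedSum_partialSum_const F s).aemeasurable
    f.continuous.aestronglyMeasurable]

theorem measurable_integral_mixedSmoothing (F : ℕ → Finset (List ℕ)) (f : ℝ →ᵇ ℝ) :
    Measurable fun s : ℝ =>
      ∫ x, f x ∂(mixedSmoothing α id fun j => partialLaw α μ₀ (F j) s) := by
  simp_rw [integral_mixedSmoothing_partialLaw]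
  exact (StronglyMeasurable.integral_prod_right
    (f := fun (s : ℝ) (p : (ℕ → ℝ≥0) × (ℕ → Tree)) =>
      f (weightedSum p.1 fun j => partialSum treeA treeE treeX s (F j) (p.2 j)))
    (f.continuous.measurable.comp
      (measurable_weightedSum_partialSum F)).stronglyMeasurable).measurable

/-- The partial sum, decomposed at the death of the ancestor. -/
def rootStep (F : Finset (List ℕ)) (t : ℝ) (p : Driver × (ℕ → Tree)) : ℝ :=
  if t < p.1.1.2 then (if [] ∈ F then p.1.2 else 0) else
    weightedSum p.1.1.1 fun j =>
      partialSum treeA treeE treeX (t - p.1.1.2) (tailSet F j) (p.2 j)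

theorem measurable_rootStep (F : Finset (List ℕ)) (t : ℝ) : Measurable (rootStep F t) := by
  refine Measurable.ite (measurableSet_lt measurable_const (by fun_prop)) ?_ ?_
  · split_ifs
    · fun_prop
    · fun_prop
  · have h : Measurable fun p : Driver × (ℕ → Tree) => (t - p.1.1.2, p.1.1.1, p.2) := by fun_prop
    exact Measurable.comp (g := fun p : ℝ × (ℕ → ℝ≥0) × (ℕ → Tree) =>
      weightedSum p.2.1 fun j => partialSum treeA treeE treeX p.1 (tailSet F j) (p.2.2 j))
      (measurable_weightedSum_partialSum (tailSet F)) h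

variable (hα : ∀ᵐ a ∂α, ∃ n, ∀ j, n ≤ j → a j = 0)

include hα

theorem ae_finite_weights : ∀ᵐ ω ∂(treeLaw α μ₀), ∀ u, ∃ n, ∀ j, n ≤ j → treeA u ω j = 0 := by
  refine ae_all_iff.2 fun u => ?_
  rw [← map_treeA α μ₀ u] at hα
  exact ae_of_ae_map (measurable_treeA u).aemeasurable hα

theorem partialSum_ae_eq (F : Finset (List ℕ)) {t : ℝ} (ht : 0 ≤ t) :
    ∀ᵐ ω ∂(treeLaw α μ₀), partialSum treeA treeE treeX t F ω =
      rootStep F t (ω [], fun j => subtree j ω) := by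
  filter_upwards [ae_finite_weights α μ₀ hα, ae_treeE_nonneg α μ₀] with ω h1 h2
  rw [partialSum_root t F ω (h1 [])]
  by_cases h : t < treeE [] ω
  · have h3 : rootStep F t (ω [], fun j => subtree j ω) = if [] ∈ F then treeX [] ω else 0 :=
      if_pos h
    rw [h3]
    simp only [ht, h, and_true]
    rw [add_eq_left]
    refine Finset.sum_eq_zero fun j _ => ?_
    simp only
    rw [partialSum_of_neg (t := t - treeE [] ω) (by linarith) (tailSet F j) (ω := subtree j ω)
      fun u => h2 (j :: u), mul_zero]
  · have h3 : rootStep F t (ω [], fun j => subtree j ω) = weightedSum (treeA [] ω) fun j =>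
        partialSum treeA treeE treeX (t - treeE [] ω) (tailSet F j) (subtree j ω) := if_neg h
    rw [h3, if_neg (by tauto), zero_add]

theorem integral_partialLaw (F : Finset (List ℕ)) {t : ℝ} (ht : 0 ≤ t) (f : ℝ →ᵇ ℝ) :
    ∫ x, f x ∂(partialLaw α μ₀ F t : Measure ℝ) =
      ∫ e, (if t < e then ∫ x, f (if [] ∈ F then x else 0) ∂(μ₀ : Measure ℝ) else
        ∫ x, f x ∂(mixedSmoothing α id fun j => partialLaw α μ₀ (tailSet F j) (t - e)))
          ∂(expMeasure 1) := by
  have hm := f.continuous.measurable.comp (measurable_rootStep F t)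
  have hI : Integrable (fun p => f (rootStep F t p))
      ((driverLaw α μ₀).prod (Measure.infinitePi fun _ : ℕ => treeLaw α μ₀)) :=
    Integrable.of_bound (C := ‖f‖) hm.aestronglyMeasurable (ae_of_all _ fun p => f.norm_coe_le_norm _)
  have hroot : Measurable fun ω : Tree => (ω [], fun j => subtree j ω) :=
    (measurable_pi_apply _).prodMk (measurable_pi_lambda _ measurable_subtree)
  have h1 : ∫ x, f x ∂(partialLaw α μ₀ F t : Measure ℝ) =
      ∫ p, f (rootStep F t p)
        ∂((driverLaw α μ₀).prod (Measure.infinitePi fun _ : ℕ => treeLaw α μ₀)) := by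
    rw [partialLaw, ProbabilityMeasure.coe_mk, integral_map
      (measurable_partialSum t F).aemeasurable f.continuous.aestronglyMeasurable]
    rw [integral_congr_ae (g := fun ω => f (rootStep F t (ω [], fun j => subtree j ω)))
      ((partialSum_ae_eq α μ₀ hα F ht).mono fun ω h => congrArg f h)]
    conv_lhs => rw [← map_graft α μ₀]
    exact integral_map measurable_graft.aemeasurable (hm.comp hroot).aestronglyMeasurable
  have hI1 := hI.integral_prod_left
  have hI2 := Integrable.integral_prod_left (μ := α.prod (expMeasure 1)) (ν := (μ₀ : Measure ℝ)) hI1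
  rw [h1, integral_prod _ hI, driverLaw, integral_prod _ hI1, integral_prod_symm _ hI2]
  refine integral_congr_ae (ae_of_all _ fun e => ?_)
  simp only
  by_cases h : t < e
  · rw [if_pos h]
    simp [rootStep, h]
  · rw [if_neg h, integral_mixedSmoothing_partialLaw, integral_prod]
    · simp [rootStep, h]
    · refine Integrable.of_bound (C := ‖f‖) ?_ (ae_of_all _ fun p => f.norm_coe_le_norm _)
      exact (f.continuous.measurable.comp (measurable_weightedSum_partialSum_const
        (tailSet F) (t - e))).aestronglyMeasurable

omit hα [IsProbabilityMeasure α] in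
/-- Integration against the unit exponential law of a function that is constant after time `t`. -/
theorem integral_expMeasure_ite {q : ℝ → ℝ} {C : ℝ} (hq : Measurable q) (hC : ∀ s, |q s| ≤ C)
    (c : ℝ) {t : ℝ} (ht : 0 ≤ t) :
    ∫ e, (if t < e then c else q (t - e)) ∂(expMeasure 1) =
      Real.exp (-t) * (c + ∫ s in (0 : ℝ)..t, Real.exp s * q s) := by
  set g : ℝ → ℝ := fun e => if t < e then c else q (t - e) with hg
  have hmp : Measurable (gammaPDF 1 1) := (measurable_gammaPDFReal 1 1).ennreal_ofReal
  have h1 : ∫ e, g e ∂(expMeasure 1) = ∫ e in Set.Ioi 0, Real.exp (-e) * g e := by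
    rw [expMeasure, gammaMeasure, integral_withDensity_eq_integral_toReal_smul hmp
      (ae_of_all _ fun e => ENNReal.ofReal_lt_top), ← integral_Ici_eq_integral_Ioi,
      ← integral_indicator measurableSet_Ici]
    refine integral_congr_ae (ae_of_all _ fun e => ?_)
    simp only
    by_cases he : 0 ≤ e
    · have := exponentialPDF_of_nonneg (r := 1) he
      rw [exponentialPDF] at this
      rw [Set.indicator_of_mem (Set.mem_Ici.2 he), show gammaPDF 1 1 e = _ from this,
        ENNReal.toReal_ofReal (by positivity)]
      simp
    · rw [Set.indicator_of_notMem (by simpa using he), gammaPDF_of_neg (not_le.1 he)]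
      simp
  have hgm : Measurable g := Measurable.ite (measurableSet_lt measurable_const measurable_id)
    measurable_const (hq.comp (measurable_const.sub measurable_id))
  have hgb : ∀ e, ‖g e‖ ≤ max |c| C := by
    intro e
    simp only [hg]
    split_ifs
    · exact le_max_left _ _
    · exact (hC _).trans (le_max_right _ _)
  have hgi : IntegrableOn (fun e => Real.exp (-e) * g e) (Set.Ioi 0) := by
    refine ((integrableOn_exp_neg_Ioi 0).mul_const (max |c| C)).mono'
      ((Real.measurable_exp.comp measurable_neg).mul hgm).aestronglyMeasurable
      (ae_of_all _ fun e => ?_)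
    rw [norm_mul, Real.norm_of_nonneg (Real.exp_pos _).le]
    exact mul_le_mul_of_nonneg_left (hgb e) (Real.exp_pos _).le
  have h2 : ∫ e in Set.Ioi t, Real.exp (-e) * g e = Real.exp (-t) * c := by
    rw [← integral_exp_neg_Ioi, ← integral_mul_const]
    refine setIntegral_congr_fun measurableSet_Ioi fun e he => ?_
    simp only [hg]
    rw [if_pos (Set.mem_Ioi.1 he)]
  have h3 : ∫ e in Set.Ioc 0 t, Real.exp (-e) * g e =
      ∫ e in (0 : ℝ)..t, Real.exp (-(t - (t - e))) * q (t - e) := by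
    rw [intervalIntegral.integral_of_le ht]
    refine setIntegral_congr_fun measurableSet_Ioc fun e he => ?_
    simp only [hg]
    rw [if_neg (not_lt.2 he.2), sub_sub_cancel]
  rw [h1, ← Set.Ioc_union_Ioi_eq_Ioi ht, setIntegral_union
    (Set.Ioc_disjoint_Ioi_same) measurableSet_Ioi
    (hgi.mono_set Set.Ioc_subset_Ioi_self) (hgi.mono_set (Set.Ioi_subset_Ioi ht)), h2, h3,
    intervalIntegral.integral_comp_sub_left (fun s => Real.exp (-(t - s)) * q s), sub_self,
    sub_zero, mul_add, add_comm, ← intervalIntegral.integral_const_mul]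
  congr 1
  refine intervalIntegral.integral_congr fun s _ => ?_
  rw [← mul_assoc, ← Real.exp_add, neg_sub, neg_add_eq_sub]

/-- If the laws of the partial sums converge, then the limits solve the equation. -/
theorem isSolution_of_tendsto_partialLaw {μ : ℝ≥0 → ProbabilityMeasure ℝ}
    (h : ∀ t : ℝ≥0, Tendsto (fun F => partialLaw α μ₀ F t) atTop (𝓝 (μ t))) :
    IsSolution α id μ₀ μ := by
  have hp := isProbabilityMeasure_smoothing α id measurable_id
  have hcg : (atTop : Filter (Finset (List ℕ))).IsCountablyGenerated := inferInstance
  have hlim : ∀ (f : ℝ →ᵇ ℝ) (s : ℝ), 0 ≤ s → Tendsto (fun F => ∫ x, f x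
      ∂(mixedSmoothing α id fun j => partialLaw α μ₀ (tailSet F j) s)) atTop
      (𝓝 (∫ x, f x ∂(smoothing α id (μ s.toNNReal)))) := by
    intro f s hs
    refine tendsto_mixedSmoothing measurable_id (fun j => ?_) f
    have := (h s.toNNReal).comp (tendsto_tailSet j)
    rwa [Real.coe_toNNReal s hs] at this
  have hmeas : ∀ f : ℝ →ᵇ ℝ,
      Measurable fun s : ℝ => ∫ x, f x ∂(smoothing α id (μ s.toNNReal)) := by
    intro f
    refine measurable_of_tendsto_metrizable' (f := fun F s => ∫ x, f x
      ∂(mixedSmoothing α id fun j => partialLaw α μ₀ (tailSet F j) (max s 0))) atTop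
      (fun F => (measurable_integral_mixedSmoothing α μ₀ (tailSet F) f).comp
        (measurable_id.max measurable_const)) (tendsto_pi_nhds.2 fun s => ?_)
    have h1 := hlim f (max s 0) (le_max_right _ _)
    rwa [show (max s 0).toNNReal = s.toNNReal by simp [Real.toNNReal]] at h1
  refine isSolution_of_mild measurable_id (fun f => (hmeas f).aestronglyMeasurable)
    fun f t ht => ?_
  have hb : ∀ s : ℝ, |∫ x, f x ∂(smoothing α id (μ s.toNNReal))| ≤ ‖f‖ := fun s => by
    have := hp (μ s.toNNReal)
    exact f.norm_integral_le_norm _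
  rw [← integral_expMeasure_ite (hmeas f) hb _ ht]
  have h1 : Tendsto (fun F => ∫ x, f x ∂(partialLaw α μ₀ F t : Measure ℝ)) atTop
      (𝓝 (∫ x, f x ∂(μ t.toNNReal : Measure ℝ))) := by
    have := ProbabilityMeasure.tendsto_iff_forall_integral_tendsto.1 (h t.toNNReal) f
    rwa [Real.coe_toNNReal t ht] at this
  refine tendsto_nhds_unique h1 ?_
  simp_rw [integral_partialLaw α μ₀ hα _ ht]
  refine tendsto_integral_filter_of_dominated_convergence (fun _ => ‖f‖)
    (.of_forall fun F => ?_) (.of_forall fun F => ae_of_all _ fun e => ?_)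
    (integrable_const _) (ae_expMeasure_nonneg.mono fun e he => ?_)
  · refine (Measurable.ite (measurableSet_lt measurable_const measurable_id) measurable_const
      ?_).aestronglyMeasurable
    exact (measurable_integral_mixedSmoothing α μ₀ (tailSet F) f).comp
      (measurable_const.sub measurable_id)
  · by_cases hte : t < e
    · rw [if_pos hte]
      refine (norm_integral_le_of_norm_le_const (C := ‖f‖) (μ := (μ₀ : Measure ℝ))
        (ae_of_all _ fun x => f.norm_coe_le_norm _)).trans_eq ?_
      simp
    · rw [if_neg hte]
      have := isProbabilityMeasure_mixedSmoothing (P₀ := α) (A := id) measurable_id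
        fun j => partialLaw α μ₀ (tailSet F j) (t - e)
      exact f.norm_integral_le_norm _
  · by_cases hte : t < e
    · simp only [if_pos hte]
      refine tendsto_const_nhds.congr' ?_
      filter_upwards [eventually_ge_atTop {[]}] with F hF
      simp [Finset.singleton_subset_iff.1 hF]
    · simp only [if_neg hte]
      exact hlim f (t - e) (by linarith)

end Recursion

/-! ### Finiteness of the set of particles born up to a given time -/

section NonExplosive

/-- The event that a particle of the `n`-th generation is born before or at time `t`. -/
def bornEvent (n : ℕ) (t : ℝ) : Set Tree :=
  {ω | ∃ u : List ℕ, u.length = n ∧ pathWeight u ω ≠ 0 ∧ birthTime treeE u ω ≤ t}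

theorem measurableSet_bornEvent_uncurry (n : ℕ) :
    MeasurableSet {p : ℝ × Tree | p.2 ∈ bornEvent n p.1} := by
  have : {p : ℝ × Tree | p.2 ∈ bornEvent n p.1} = ⋃ u : List ℕ, ⋃ _ : u.length = n,
      {p : ℝ × Tree | pathWeight u p.2 ≠ 0} ∩ {p | birthTime treeE u p.2 ≤ p.1} := by
    ext p
    simp only [bornEvent, Set.mem_ofPred_eq, Set.mem_iUnion, Set.mem_inter_iff, exists_prop]
  rw [this]
  refine MeasurableSet.iUnion fun u => MeasurableSet.iUnion fun _ => MeasurableSet.inter ?_ ?_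
  · exact ((measurable_pathWeight u).comp measurable_snd) (measurableSet_singleton 0).compl
  · exact measurableSet_le ((measurable_birthTime u).comp measurable_snd) measurable_fst

theorem measurableSet_bornEvent (n : ℕ) (t : ℝ) : MeasurableSet (bornEvent n t) :=
  measurable_prodMk_left (x := t) (measurableSet_bornEvent_uncurry n)

theorem mem_bornEvent_succ {n : ℕ} {t : ℝ} {ω : Tree} (h : ω ∈ bornEvent (n + 1) t) :
    ∃ j, treeA [] ω j ≠ 0 ∧ subtree j ω ∈ bornEvent n (t - treeE [] ω) := by
  obtain ⟨u, hu, h1, h2⟩ := h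
  match u, hu with
  | j :: v, hu =>
    rw [birthTime_cons] at h2
    rw [pathWeight, mul_ne_zero_iff] at h1
    exact ⟨j, h1.1, v, by simpa using hu, h1.2, by linarith⟩

/-- If no particle of the `n`-th generation is born up to time `t`, then only finitely many
particles are born up to time `t`. -/
theorem finite_born {n : ℕ} {t : ℝ} {ω : Tree} (hE : ∀ u, 0 ≤ treeE u ω)
    (hA : ∀ u, ∃ n, ∀ j, n ≤ j → treeA u ω j = 0) (h : ω ∉ bornEvent n t) :
    {u | pathWeight u ω ≠ 0 ∧ birthTime treeE u ω ≤ t}.Finite := by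
  induction n generalizing ω t with
  | zero =>
    have ht : t < 0 := by
      by_contra h0
      exact h ⟨[], rfl, by simp [pathWeight], by simpa using h0⟩
    convert Set.finite_empty
    ext u
    have := birthTime_nonneg hE u
    simp only [Set.mem_ofPred_eq, Set.mem_empty_iff_false, iff_false, not_and]
    intro _
    linarith
  | succ n ih =>
    obtain ⟨m, hm⟩ := hA []
    have hsub : {u | pathWeight u ω ≠ 0 ∧ birthTime treeE u ω ≤ t} ⊆ {[]} ∪
        ⋃ j ∈ Finset.range m, ⋃ _ : treeA [] ω j ≠ 0, List.cons j ''
          {v | pathWeight v (subtree j ω) ≠ 0 ∧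
            birthTime treeE v (subtree j ω) ≤ t - treeE [] ω} := by
      rintro u ⟨h1, h2⟩
      match u with
      | [] => exact Or.inl rfl
      | j :: v =>
        right
        rw [birthTime_cons] at h2
        rw [pathWeight, mul_ne_zero_iff] at h1
        simp only [Set.mem_iUnion]
        refine ⟨j, ?_, h1.1, v, ⟨h1.2, by linarith⟩, rfl⟩
        rw [Finset.mem_range]
        by_contra hj
        exact h1.1 (hm j (not_lt.1 hj))
    refine Set.Finite.subset ((Set.finite_singleton _).union ?_) hsub
    refine (Finset.finite_toSet _).biUnion fun j _ => Set.finite_iUnion fun hj => ?_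
    refine Set.Finite.image _ (ih (fun u => hE (j :: u)) (fun u => hA (j :: u)) fun hmem => h ?_)
    obtain ⟨v, hv, h1, h2⟩ := hmem
    refine ⟨j :: v, by simp [hv], ?_, ?_⟩
    · rw [pathWeight]
      exact mul_ne_zero hj h1
    · rw [birthTime_cons]
      linarith

theorem expMeasure_le : expMeasure 1 ≤ volume.restrict (Set.Ioi 0) := by
  rw [Measure.restrict_congr_set Ioi_ae_eq_Ici, expMeasure, gammaMeasure,
    ← withDensity_indicator_one measurableSet_Ici]
  refine withDensity_mono (ae_of_all _ fun e => ?_)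
  by_cases he : 0 ≤ e
  · have := exponentialPDF_of_nonneg (r := 1) he
    rw [exponentialPDF] at this
    rw [Set.indicator_of_mem (Set.mem_Ici.2 he), show gammaPDF 1 1 e = _ from this]
    simpa using he
  · rw [gammaPDF_of_neg (not_le.1 he)]
    exact zero_le

variable (α : Measure (ℕ → ℝ≥0)) (μ₀ : ProbabilityMeasure ℝ) [IsProbabilityMeasure α]

theorem treeLaw_bornEvent_of_neg (n : ℕ) {t : ℝ} (ht : t < 0) :
    treeLaw α μ₀ (bornEvent n t) = 0 := by
  refine measure_mono_null ?_ (ae_iff.1 (ae_treeE_nonneg α μ₀))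
  rintro ω ⟨u, -, -, hu⟩ hE
  have := birthTime_nonneg hE u
  linarith

variable (hα : ∀ᵐ a ∂α, ∃ n, ∀ j, n ≤ j → a j = 0)

theorem measure_prod_subtree_bornEvent_le {n : ℕ} {a : ℕ → ℝ≥0} (ha : ∃ n, ∀ j, n ≤ j → a j = 0)
    {b s : ℝ} (hb : 0 ≤ b) (h : treeLaw α μ₀ (bornEvent n s) ≤ ENNReal.ofReal b) :
    (Measure.infinitePi fun _ : ℕ => treeLaw α μ₀) {y | ∃ j, a j ≠ 0 ∧ y j ∈ bornEvent n s} ≤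
      ENNReal.ofReal (min 1 ((numWeights a + 1) * max b 0)) := by
  have hz : ∀ j, numWeights a ≤ j → a j = 0 := Nat.sInf_mem ha
  rw [ENNReal.ofReal_min, ENNReal.ofReal_one, max_eq_left hb]
  refine le_min prob_le_one ?_
  have hsub : {y : ℕ → Tree | ∃ j, a j ≠ 0 ∧ y j ∈ bornEvent n s} ⊆
      ⋃ j ∈ Finset.range (numWeights a), {y | y j ∈ bornEvent n s} := by
    rintro y ⟨j, hj, hy⟩
    simp only [Set.mem_iUnion]
    refine ⟨j, ?_, hy⟩
    rw [Finset.mem_range]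
    by_contra hlt
    exact hj (hz j (not_lt.1 hlt))
  refine (measure_mono hsub).trans ((measure_biUnion_finset_le _ _).trans ?_)
  have hj : ∀ j ∈ Finset.range (numWeights a), (Measure.infinitePi fun _ : ℕ => treeLaw α μ₀)
      {y | y j ∈ bornEvent n s} ≤ ENNReal.ofReal b := by
    intro j _
    have := (measurePreserving_eval_infinitePi (fun _ : ℕ => treeLaw α μ₀) j).measure_preimage
      (measurableSet_bornEvent n s).nullMeasurableSet
    exact this.le.trans h
  refine (Finset.sum_le_card_nsmul _ _ _ hj).trans ?_
  rw [Finset.card_range, nsmul_eq_mul, ← ENNReal.ofReal_natCast, ← ENNReal.ofReal_mul (by positivity)]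
  refine ENNReal.ofReal_le_ofReal ?_
  nlinarith

include hα

theorem treeLaw_bornEvent_succ_le {n : ℕ} {b : ℝ → ℝ} (hb0 : ∀ s, 0 ≤ s → 0 ≤ b s)
    (hbm : Continuous b)
    (hb : ∀ s, 0 ≤ s → treeLaw α μ₀ (bornEvent n s) ≤ ENNReal.ofReal (b s)) {t : ℝ} (ht : 0 ≤ t) :
    treeLaw α μ₀ (bornEvent (n + 1) t) ≤
      ENNReal.ofReal (∫ s in (0 : ℝ)..t, modulus α numWeights (b s)) := by
  have hw := continuous_modulus (P₀ := α) measurable_numWeights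
  set Y := Measure.infinitePi fun _ : ℕ => treeLaw α μ₀ with hY
  set φ : (ℕ → ℝ≥0) × ℝ → ℝ≥0∞ := fun p => if p.2 ≤ t then
    ENNReal.ofReal (min 1 ((numWeights p.1 + 1) * max (b (t - p.2)) 0)) else 0 with hφ
  have hφm : Measurable φ := by
    refine Measurable.ite (measurableSet_le measurable_snd measurable_const) ?_ measurable_const
    refine (measurable_const.min ?_).ennreal_ofReal
    refine Measurable.mul ?_ ?_
    · exact ((measurable_from_nat (f := fun n : ℕ => (n : ℝ))).comp
        (measurable_numWeights.comp measurable_fst)).add_const 1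
    · exact (hbm.measurable.comp (measurable_const.sub measurable_snd)).max measurable_const
  have hpre := measurable_graft (measurableSet_bornEvent (n + 1) t)
  have hsec : ∀ᵐ d ∂(driverLaw α μ₀), Y (Prod.mk d ⁻¹' (graft ⁻¹' bornEvent (n + 1) t)) ≤
      φ d.1 := by
    have hα' : ∀ᵐ d ∂(driverLaw α μ₀), ∃ n, ∀ j, n ≤ j → d.1.1 j = 0 := by
      have h1 : Tendsto (fun d : Driver => d.1.1) (ae (driverLaw α μ₀)) (ae α) :=
        Measure.quasiMeasurePreserving_fst.tendsto_ae.comp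
          Measure.quasiMeasurePreserving_fst.tendsto_ae
      exact h1.eventually hα
    filter_upwards [hα'] with d hd
    have hsub : Prod.mk d ⁻¹' (graft ⁻¹' bornEvent (n + 1) t) ⊆
        {y | ∃ j, d.1.1 j ≠ 0 ∧ y j ∈ bornEvent n (t - d.1.2)} :=
      fun y hy => mem_bornEvent_succ hy
    refine (measure_mono hsub).trans ?_
    by_cases hd2 : d.1.2 ≤ t
    · simp only [hφ, if_pos hd2]
      exact measure_prod_subtree_bornEvent_le α μ₀ hd (hb0 _ (by linarith)) (hb _ (by linarith))
    · have := measure_prod_subtree_bornEvent_le α μ₀ (n := n) (s := t - d.1.2) hd le_rfl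
        (by rw [treeLaw_bornEvent_of_neg α μ₀ n (by linarith)]; exact zero_le)
      refine this.trans ?_
      simp
  calc treeLaw α μ₀ (bornEvent (n + 1) t)
      = ((driverLaw α μ₀).prod Y) (graft ⁻¹' bornEvent (n + 1) t) := by
        rw [← Measure.map_apply measurable_graft (measurableSet_bornEvent _ _), map_graft]
    _ = ∫⁻ d, Y (Prod.mk d ⁻¹' (graft ⁻¹' bornEvent (n + 1) t)) ∂(driverLaw α μ₀) :=
        Measure.prod_apply hpre
    _ ≤ ∫⁻ d, φ d.1 ∂(driverLaw α μ₀) := lintegral_mono_ae hsec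
    _ = ∫⁻ p, φ p ∂(α.prod (expMeasure 1)) := by
        have h1 : (driverLaw α μ₀).map Prod.fst = α.prod (expMeasure 1) := by
          rw [driverLaw, Measure.map_fst_prod, measure_univ, one_smul]
        rw [← h1, lintegral_map hφm measurable_fst]
    _ = ∫⁻ e, ∫⁻ a, φ (a, e) ∂α ∂(expMeasure 1) := lintegral_prod_symm _ hφm.aemeasurable
    _ ≤ ∫⁻ e in Set.Ioi 0, ∫⁻ a, φ (a, e) ∂α := lintegral_mono' expMeasure_le le_rfl
    _ = ∫⁻ e in Set.Ioi 0, (Set.Iic t).indicator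
          (fun e => ENNReal.ofReal (modulus α numWeights (b (t - e)))) e := by
        refine lintegral_congr fun e => ?_
        by_cases he : e ≤ t
        · rw [Set.indicator_of_mem (Set.mem_Iic.2 he)]
          simp only [hφ, if_pos he]
          rw [modulus, ofReal_integral_eq_lintegral_ofReal
            (integrable_modulus measurable_numWeights _)
            (ae_of_all _ fun ω => (modulus_integrand_mem _ _).1)]
        · rw [Set.indicator_of_notMem (by simpa using he)]
          simp only [hφ, if_neg he]
          simp
    _ = ∫⁻ e in Set.Ioc 0 t, ENNReal.ofReal (modulus α numWeights (b (t - e))) := by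
        rw [lintegral_indicator measurableSet_Iic, Measure.restrict_restrict measurableSet_Iic,
          Set.inter_comm, Set.Ioi_inter_Iic]
    _ = ENNReal.ofReal (∫ s in (0 : ℝ)..t, modulus α numWeights (b s)) := by
        have hc : Continuous fun e => modulus α numWeights (b (t - e)) :=
          hw.comp (hbm.comp (by fun_prop))
        rw [← ofReal_integral_eq_lintegral_ofReal hc.integrableOn_Ioc
          (ae_of_all _ fun e => modulus_nonneg _), ← intervalIntegral.integral_of_le ht,
          intervalIntegral.integral_comp_sub_left (fun s => modulus α numWeights (b s))]
        simp

theorem treeLaw_bornEvent_le_picard (n : ℕ) {t : ℝ} (ht : 0 ≤ t) :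
    treeLaw α μ₀ (bornEvent n t) ≤ ENNReal.ofReal (picard (modulus α numWeights) n t) := by
  induction n generalizing t with
  | zero =>
    refine prob_le_one.trans ?_
    rw [← ENNReal.ofReal_one]
    refine ENNReal.ofReal_le_ofReal ?_
    simp only [picard]
    linarith
  | succ n ih =>
    exact treeLaw_bornEvent_succ_le α μ₀ hα (fun s hs => picard_nonneg modulus_nonneg n hs)
      (continuous_picard (continuous_modulus measurable_numWeights) n) (fun s hs => ih hs) ht

/-- Under the non-explosion assumption, only finitely many particles are alive at time `t`. -/
theorem ae_finite_alive (hne : NonExplosion α id) {t : ℝ} (ht : 0 ≤ t) :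
    ∀ᵐ ω ∂(treeLaw α μ₀), (alive treeA treeE t ω).Finite := by
  have h0 : treeLaw α μ₀ (⋂ n, bornEvent n t) = 0 := by
    have h1 : Tendsto (fun n => ENNReal.ofReal (picard (modulus α numWeights) n t)) atTop
        (𝓝 0) := by
      have := ENNReal.tendsto_ofReal (tendsto_picard_modulus measurable_id hne ht)
      rwa [ENNReal.ofReal_zero] at this
    refine le_antisymm (ge_of_tendsto h1 (.of_forall fun n => ?_)) zero_le
    exact (measure_mono (Set.iInter_subset _ n)).trans (treeLaw_bornEvent_le_picard α μ₀ hα n ht)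
  filter_upwards [measure_eq_zero_iff_ae_notMem.1 h0, ae_finite_weights α μ₀ hα,
    ae_treeE_nonneg α μ₀] with ω h1 h2 h3
  obtain ⟨n, hn⟩ := not_forall.1 (fun h => h1 (Set.mem_iInter.2 h))
  refine (finite_born h3 h2 hn).subset fun u hu => ?_
  exact ⟨(position_lt_top_iff u ω).1 hu.1, hu.2.1⟩

omit hα in
theorem eventually_partialSum_eq {t : ℝ} {ω : Tree} (h : (alive treeA treeE t ω).Finite) :
    ∀ᶠ F in atTop, partialSum treeA treeE treeX t F ω = finiteSum treeA treeE treeX t ω := by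
  filter_upwards [eventually_ge_atTop h.toFinset] with F hF
  rw [finiteSum, finsum_mem_def, finsum_eq_sum_of_support_subset (s := F)]
  · rfl
  · intro u hu
    have : u ∈ alive treeA treeE t ω := by
      by_contra hnot
      exact hu (Set.indicator_of_notMem hnot _)
    exact hF (h.mem_toFinset.2 this)

/-- The solution given by the branching random walk in the non-explosive case. -/
theorem exists_solution_of_nonExplosion (hne : NonExplosion α id) :
    ∃ μ : ℝ≥0 → ProbabilityMeasure ℝ, IsSolution α id μ₀ μ ∧
      ∀ t : ℝ≥0, HasLaw (finiteSum treeA treeE treeX t) (μ t : Measure ℝ) (treeLaw α μ₀) := by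
  have hlim : ∀ t : ℝ≥0, ∀ᵐ ω ∂(treeLaw α μ₀), Tendsto
      (fun F => partialSum treeA treeE treeX t F ω) atTop
      (𝓝 (finiteSum treeA treeE treeX t ω)) := fun t => by
    filter_upwards [ae_finite_alive α μ₀ hα hne t.2] with ω hω
    exact tendsto_const_nhds.congr' ((eventually_partialSum_eq hω).mono fun F hF => hF.symm)
  have hm : ∀ t : ℝ≥0, AEMeasurable (finiteSum treeA treeE treeX t) (treeLaw α μ₀) := fun t =>
    aemeasurable_of_tendsto_metrizable_ae atTop
      (fun F => (measurable_partialSum t F).aemeasurable) (hlim t)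
  refine ⟨fun t => ⟨(treeLaw α μ₀).map (finiteSum treeA treeE treeX t),
    Measure.isProbabilityMeasure_map (hm t)⟩, ?_, fun t => ⟨hm t, rfl⟩⟩
  refine isSolution_of_tendsto_partialLaw α μ₀ hα fun t => ?_
  exact (tendstoInDistribution_of_ae_tendsto
    (fun F => (measurable_partialSum t F).aemeasurable) (hm t) (hlim t)).tendsto

end NonExplosive

/-! ### Moments of weighted sums of centered random variables -/

theorem abs_one_add_rpow_le {γ : ℝ} (h1 : 1 ≤ γ) (h2 : γ ≤ 2) (z : ℝ) :
    |1 + z| ^ γ ≤ 1 + γ * z + 6 * |z| ^ γ := by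
  rcases le_total |z| 1 with hz | hz
  · have h3 : |1 + z| ^ γ = (1 + (2 * z + z ^ 2)) ^ (γ / 2) := by
      rw [show 1 + (2 * z + z ^ 2) = |1 + z| ^ 2 by rw [sq_abs]; ring, ← Real.rpow_natCast,
        ← Real.rpow_mul (abs_nonneg _)]
      congr 1
      push_cast
      ring
    have h4 := rpow_one_add_le_one_add_mul_self (s := 2 * z + z ^ 2) (by nlinarith [sq_nonneg (1 + z)])
      (p := γ / 2) (by linarith) (by linarith)
    have h5 : |z| ^ (2 : ℝ) ≤ |z| ^ γ :=
      Real.rpow_le_rpow_of_exponent_ge_of_imp (abs_nonneg z) hz h2 fun _ h' =>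
        absurd h' (by linarith)
    rw [Real.rpow_two, sq_abs] at h5
    have : γ / 2 * z ^ 2 ≤ z ^ 2 := by nlinarith [sq_nonneg z]
    rw [h3]
    nlinarith [sq_nonneg z]
  · have h3 : |1 + z| ≤ 2 * |z| := by
      have := abs_add_le 1 z
      rw [abs_one] at this
      linarith
    have h4 : |1 + z| ^ γ ≤ 2 ^ γ * |z| ^ γ := by
      rw [← Real.mul_rpow zero_le_two (abs_nonneg z)]
      exact Real.rpow_le_rpow (abs_nonneg _) h3 (by linarith)
    have h5 : (2 : ℝ) ^ γ ≤ 2 ^ (2 : ℝ) := Real.rpow_le_rpow_of_exponent_le one_le_two h2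
    rw [Real.rpow_two] at h5
    have h6 : |z| ^ (1 : ℝ) ≤ |z| ^ γ := Real.rpow_le_rpow_of_exponent_le hz h1
    rw [Real.rpow_one] at h6
    have h7 : -(2 * |z|) ≤ γ * z := by
      have : |γ * z| ≤ 2 * |z| := by
        rw [abs_mul, abs_of_nonneg (by linarith : 0 ≤ γ)]
        gcongr
      exact (abs_le.1 (this.trans le_rfl)).1
    have : 0 ≤ |z| ^ γ := by positivity
    nlinarith

/-- The function `|·|^γ` differs from an affine function by at most a multiple of `|·|^γ`. -/
theorem exists_abs_add_rpow_le {γ : ℝ} (h0 : 0 < γ) (h2 : γ ≤ 2) (s : ℝ) :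
    ∃ k : ℝ, (γ ≤ 1 → k = 0) ∧ ∀ y, |s + y| ^ γ ≤ |s| ^ γ + k * y + 6 * |y| ^ γ := by
  rcases le_or_gt γ 1 with h1 | h1
  · refine ⟨0, fun _ => rfl, fun y => ?_⟩
    have h3 : |s + y| ^ γ ≤ (|s| + |y|) ^ γ :=
      Real.rpow_le_rpow (abs_nonneg _) (abs_add_le _ _) h0.le
    have h4 := Real.rpow_add_le_add_rpow (abs_nonneg s) (abs_nonneg y) h0.le h1
    have : 0 ≤ |y| ^ γ := by positivity
    linarith
  · rcases eq_or_ne s 0 with rfl | hs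
    · refine ⟨0, fun _ => rfl, fun y => ?_⟩
      have : 0 ≤ |y| ^ γ := by positivity
      rw [abs_zero, Real.zero_rpow h0.ne', zero_add]
      linarith
    · refine ⟨|s| ^ γ * γ / s, fun h => absurd h1 (not_lt.2 h), fun y => ?_⟩
      have h3 := abs_one_add_rpow_le h1.le h2 (y / s)
      have h4 : |s + y| ^ γ = |s| ^ γ * |1 + y / s| ^ γ := by
        rw [← Real.mul_rpow (abs_nonneg _) (abs_nonneg _), ← abs_mul]
        congr 2
        field_simp
      have h5 : |y| ^ γ = |s| ^ γ * |y / s| ^ γ := by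
        rw [← Real.mul_rpow (abs_nonneg _) (abs_nonneg _), ← abs_mul]
        congr 2
        field_simp
      rw [h4, h5]
      have h6 : 0 ≤ |s| ^ γ := by positivity
      have := mul_le_mul_of_nonneg_left h3 h6
      refine this.trans (le_of_eq ?_)
      ring

theorem lintegral_abs_add_rpow_le {γ : ℝ} (h0 : 0 < γ) (h2 : γ ≤ 2) {μ : ProbabilityMeasure ℝ}
    (hμ : μ ∈ MomentClass γ) (s c : ℝ) :
    ∫⁻ y, ENNReal.ofReal (|s + c * y| ^ γ) ∂(μ : Measure ℝ) ≤
      ENNReal.ofReal (|s| ^ γ) + 6 * ENNReal.ofReal (|c| ^ γ) * absMoment γ μ := by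
  obtain ⟨k, hk, hle⟩ := exists_abs_add_rpow_le h0 h2 s
  have hm : absMoment γ μ ≠ ⊤ := hμ.1.ne
  have hi := integrable_abs_rpow hm
  have hlin : Integrable (fun y => k * (c * y)) (μ : Measure ℝ) ∧
      ∫ y, k * (c * y) ∂(μ : Measure ℝ) = 0 := by
    rcases le_or_gt γ 1 with h1 | h1
    · simp [hk h1]
    · refine ⟨((integrable_id_of_absMoment h1.le hm).const_mul c).const_mul k, ?_⟩
      rw [integral_const_mul, integral_const_mul, hμ.2 h1, mul_zero, mul_zero]
  have hg : ∀ y, |s + c * y| ^ γ ≤ |s| ^ γ + k * (c * y) + 6 * |c| ^ γ * |y| ^ γ := fun y => by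
    have := hle (c * y)
    rwa [abs_mul c y, Real.mul_rpow (abs_nonneg _) (abs_nonneg _), ← mul_assoc 6] at this
  have hI1 : Integrable (fun y => |s| ^ γ + k * (c * y)) (μ : Measure ℝ) :=
    (integrable_const _).add hlin.1
  have hI2 : Integrable (fun y => 6 * |c| ^ γ * |y| ^ γ) (μ : Measure ℝ) := hi.const_mul _
  calc ∫⁻ y, ENNReal.ofReal (|s + c * y| ^ γ) ∂(μ : Measure ℝ)
      ≤ ∫⁻ y, ENNReal.ofReal (|s| ^ γ + k * (c * y) + 6 * |c| ^ γ * |y| ^ γ) ∂(μ : Measure ℝ) :=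
        lintegral_mono fun y => ENNReal.ofReal_le_ofReal (hg y)
    _ = ENNReal.ofReal (∫ y, (|s| ^ γ + k * (c * y) + 6 * |c| ^ γ * |y| ^ γ) ∂(μ : Measure ℝ)) :=
        (ofReal_integral_eq_lintegral_ofReal (hI1.add hI2) (ae_of_all _ fun y =>
          (by positivity : (0 : ℝ) ≤ |s + c * y| ^ γ).trans (hg y))).symm
    _ = ENNReal.ofReal (|s| ^ γ + 6 * |c| ^ γ * (absMoment γ μ).toReal) := by
        rw [integral_add hI1 hI2, integral_add (integrable_const _) hlin.1, hlin.2,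
          integral_const_mul, integral_abs_rpow]
        simp
    _ = _ := by
        rw [ENNReal.ofReal_add (by positivity) (by positivity), ENNReal.ofReal_mul (by positivity),
          ENNReal.ofReal_mul (by positivity), ENNReal.ofReal_toReal hm]
        simp

/-- A bound of von Bahr-Esseen type. -/
theorem lintegral_abs_sum_rpow_le {ι Ω : Type*} [MeasurableSpace Ω] {P : Measure Ω} {γ : ℝ}
    (h0 : 0 < γ) (h2 : γ ≤ 2) {μ : ProbabilityMeasure ℝ} (hμ : μ ∈ MomentClass γ)
    {X : ι → Ω → ℝ} (hX : ∀ i, Measurable (X i)) (hind : iIndepFun X P)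
    (hlaw : ∀ i, P.map (X i) = μ) (c : ι → ℝ) (F : Finset ι) :
    ∫⁻ ω, ENNReal.ofReal (|∑ i ∈ F, c i * X i ω| ^ γ) ∂P ≤
      6 * absMoment γ μ * ∑ i ∈ F, ENNReal.ofReal (|c i| ^ γ) := by
  classical
  have hP : IsProbabilityMeasure P := hind.isProbabilityMeasure
  induction F using Finset.induction_on with
  | empty => simp [Real.zero_rpow h0.ne']
  | insert i F hi ih =>
    have hi' : IndepFun (fun ω => ∑ j ∈ F, c j * X j ω) (X i) P := by
      have hev : Measurable fun x : ({i} : Finset ι) → ℝ => x ⟨i, by simp⟩ :=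
        measurable_pi_apply _
      have := (hind.indepFun_finset F {i} (by simpa using hi) hX).comp
        (φ := fun x : F → ℝ => ∑ j : F, c j * x j)
        (by fun_prop) hev
      convert this using 1
      · ext ω
        exact (Finset.sum_coe_sort F fun j => c j * X j ω).symm
      · rfl
    have hS : Measurable fun ω => ∑ j ∈ F, c j * X j ω := by fun_prop
    have hmap := (indepFun_iff_map_prod_eq_prod_map_map hS.aemeasurable (hX i).aemeasurable).1 hi'
    rw [hlaw i] at hmap
    have hf : Measurable fun p : ℝ × ℝ => ENNReal.ofReal (|p.1 + c i * p.2| ^ γ) := by fun_prop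
    calc ∫⁻ ω, ENNReal.ofReal (|∑ j ∈ insert i F, c j * X j ω| ^ γ) ∂P
        = ∫⁻ p, ENNReal.ofReal (|p.1 + c i * p.2| ^ γ)
            ∂((P.map fun ω => ∑ j ∈ F, c j * X j ω).prod (μ : Measure ℝ)) := by
          rw [← hmap, lintegral_map hf (hS.prodMk (hX i))]
          simp_rw [Finset.sum_insert hi, add_comm]
      _ ≤ ∫⁻ s, (ENNReal.ofReal (|s| ^ γ) + 6 * ENNReal.ofReal (|c i| ^ γ) * absMoment γ μ)
            ∂(P.map fun ω => ∑ j ∈ F, c j * X j ω) := by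
          rw [lintegral_prod _ hf.aemeasurable]
          exact lintegral_mono fun s => lintegral_abs_add_rpow_le h0 h2 hμ s (c i)
      _ = ∫⁻ ω, ENNReal.ofReal (|∑ j ∈ F, c j * X j ω| ^ γ) ∂P +
            6 * ENNReal.ofReal (|c i| ^ γ) * absMoment γ μ := by
          rw [lintegral_map (by fun_prop) hS, lintegral_add_right _ measurable_const]
          simp
      _ ≤ _ := by
          refine (add_le_add_left ih _).trans (le_of_eq ?_)
          rw [Finset.sum_insert hi]
          ring

/-! ### Convergence of nets of random variables in `L^γ` -/

theorem abs_add_rpow_le_four {γ : ℝ} (h0 : 0 < γ) (h2 : γ ≤ 2) (x y : ℝ) :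
    |x + y| ^ γ ≤ 4 * |x| ^ γ + 4 * |y| ^ γ := by
  have hx : 0 ≤ |x| ^ γ := by positivity
  have hy : 0 ≤ |y| ^ γ := by positivity
  have h5 : (2 : ℝ) ^ γ ≤ 2 ^ (2 : ℝ) := Real.rpow_le_rpow_of_exponent_le one_le_two h2
  rw [Real.rpow_two] at h5
  have key : ∀ m : ℝ, 0 ≤ m → |x| ≤ m → |y| ≤ m → |x + y| ^ γ ≤ 4 * m ^ γ := fun m hm h3 h4 => by
    have : |x + y| ≤ 2 * m := (abs_add_le x y).trans (by linarith)
    refine (Real.rpow_le_rpow (abs_nonneg _) this h0.le).trans ?_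
    rw [Real.mul_rpow zero_le_two hm]
    have : 0 ≤ m ^ γ := by positivity
    nlinarith
  rcases le_total |x| |y| with h | h
  · linarith [key |y| (abs_nonneg _) h le_rfl]
  · linarith [key |x| (abs_nonneg _) le_rfl h]

theorem cauchySeq_of_tsum_rpow_ne_top {γ : ℝ} (h0 : 0 < γ) {x : ℕ → ℝ}
    (h : ∑' n, 2 ^ n * ENNReal.ofReal (|x n - x (n + 1)| ^ γ) ≠ ⊤) : CauchySeq x := by
  set K := (∑' n, 2 ^ n * ENNReal.ofReal (|x n - x (n + 1)| ^ γ)).toReal with hK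
  have hK0 : 0 ≤ K := ENNReal.toReal_nonneg
  have h1 : ∀ n, |x n - x (n + 1)| ^ γ ≤ K * (1 / 2) ^ n := fun n => by
    have h2 := ENNReal.toReal_mono h
      (ENNReal.le_tsum (f := fun n => 2 ^ n * ENNReal.ofReal (|x n - x (n + 1)| ^ γ)) n)
    rw [ENNReal.toReal_mul, ENNReal.toReal_ofReal (by positivity)] at h2
    simp only [ENNReal.toReal_pow, ENNReal.toReal_ofNat] at h2
    rw [one_div, inv_pow, ← div_eq_mul_inv, le_div_iff₀' (by positivity)]
    exact h2
  refine cauchySeq_of_le_geometric ((1 / 2 : ℝ) ^ γ⁻¹) (K ^ γ⁻¹)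
    (Real.rpow_lt_one (by norm_num) (by norm_num) (inv_pos.2 h0)) fun n => ?_
  rw [Real.dist_eq, ← Real.rpow_natCast, ← Real.rpow_mul (by norm_num), mul_comm γ⁻¹,
    Real.rpow_mul (by norm_num), Real.rpow_natCast, ← Real.mul_rpow hK0 (by positivity)]
  rw [← Real.rpow_rpow_inv (abs_nonneg (x n - x (n + 1))) h0.ne']
  exact Real.rpow_le_rpow (by positivity) (h1 n) (inv_pos.2 h0).le

theorem exists_limit_of_lintegral_sub_rpow_le {ι Ω : Type*} [DecidableEq ι] [MeasurableSpace Ω]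
    {P : Measure Ω} {γ : ℝ} (h0 : 0 < γ) {S : Finset ι → Ω → ℝ} (hS : ∀ F, Measurable (S F))
    {b : ι → ℝ≥0∞} (hb : ∑' i, b i ≠ ⊤)
    (h : ∀ F G, ∫⁻ ω, ENNReal.ofReal (|S F ω - S G ω| ^ γ) ∂P ≤ ∑ i ∈ symmDiff F G, b i) :
    ∃ U : Ω → ℝ, Measurable U ∧
      Tendsto (fun F => ∫⁻ ω, ENNReal.ofReal (|S F ω - U ω| ^ γ) ∂P) atTop (𝓝 0) := by
  have htail := ENNReal.tendsto_tsum_compl_atTop_zero hb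
  have hle : ∀ F G H, H ⊆ F → H ⊆ G →
      ∫⁻ ω, ENNReal.ofReal (|S F ω - S G ω| ^ γ) ∂P ≤ ∑' i : {i // i ∉ H}, b i := by
    intro F G H hF hG
    refine (h F G).trans ?_
    rw [← Finset.tsum_subtype]
    refine ENNReal.tsum_mono_subtype b fun i hi => ?_
    simp only [Finset.mem_coe, Finset.mem_symmDiff] at hi
    change i ∉ H
    intro hH
    rcases hi with hi | hi
    · exact hi.2 (hG hH)
    · exact hi.2 (hF hH)
  have hex : ∀ n : ℕ, ∃ H : Finset ι, ∑' i : {i // i ∉ H}, b i ≤ (4⁻¹ : ℝ≥0∞) ^ n := fun n =>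
    ((tendsto_order.1 htail).2 _ (ENNReal.pow_pos (by simp) n)).exists.imp
      fun H hH => le_of_lt hH
  choose H hH using hex
  set G : ℕ → Finset ι := fun n => (Finset.range (n + 1)).biUnion H with hG
  have hGmono : Monotone G := fun m n hmn => Finset.biUnion_subset_biUnion_of_subset_left _
    (Finset.range_mono (by omega))
  have hHG : ∀ n, H n ⊆ G n := fun n => Finset.subset_biUnion_of_mem H (by simp)
  have hm : ∀ F G, Measurable fun ω => ENNReal.ofReal (|S F ω - S G ω| ^ γ) := fun F G => by
    have := hS F
    have := hS G
    fun_prop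
  have hcauchy : ∀ᵐ ω ∂P, ∃ l, Tendsto (fun n => S (G n) ω) atTop (𝓝 l) := by
    have h1 : ∫⁻ ω, ∑' n, 2 ^ n * ENNReal.ofReal (|S (G n) ω - S (G (n + 1)) ω| ^ γ) ∂P ≠ ⊤ := by
      rw [lintegral_tsum fun n => ((hm _ _).const_mul _).aemeasurable]
      refine ne_top_of_le_ne_top (b := ∑' n : ℕ, (2⁻¹ : ℝ≥0∞) ^ n) ?_ ?_
      · rw [ENNReal.tsum_geometric]
        simp [ENNReal.one_sub_inv_two]
      · refine ENNReal.tsum_le_tsum fun n => ?_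
        rw [lintegral_const_mul _ (hm _ _)]
        have h2 := (hle (G n) (G (n + 1)) (H n) (hHG n)
          ((hHG n).trans (hGmono n.le_succ))).trans (hH n)
        calc 2 ^ n * ∫⁻ ω, ENNReal.ofReal (|S (G n) ω - S (G (n + 1)) ω| ^ γ) ∂P
            ≤ 2 ^ n * (4⁻¹ : ℝ≥0∞) ^ n := by gcongr
          _ = (2⁻¹ : ℝ≥0∞) ^ n := by
              rw [← mul_pow]
              congr 1
              rw [show (4 : ℝ≥0∞) = 2 * 2 by norm_num,
                ENNReal.mul_inv (by simp) (by simp), ← mul_assoc,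
                ENNReal.mul_inv_cancel (by simp) (by simp), one_mul]
    have h3 : Measurable fun ω =>
        ∑' n, 2 ^ n * ENNReal.ofReal (|S (G n) ω - S (G (n + 1)) ω| ^ γ) :=
      Measurable.tsum fun n => (hm _ _).const_mul _
    filter_upwards [ae_lt_top h3 h1] with ω hω
    exact cauchySeq_tendsto_of_complete (cauchySeq_of_tsum_rpow_ne_top h0 hω.ne)
  obtain ⟨U, hU, hlim⟩ := measurable_limit_of_tendsto_metrizable_ae
    (fun n => (hS (G n)).aemeasurable) hcauchy
  refine ⟨U, hU, ?_⟩
  rw [ENNReal.tendsto_nhds_zero]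
  intro ε hε
  obtain ⟨n, hn⟩ : ∃ n : ℕ, (4⁻¹ : ℝ≥0∞) ^ n ≤ ε :=
    (((ENNReal.tendsto_pow_atTop_nhds_zero_of_lt_one (by simp)).eventually_lt_const hε).exists).imp
      fun n hn => le_of_lt hn
  filter_upwards [eventually_ge_atTop (H n)] with F hF
  calc ∫⁻ ω, ENNReal.ofReal (|S F ω - U ω| ^ γ) ∂P
      ≤ ∫⁻ ω, liminf (fun k => ENNReal.ofReal (|S F ω - S (G k) ω| ^ γ)) atTop ∂P := by
        refine lintegral_mono_ae (hlim.mono fun ω hω => ?_)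
        have hc : Continuous fun x : ℝ => ENNReal.ofReal (|S F ω - x| ^ γ) :=
          ENNReal.continuous_ofReal.comp
            (((continuous_const.sub continuous_id).abs).rpow_const fun _ => Or.inr h0.le)
        exact (((hc.tendsto _).comp hω).liminf_eq).ge
    _ ≤ liminf (fun k => ∫⁻ ω, ENNReal.ofReal (|S F ω - S (G k) ω| ^ γ) ∂P) atTop :=
        lintegral_liminf_le fun k => hm _ _
    _ ≤ (4⁻¹ : ℝ≥0∞) ^ n := by
        refine liminf_le_of_frequently_le' (Eventually.frequently ?_)
        filter_upwards [eventually_ge_atTop n] with k hk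
        exact (hle _ _ (H n) hF ((hHG n).trans (hGmono hk))).trans (hH n)
    _ ≤ ε := hn

/-! ### Moments of the weights of the particles alive -/

section Discounted

/-- The `γ`-th power of the weight of a particle, discounted at rate `r` until its birth. -/
def discountedWeight (γ r : ℝ) (u : List ℕ) (ω : Tree) : ℝ≥0∞ :=
  (pathWeight u ω : ℝ≥0∞) ^ γ * ENNReal.ofReal (Real.exp (-r * birthTime treeE u ω))

/-- The factor by which the `j`-th child of a particle is discounted. -/
def discountFactor (γ r : ℝ) (j : ℕ) (d : Driver) : ℝ≥0∞ :=
  (d.1.1 j : ℝ≥0∞) ^ γ * ENNReal.ofReal (Real.exp (-r * d.1.2))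

theorem measurable_discountedWeight (γ r : ℝ) (u : List ℕ) :
    Measurable (discountedWeight γ r u) := by
  have h1 := measurable_pathWeight u
  have h2 := measurable_birthTime u
  unfold discountedWeight
  fun_prop

theorem measurable_discountFactor (γ r : ℝ) (j : ℕ) : Measurable (discountFactor γ r j) := by
  unfold discountFactor
  fun_prop

theorem discountedWeight_nil (γ r : ℝ) (ω : Tree) : discountedWeight γ r [] ω = 1 := by
  simp [discountedWeight, pathWeight]

theorem discountedWeight_cons {γ : ℝ} (h0 : 0 ≤ γ) (r : ℝ) (j : ℕ) (v : List ℕ) (ω : Tree) :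
    discountedWeight γ r (j :: v) ω =
      discountFactor γ r j (ω []) * discountedWeight γ r v (subtree j ω) := by
  simp only [discountedWeight, discountFactor]
  rw [birthTime_cons, pathWeight, ENNReal.coe_mul, ENNReal.mul_rpow_of_nonneg _ _ h0, mul_add,
    Real.exp_add, ENNReal.ofReal_mul (Real.exp_nonneg _)]
  exact mul_mul_mul_comm _ _ _ _

theorem ofReal_abs_aliveWeight_rpow_le {γ r : ℝ} (h0 : 0 < γ) (hr : 0 ≤ r) (t : ℝ) (u : List ℕ)
    (ω : Tree) : ENNReal.ofReal (|aliveWeight t u ω| ^ γ) ≤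
      ENNReal.ofReal (Real.exp (r * t)) * discountedWeight γ r u ω := by
  rw [aliveWeight]
  split_ifs with h
  · rw [NNReal.abs_eq, ← ENNReal.ofReal_rpow_of_nonneg NNReal.zero_le_coe h0.le,
      ENNReal.ofReal_coe_nnreal, discountedWeight, mul_left_comm, ← ENNReal.ofReal_mul
      (Real.exp_nonneg _), ← Real.exp_add]
    refine le_mul_of_one_le_right zero_le ?_
    rw [ENNReal.one_le_ofReal, Real.one_le_exp_iff]
    nlinarith [h.1]
  · simp [Real.zero_rpow h0.ne']

theorem lintegral_exp_neg_mul_expMeasure_le {r : ℝ} (hr : 0 < r) :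
    ∫⁻ e, ENNReal.ofReal (Real.exp (-r * e)) ∂(expMeasure 1) ≤ ENNReal.ofReal r⁻¹ := by
  refine (lintegral_mono' expMeasure_le le_rfl).trans ?_
  rw [← ofReal_integral_eq_lintegral_ofReal (integrableOn_exp_mul_Ioi (by linarith) 0)
    (ae_of_all _ fun e => Real.exp_nonneg _), integral_exp_mul_Ioi (by linarith)]
  refine ENNReal.ofReal_le_ofReal (le_of_eq ?_)
  simp [neg_div_neg_eq]

variable (α : Measure (ℕ → ℝ≥0)) (μ₀ : ProbabilityMeasure ℝ) [IsProbabilityMeasure α]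

theorem lintegral_discountedWeight_cons {γ : ℝ} (h0 : 0 ≤ γ) (r : ℝ) (j : ℕ) (v : List ℕ) :
    ∫⁻ ω, discountedWeight γ r (j :: v) ω ∂(treeLaw α μ₀) =
      (∫⁻ d, discountFactor γ r j d ∂(driverLaw α μ₀)) *
        ∫⁻ ω, discountedWeight γ r v ω ∂(treeLaw α μ₀) := by
  have h1 := measurable_discountFactor γ r j
  have h2 := measurable_discountedWeight γ r v
  have h3 : Measurable fun ω : Tree => (ω [], subtree j ω) :=
    (measurable_pi_apply _).prodMk (measurable_subtree j)
  rw [← lintegral_prod_mul h1.aemeasurable h2.aemeasurable, ← map_root_subtree α μ₀ j,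
    lintegral_map (by fun_prop) h3]
  exact lintegral_congr fun ω => discountedWeight_cons h0 r j v ω

variable (hα : ∀ᵐ a ∂α, ∃ n, ∀ j, n ≤ j → a j = 0)

omit [IsProbabilityMeasure α] in
include hα in
theorem exists_sum_discountFactor_le {γ : ℝ} (h0 : 0 < γ)
    (hm : ∫⁻ a, ∑ j ∈ Finset.range (numWeights a), (a j : ℝ≥0∞) ^ γ ∂α ≠ ⊤) :
    ∃ r : ℝ, 0 < r ∧ ∀ n,
      ∑ j ∈ Finset.range n, ∫⁻ d, discountFactor γ r j d ∂(driverLaw α μ₀) ≤ 2⁻¹ := by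
  set m := ∫⁻ a, ∑ j ∈ Finset.range (numWeights a), (a j : ℝ≥0∞) ^ γ ∂α with hmdef
  have hr : 0 < 2 * m.toReal + 1 := by positivity
  refine ⟨2 * m.toReal + 1, hr, fun n => ?_⟩
  set r := 2 * m.toReal + 1 with hrdef
  have hc : ∀ j, ∫⁻ d, discountFactor γ r j d ∂(driverLaw α μ₀) ≤
      (∫⁻ a, (a j : ℝ≥0∞) ^ γ ∂α) * ENNReal.ofReal r⁻¹ := fun j => by
    have h1 : (driverLaw α μ₀).map Prod.fst = α.prod (expMeasure 1) := by
      rw [driverLaw, Measure.map_fst_prod, measure_univ, one_smul]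
    have h2 : ∫⁻ d, discountFactor γ r j d ∂(driverLaw α μ₀) =
        ∫⁻ p : (ℕ → ℝ≥0) × ℝ, (p.1 j : ℝ≥0∞) ^ γ * ENNReal.ofReal (Real.exp (-r * p.2))
          ∂(α.prod (expMeasure 1)) := by
      rw [← h1, lintegral_map (by fun_prop) measurable_fst]
      rfl
    rw [h2, lintegral_prod_mul (f := fun a : ℕ → ℝ≥0 => (a j : ℝ≥0∞) ^ γ)
      (g := fun e => ENNReal.ofReal (Real.exp (-r * e)))
      (Measurable.aemeasurable (by fun_prop)) (by fun_prop)]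
    gcongr
    exact lintegral_exp_neg_mul_expMeasure_le hr
  have hsum : ∑ j ∈ Finset.range n, ∫⁻ a, (a j : ℝ≥0∞) ^ γ ∂α ≤ m := by
    rw [← lintegral_finsetSum _ fun j _ => by fun_prop]
    refine lintegral_mono_ae ?_
    filter_upwards [hα] with a ha
    have hz : ∀ j, numWeights a ≤ j → a j = 0 := Nat.sInf_mem ha
    refine Finset.sum_le_sum_of_ne_zero fun j _ hj => ?_
    rw [Finset.mem_range]
    by_contra hlt
    exact hj (by rw [hz j (not_lt.1 hlt), ENNReal.coe_zero, ENNReal.zero_rpow_of_pos h0])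
  calc ∑ j ∈ Finset.range n, ∫⁻ d, discountFactor γ r j d ∂(driverLaw α μ₀)
      ≤ (∑ j ∈ Finset.range n, ∫⁻ a, (a j : ℝ≥0∞) ^ γ ∂α) * ENNReal.ofReal r⁻¹ := by
        rw [Finset.sum_mul]
        exact Finset.sum_le_sum fun j _ => hc j
    _ ≤ m * ENNReal.ofReal r⁻¹ := by gcongr
    _ = ENNReal.ofReal (m.toReal * r⁻¹) := by
        rw [ENNReal.ofReal_mul ENNReal.toReal_nonneg, ENNReal.ofReal_toReal hm]
    _ ≤ ENNReal.ofReal 2⁻¹ := by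
        refine ENNReal.ofReal_le_ofReal ?_
        rw [← div_eq_mul_inv, div_le_iff₀ hr]
        linarith
    _ = 2⁻¹ := by
        rw [ENNReal.ofReal_inv_of_pos zero_lt_two, ENNReal.ofReal_ofNat]

theorem sum_discountedWeight_le {γ r : ℝ} (h0 : 0 ≤ γ)
    (h : ∀ n, ∑ j ∈ Finset.range n, ∫⁻ d, discountFactor γ r j d ∂(driverLaw α μ₀) ≤ 2⁻¹)
    (F : Finset (List ℕ)) :
    ∑ u ∈ F, ∫⁻ ω, discountedWeight γ r u ω ∂(treeLaw α μ₀) ≤ 2 := by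
  obtain ⟨k, hk⟩ : ∃ k, ∀ u ∈ F, u.length < k :=
    ⟨F.sup List.length + 1, fun u hu => Nat.lt_succ_of_le (Finset.le_sup (f := List.length) hu)⟩
  induction k generalizing F with
  | zero =>
    rw [Finset.eq_empty_of_forall_notMem fun u hu => absurd (hk u hu) (Nat.not_lt_zero _)]
    simp
  | succ k ih =>
    obtain ⟨n, hn⟩ := exists_bound_heads F
    rw [sum_eq_add_sum_tailSet F _ n fun j v hj hmem => absurd hmem (hn j v hj)]
    have h1 : (if [] ∈ F then ∫⁻ ω, discountedWeight γ r [] ω ∂(treeLaw α μ₀) else 0) ≤ 1 := by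
      split_ifs
      · simp [discountedWeight_nil]
      · exact zero_le
    have h2 : ∀ j ∈ Finset.range n,
        ∑ v ∈ tailSet F j, ∫⁻ ω, discountedWeight γ r (j :: v) ω ∂(treeLaw α μ₀) ≤
          (∫⁻ d, discountFactor γ r j d ∂(driverLaw α μ₀)) * 2 := fun j _ => by
      simp_rw [lintegral_discountedWeight_cons α μ₀ h0]
      rw [← Finset.mul_sum]
      gcongr
      refine ih _ fun v hv => ?_
      simpa using hk _ (mem_tailSet.1 hv)
    calc _ ≤ 1 + ∑ j ∈ Finset.range n, (∫⁻ d, discountFactor γ r j d ∂(driverLaw α μ₀)) * 2 :=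
          add_le_add h1 (Finset.sum_le_sum h2)
      _ ≤ 1 + 2⁻¹ * 2 := by
          rw [← Finset.sum_mul]
          gcongr
          exact h n
      _ = 2 := by
          rw [ENNReal.inv_mul_cancel (by simp) (by simp)]
          norm_num

include hα in
theorem exists_tsum_aliveWeight_le {γ : ℝ} (h0 : 0 < γ)
    (hm : ∫⁻ a, ∑ j ∈ Finset.range (numWeights a), (a j : ℝ≥0∞) ^ γ ∂α ≠ ⊤) :
    ∃ r : ℝ, 0 < r ∧ ∀ t : ℝ,
      ∑' u, ∫⁻ ω, ENNReal.ofReal (|aliveWeight t u ω| ^ γ) ∂(treeLaw α μ₀) ≤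
        ENNReal.ofReal (Real.exp (r * t)) * 2 := by
  obtain ⟨r, hr, h⟩ := exists_sum_discountFactor_le α μ₀ hα h0 hm
  refine ⟨r, hr, fun t => ?_⟩
  rw [ENNReal.tsum_eq_iSup_sum]
  refine iSup_le fun F => ?_
  calc ∑ u ∈ F, ∫⁻ ω, ENNReal.ofReal (|aliveWeight t u ω| ^ γ) ∂(treeLaw α μ₀)
      ≤ ∑ u ∈ F, ENNReal.ofReal (Real.exp (r * t)) *
          ∫⁻ ω, discountedWeight γ r u ω ∂(treeLaw α μ₀) := by
        refine Finset.sum_le_sum fun u _ => ?_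
        rw [← lintegral_const_mul _ (measurable_discountedWeight γ r u)]
        exact lintegral_mono fun ω => ofReal_abs_aliveWeight_rpow_le h0 hr.le t u ω
    _ ≤ _ := by
        rw [← Finset.mul_sum]
        gcongr
        exact sum_discountedWeight_le α μ₀ h0.le h F

end Discounted

/-! ### The solution in the class of measures with locally bounded moments -/

section Moments

variable (α : Measure (ℕ → ℝ≥0)) (μ₀ : ProbabilityMeasure ℝ) [IsProbabilityMeasure α]

theorem pathWeight_congr {ω η : Tree} (h : ∀ u, treeA u ω = treeA u η) (u : List ℕ) :
    pathWeight u ω = pathWeight u η := by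
  induction u generalizing ω η with
  | nil => rfl
  | cons j v ih =>
    rw [pathWeight, pathWeight, h, ih (ω := subtree j ω) (η := subtree j η) fun w => h (j :: w)]

theorem aliveWeight_congr {ω η : Tree} (h : ∀ u, (ω u).1 = (η u).1) (t : ℝ) (u : List ℕ) :
    aliveWeight t u ω = aliveWeight t u η := by
  have h1 : ∀ v, treeE v ω = treeE v η := fun v => congrArg Prod.snd (h v)
  have h2 : birthTime treeE u ω = birthTime treeE u η := by simp only [birthTime, h1]
  rw [aliveWeight, aliveWeight, h1, h2, pathWeight_congr fun v => congrArg Prod.fst (h v)]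

theorem measurable_aliveWeight_const (t : ℝ) (u : List ℕ) : Measurable (aliveWeight t u) :=
  Measurable.of_uncurry_left (f := fun t ω => aliveWeight t u ω) (measurable_aliveWeight u)

theorem treeLaw_eq_map_zip :
    treeLaw α μ₀ = ((Measure.infinitePi fun _ : List ℕ => α.prod (expMeasure 1)).prod
      (Measure.infinitePi fun _ : List ℕ => (μ₀ : Measure ℝ))).map fun p u => (p.1 u, p.2 u) :=
  (infinitePi_map_zip (fun _ : List ℕ => α.prod (expMeasure 1))
    fun _ => (μ₀ : Measure ℝ)).symm

theorem lintegral_abs_sum_aliveWeight_rpow_le {γ : ℝ} (h0 : 0 < γ) (h2 : γ ≤ 2)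
    (hμ₀ : μ₀ ∈ MomentClass γ) (t : ℝ) (σ : List ℕ → ℝ) (hσ : ∀ u, |σ u| = 1)
    (F : Finset (List ℕ)) :
    ∫⁻ ω, ENNReal.ofReal (|∑ u ∈ F, σ u * aliveWeight t u ω * treeX u ω| ^ γ) ∂(treeLaw α μ₀) ≤
      ∑ u ∈ F, 6 * absMoment γ μ₀ *
        ∫⁻ ω, ENNReal.ofReal (|aliveWeight t u ω| ^ γ) ∂(treeLaw α μ₀) := by
  set Q := Measure.infinitePi fun _ : List ℕ => α.prod (expMeasure 1) with hQ
  set Y := Measure.infinitePi fun _ : List ℕ => (μ₀ : Measure ℝ) with hY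
  set w : List ℕ → (List ℕ → (ℕ → ℝ≥0) × ℝ) → ℝ := fun u q =>
    aliveWeight t u fun v => (q v, 0) with hw
  have hzip : Measurable fun (p : (List ℕ → (ℕ → ℝ≥0) × ℝ) × (List ℕ → ℝ)) (u : List ℕ) =>
    (p.1 u, p.2 u) := by fun_prop
  have hwm : ∀ u, Measurable (w u) := fun u =>
    (measurable_aliveWeight_const t u).comp (by fun_prop)
  have ha := fun u => measurable_aliveWeight_const t u
  have hX := measurable_treeX
  have hwz : ∀ u (p : (List ℕ → (ℕ → ℝ≥0) × ℝ) × (List ℕ → ℝ)),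
      aliveWeight t u (fun v => (p.1 v, p.2 v)) = w u p.1 := fun u p =>
    aliveWeight_congr (ω := fun v => (p.1 v, p.2 v)) (η := fun v => (p.1 v, 0)) (fun _ => rfl) t u
  have hb : ∀ u, ∫⁻ ω, ENNReal.ofReal (|aliveWeight t u ω| ^ γ) ∂(treeLaw α μ₀) =
      ∫⁻ q, ENNReal.ofReal (|w u q| ^ γ) ∂Q := fun u => by
    rw [treeLaw_eq_map_zip, lintegral_map (by fun_prop) hzip]
    simp only [hwz]
    have := hwm u
    rw [lintegral_prod _ (by fun_prop)]
    simp [hQ]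
  have hind : iIndepFun (fun (u : List ℕ) (y : List ℕ → ℝ) => y u) Y :=
    iIndepFun_infinitePi (X := fun _ x => x) fun _ => measurable_id
  have hlaw : ∀ u : List ℕ, Y.map (fun y => y u) = μ₀ := fun u =>
    Measure.infinitePi_map_eval (fun _ : List ℕ => (μ₀ : Measure ℝ)) u
  simp_rw [hb]
  rw [treeLaw_eq_map_zip, lintegral_map (by fun_prop) hzip]
  simp only [hwz]
  calc ∫⁻ p : (List ℕ → (ℕ → ℝ≥0) × ℝ) × (List ℕ → ℝ),
        ENNReal.ofReal (|∑ u ∈ F, σ u * w u p.1 * p.2 u| ^ γ) ∂(Q.prod Y)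
      = ∫⁻ q, ∫⁻ y, ENNReal.ofReal (|∑ u ∈ F, σ u * w u q * y u| ^ γ) ∂Y ∂Q :=
        lintegral_prod _ (by fun_prop)
    _ ≤ ∫⁻ q, 6 * absMoment γ μ₀ * ∑ u ∈ F, ENNReal.ofReal (|w u q| ^ γ) ∂Q := by
        refine lintegral_mono fun q => ?_
        have := lintegral_abs_sum_rpow_le h0 h2 hμ₀ (fun u => measurable_pi_apply u) hind hlaw
          (fun u => σ u * w u q) F
        simpa only [abs_mul, hσ, one_mul] using this
    _ = _ := by
        rw [lintegral_const_mul _ (by fun_prop), lintegral_finsetSum _ fun u _ => by fun_prop,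
          Finset.mul_sum]

theorem lintegral_abs_partialSum_sub_rpow_le {γ : ℝ} (h0 : 0 < γ) (h2 : γ ≤ 2)
    (hμ₀ : μ₀ ∈ MomentClass γ) (t : ℝ) (F G : Finset (List ℕ)) :
    ∫⁻ ω, ENNReal.ofReal (|partialSum treeA treeE treeX t F ω -
        partialSum treeA treeE treeX t G ω| ^ γ) ∂(treeLaw α μ₀) ≤
      ∑ u ∈ symmDiff F G, 6 * absMoment γ μ₀ *
        ∫⁻ ω, ENNReal.ofReal (|aliveWeight t u ω| ^ γ) ∂(treeLaw α μ₀) := by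
  set σ : List ℕ → ℝ := fun u => if u ∈ F then 1 else -1 with hσ
  have hσ1 : ∀ u, |σ u| = 1 := fun u => by
    simp only [hσ]
    split_ifs <;> simp
  refine le_trans (le_of_eq (lintegral_congr fun ω => ?_))
    (lintegral_abs_sum_aliveWeight_rpow_le α μ₀ h0 h2 hμ₀ t σ hσ1 (symmDiff F G))
  congr 3
  have hd : Disjoint (F \ G) (G \ F) := disjoint_sdiff_sdiff
  have h3 : ∑ u ∈ F \ G, σ u * aliveWeight t u ω * treeX u ω =
      ∑ u ∈ F \ G, aliveWeight t u ω * treeX u ω :=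
    Finset.sum_congr rfl fun u hu => by
      simp only [hσ, if_pos (Finset.mem_sdiff.1 hu).1, one_mul]
  have h4 : ∑ u ∈ G \ F, σ u * aliveWeight t u ω * treeX u ω =
      -∑ u ∈ G \ F, aliveWeight t u ω * treeX u ω := by
    rw [← Finset.sum_neg_distrib]
    exact Finset.sum_congr rfl fun u hu => by
      simp only [hσ, if_neg (Finset.mem_sdiff.1 hu).2]
      ring
  rw [partialSum_tree, partialSum_tree, symmDiff, Finset.sup_eq_union, Finset.sum_union hd, h3, h4,
    ← sub_eq_add_neg, Finset.sum_sdiff_sub_sum_sdiff]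

theorem eLpNorm_ofReal_eq {Ω : Type*} [MeasurableSpace Ω] {P : Measure Ω} {γ : ℝ} (h0 : 0 < γ)
    (f : Ω → ℝ) :
    eLpNorm f (ENNReal.ofReal γ) P = (∫⁻ ω, ENNReal.ofReal (|f ω| ^ γ) ∂P) ^ (1 / γ) := by
  rw [eLpNorm_eq_lintegral_rpow_enorm_toReal (by simpa using h0) ENNReal.ofReal_ne_top,
    ENNReal.toReal_ofReal h0.le]
  congr 1
  refine lintegral_congr fun ω => ?_
  rw [Real.enorm_eq_ofReal_abs, ENNReal.ofReal_rpow_of_nonneg (abs_nonneg _) h0.le]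

variable (hα : ∀ᵐ a ∂α, ∃ n, ∀ j, n ≤ j → a j = 0)

include hα in
/-- The solution given by the branching random walk under the moment assumption. -/
theorem exists_solution_of_moment {γ : ℝ} (h0 : 0 < γ) (h2 : γ ≤ 2) (hμ₀ : μ₀ ∈ MomentClass γ)
    (hm : ∫⁻ a, ∑ j ∈ Finset.range (numWeights a), (a j : ℝ≥0∞) ^ γ ∂α ≠ ⊤) :
    ∃ μ : ℝ≥0 → ProbabilityMeasure ℝ, IsSolution α id μ₀ μ ∧ LocallyBoundedMoment γ μ ∧
      ∀ t : ℝ≥0, ∃ U : Tree → ℝ, Measurable U ∧ HasLaw U (μ t : Measure ℝ) (treeLaw α μ₀) ∧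
        Tendsto (fun F => eLpNorm (fun ω => partialSum treeA treeE treeX t F ω - U ω)
          (ENNReal.ofReal γ) (treeLaw α μ₀)) atTop (𝓝 0) := by
  obtain ⟨r, hr, hsum⟩ := exists_tsum_aliveWeight_le α μ₀ hα h0 hm
  set b : ℝ → List ℕ → ℝ≥0∞ := fun t u => 6 * absMoment γ μ₀ *
    ∫⁻ ω, ENNReal.ofReal (|aliveWeight t u ω| ^ γ) ∂(treeLaw α μ₀) with hb
  set B : ℝ → ℝ≥0∞ := fun t =>
    6 * absMoment γ μ₀ * (ENNReal.ofReal (Real.exp (r * t)) * 2) with hB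
  have hBtop : ∀ t, B t ≠ ⊤ := fun t =>
    ENNReal.mul_ne_top (ENNReal.mul_ne_top (by simp) hμ₀.1.ne)
      (ENNReal.mul_ne_top ENNReal.ofReal_ne_top (by simp))
  have hbB : ∀ t, ∑' u, b t u ≤ B t := fun t => by
    rw [ENNReal.tsum_mul_left]
    exact mul_le_mul_right (hsum t) _
  choose U hU hlim using fun t : ℝ => exists_limit_of_lintegral_sub_rpow_le h0
    (fun F => measurable_partialSum t F) (ne_top_of_le_ne_top (hBtop t) (hbB t))
    (lintegral_abs_partialSum_sub_rpow_le α μ₀ h0 h2 hμ₀ t)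
  have hlimp : ∀ t : ℝ, Tendsto (fun F => eLpNorm (fun ω =>
      partialSum treeA treeE treeX t F ω - U t ω) (ENNReal.ofReal γ) (treeLaw α μ₀)) atTop (𝓝 0) :=
    fun t => by
      simp_rw [eLpNorm_ofReal_eq h0]
      have := (hlim t).ennrpow_const (1 / γ)
      rwa [ENNReal.zero_rpow_of_pos (by positivity)] at this
  have hmom : ∀ t : ℝ, ∫⁻ ω, ENNReal.ofReal (|U t ω| ^ γ) ∂(treeLaw α μ₀) ≤ 4 * 1 + 4 * B t := by
    intro t
    obtain ⟨F, hF⟩ := ((hlim t).eventually_le_const zero_lt_one).exists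
    have hS := measurable_partialSum t F
    have hUt := hU t
    have h3 : ∫⁻ ω, ENNReal.ofReal (|partialSum treeA treeE treeX t F ω| ^ γ) ∂(treeLaw α μ₀) ≤
        B t := by
      have h4 := lintegral_abs_partialSum_sub_rpow_le α μ₀ h0 h2 hμ₀ t F ∅
      simp only [partialSum_tree, Finset.sum_empty, sub_zero] at h4 ⊢
      exact h4.trans ((ENNReal.sum_le_tsum _).trans (hbB t))
    calc ∫⁻ ω, ENNReal.ofReal (|U t ω| ^ γ) ∂(treeLaw α μ₀)
        ≤ ∫⁻ ω, (4 * ENNReal.ofReal (|partialSum treeA treeE treeX t F ω - U t ω| ^ γ) +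
            4 * ENNReal.ofReal (|partialSum treeA treeE treeX t F ω| ^ γ)) ∂(treeLaw α μ₀) := by
          refine lintegral_mono fun ω => ?_
          have h5 := abs_add_rpow_le_four h0 h2 (U t ω - partialSum treeA treeE treeX t F ω)
            (partialSum treeA treeE treeX t F ω)
          rw [sub_add_cancel, abs_sub_comm] at h5
          refine (ENNReal.ofReal_le_ofReal h5).trans (le_of_eq ?_)
          rw [ENNReal.ofReal_add (by positivity) (by positivity),
            ENNReal.ofReal_mul (by norm_num), ENNReal.ofReal_mul (by norm_num)]
          simp
      _ ≤ 4 * 1 + 4 * B t := by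
          rw [lintegral_add_left (by fun_prop), lintegral_const_mul _ (by fun_prop),
            lintegral_const_mul _ (by fun_prop)]
          gcongr
  refine ⟨fun t => ⟨(treeLaw α μ₀).map (U t), Measure.isProbabilityMeasure_map
    (hU t).aemeasurable⟩, ?_, fun t => ?_, fun t => ⟨U t, hU t, ⟨(hU t).aemeasurable, rfl⟩,
    hlimp t⟩⟩
  · refine isSolution_of_tendsto_partialLaw α μ₀ hα fun t => ?_
    have h3 : TendstoInMeasure (treeLaw α μ₀) (fun F => partialSum treeA treeE treeX t F) atTop
        (U t) :=
      tendstoInMeasure_of_tendsto_eLpNorm (p := ENNReal.ofReal γ) (by simpa using h0)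
        (fun F => (measurable_partialSum t F).aestronglyMeasurable)
        (hU t).aestronglyMeasurable (hlimp t)
    exact (h3.tendstoInDistribution fun F => (measurable_partialSum t F).aemeasurable).tendsto
  · refine lt_of_le_of_lt (b := 4 * 1 + 4 * B t) (iSup₂_le fun s hs => ?_) ?_
    · have h3 : absMoment γ ((treeLaw α μ₀).map (U s)) =
          ∫⁻ ω, ENNReal.ofReal (|U s ω| ^ γ) ∂(treeLaw α μ₀) :=
        lintegral_map (measurable_ofReal_abs_rpow γ) (hU s)
      refine h3.le.trans ((hmom s).trans ?_)
      have h4 : Real.exp (r * s) ≤ Real.exp (r * t) :=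
        Real.exp_le_exp.2 (mul_le_mul_of_nonneg_left (NNReal.coe_le_coe.2 hs.2) hr.le)
      simp only [hB]
      gcongr
    · exact lt_top_iff_ne_top.2 (ENNReal.add_ne_top.2 ⟨by simp,
        ENNReal.mul_ne_top (by simp) (hBtop t)⟩)

end Moments

/-! ### Transfer to and from the canonical space -/

section Transfer

variable {Ω₀ : Type*} [MeasurableSpace Ω₀] {P₀ : Measure Ω₀} [IsProbabilityMeasure P₀]
  {A : Ω₀ → ℕ → ℝ≥0} (hA : Measurable A)

include hA

theorem smoothing_map_id (μ : ProbabilityMeasure ℝ) :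
    smoothing (P₀.map A) id μ = smoothing P₀ A μ := by
  have h1 : (P₀.map A).prod (Measure.infinitePi fun _ : ℕ => (μ : Measure ℝ)) =
      (P₀.prod (Measure.infinitePi fun _ : ℕ => (μ : Measure ℝ))).map (Prod.map A id) := by
    rw [← Measure.map_prod_map _ _ hA measurable_id, Measure.map_id]
  rw [smoothing, h1]
  exact Measure.map_map measurable_weightedSum (hA.prodMap measurable_id)

theorem IsSolution.of_map_id {μ₀ : ProbabilityMeasure ℝ} {μ : ℝ≥0 → ProbabilityMeasure ℝ}
    (h : IsSolution (P₀.map A) id μ₀ μ) : IsSolution P₀ A μ₀ μ := by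
  refine ⟨h.initial, fun f t => ?_⟩
  rw [← smoothing_map_id hA]
  exact h.equation f t

omit [IsProbabilityMeasure P₀] in
theorem NonExplosion.map_id (h : NonExplosion P₀ A) : NonExplosion (P₀.map A) id := by
  intro δ h0 h1
  rw [← h δ h0 h1]
  refine lintegral_congr fun s => ?_
  have hm : Measurable fun a : ℕ → ℝ≥0 => s ^ numWeights a :=
    (measurable_from_nat (f := fun n : ℕ => s ^ n)).comp measurable_numWeights
  simp only [id]
  rw [integral_map hA.aemeasurable hm.aestronglyMeasurable]

omit [IsProbabilityMeasure P₀] in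
theorem ae_map_finite_weights (h : ∀ᵐ ω ∂P₀, ∃ n, ∀ j, n ≤ j → A ω j = 0) :
    ∀ᵐ a ∂(P₀.map A), ∃ n, ∀ j, n ≤ j → a j = 0 := by
  refine (ae_map_iff hA.aemeasurable ?_).2 h
  have : {a : ℕ → ℝ≥0 | ∃ n, ∀ j, n ≤ j → a j = 0} =
      ⋃ n, ⋂ j, ⋂ (_ : n ≤ j), {a | a j = 0} := by
    ext a
    simp
  rw [this]
  exact MeasurableSet.iUnion fun n => MeasurableSet.iInter fun j => MeasurableSet.iInter fun _ =>
    measurable_pi_apply j (measurableSet_singleton 0)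

omit [IsProbabilityMeasure P₀] in
theorem lintegral_map_ne_top_of_Phi {γ : ℝ} (h : Phi P₀ A γ < ⊤) :
    ∫⁻ a, ∑ j ∈ Finset.range (numWeights a), (a j : ℝ≥0∞) ^ γ ∂(P₀.map A) ≠ ⊤ := by
  have hm : Measurable fun a : ℕ → ℝ≥0 =>
      ∑ j ∈ Finset.range (numWeights a), (a j : ℝ≥0∞) ^ γ := measurable_sum_rpow measurable_id γ
  rw [lintegral_map hm hA]
  exact (lintegral_lt_top_of_Phi h).ne

omit hA [IsProbabilityMeasure P₀] in
theorem IsDrivingFamily.measurable_tree {Ω : Type*} [MeasurableSpace Ω] {μ₀ : ProbabilityMeasure ℝ}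
    {P : Measure Ω} {A' : List ℕ → Ω → ℕ → ℝ≥0} {E X : List ℕ → Ω → ℝ}
    (h : IsDrivingFamily P₀ A μ₀ P A' E X) :
    Measurable fun (ω : Ω) (u : List ℕ) => ((A' u ω, E u ω), X u ω) :=
  measurable_pi_lambda _ fun u =>
    ((h.measurable_A u).prodMk (h.measurable_E u)).prodMk (h.measurable_X u)

theorem IsDrivingFamily.hasLaw_tree {Ω : Type*} [MeasurableSpace Ω] {μ₀ : ProbabilityMeasure ℝ}
    {P : Measure Ω} [IsProbabilityMeasure P] {A' : List ℕ → Ω → ℕ → ℝ≥0}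
    {E X : List ℕ → Ω → ℝ} (h : IsDrivingFamily P₀ A μ₀ P A' E X) :
    HasLaw (fun (ω : Ω) (u : List ℕ) => ((A' u ω, E u ω), X u ω)) (treeLaw (P₀.map A) μ₀) P :=
  ⟨h.measurable_tree.aemeasurable, h.map_eq μ₀ hA⟩

end Transfer

end Kinetic

end

theorem theorem1 {Ω₀ : Type*} [MeasurableSpace Ω₀] (P₀ : Measure Ω₀) [IsProbabilityMeasure P₀]
    (A : Ω₀ → ℕ → ℝ≥0) (hA : Measurable A)
    (hN : ∀ᵐ ω ∂P₀, ∃ n, ∀ j, n ≤ j → A ω j = 0)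
    (μ₀ : ProbabilityMeasure ℝ) :
    (Kinetic.NonExplosion P₀ A →
      ∃ μ : ℝ≥0 → ProbabilityMeasure ℝ,
        Kinetic.IsSolution P₀ A μ₀ μ ∧
        (∀ ν : ℝ≥0 → ProbabilityMeasure ℝ, Kinetic.IsSolution P₀ A μ₀ ν → ν = μ) ∧
        ∀ (Ω : Type*) [MeasurableSpace Ω] (P : Measure Ω) [IsProbabilityMeasure P]
          (A' : List ℕ → Ω → ℕ → ℝ≥0) (E X : List ℕ → Ω → ℝ),
          Kinetic.IsDrivingFamily P₀ A μ₀ P A' E X →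
          ∀ t : ℝ≥0,
            (∀ᵐ ω ∂P, (Kinetic.alive A' E t ω).Finite) ∧
            HasLaw (Kinetic.finiteSum A' E X t) (μ t : Measure ℝ) P) ∧
    (∀ γ : ℝ, 0 < γ → γ ≤ 2 → μ₀ ∈ Kinetic.MomentClass γ → Kinetic.Phi P₀ A γ < ⊤ →
      ∃ μ : ℝ≥0 → ProbabilityMeasure ℝ,
        Kinetic.IsSolution P₀ A μ₀ μ ∧
        Kinetic.LocallyBoundedMoment γ μ ∧
        (∀ ν : ℝ≥0 → ProbabilityMeasure ℝ, Kinetic.IsSolution P₀ A μ₀ ν →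
          Kinetic.LocallyBoundedMoment γ ν → ν = μ) ∧
        ∀ (Ω : Type*) [MeasurableSpace Ω] (P : Measure Ω) [IsProbabilityMeasure P]
          (A' : List ℕ → Ω → ℕ → ℝ≥0) (E X : List ℕ → Ω → ℝ),
          Kinetic.IsDrivingFamily P₀ A μ₀ P A' E X →
          ∀ t : ℝ≥0, ∃ U : Ω → ℝ,
            HasLaw U (μ t : Measure ℝ) P ∧
            Tendsto (fun F : Finset (List ℕ) =>
              eLpNorm (fun ω => Kinetic.partialSum A' E X t F ω - U ω) (ENNReal.ofReal γ) P)
              atTop (𝓝 0)) := by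
  have hprob : IsProbabilityMeasure (P₀.map A) :=
    Measure.isProbabilityMeasure_map hA.aemeasurable
  have hα := Kinetic.ae_map_finite_weights hA hN
  refine ⟨fun hne => ?_, fun γ h0 h2 hμ₀ hΦ => ?_⟩
  · obtain ⟨μ, hμ, hlaw⟩ :=
      Kinetic.exists_solution_of_nonExplosion (P₀.map A) μ₀ hα (hne.map_id hA)
    refine ⟨μ, hμ.of_map_id hA, fun ν hν =>
      Kinetic.IsSolution.unique hA hne hν (hμ.of_map_id hA), ?_⟩
    intro Ω _ P _ A' E X hD t
    have hΞ := hD.hasLaw_tree hA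
    refine ⟨?_, (hlaw t).comp hΞ⟩
    have h := Kinetic.ae_finite_alive (P₀.map A) μ₀ hα (hne.map_id hA) t.2
    rw [← hΞ.map_eq] at h
    exact ae_of_ae_map hΞ.aemeasurable h
  · obtain ⟨μ, hμ, hmom, hlim⟩ := Kinetic.exists_solution_of_moment (P₀.map A) μ₀ hα h0 h2 hμ₀
      (Kinetic.lintegral_map_ne_top_of_Phi hA hΦ)
    refine ⟨μ, hμ.of_map_id hA, hmom, fun ν hν hνm =>
      Kinetic.IsSolution.unique_of_moment hA h0 h2 hμ₀ hΦ hν (hμ.of_map_id hA) hνm hmom, ?_⟩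
    intro Ω _ P _ A' E X hD t
    have hΞ := hD.hasLaw_tree hA
    obtain ⟨U, hU, hlaw, hconv⟩ := hlim t
    refine ⟨_, hlaw.comp hΞ, hconv.congr fun F => ?_⟩
    rw [← hΞ.map_eq]
    exact eLpNorm_map_measure
      ((Kinetic.measurable_partialSum t F).sub hU).aestronglyMeasurable hΞ.aemeasurable
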